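/- Let $S^2\subset\mathbb R^3$ be the unit sphere with surface measure $dx$ (total mass $4\pi$), and let $L^2(S^2)$, $L^2(S^2\times S^2)$ be the complex $L^2$ spaces, $\|\cdot\|_2$ their norms, $\|\cdot\|_{\mathrm{TR}}$ the trace (nuclear) norm of operators on $L^2(S^2)$. A space-time spherical random field is a family of real random variables $T(x,t)$, $(x,t)\in S^2\times\mathbb Z$, on a probability space, such that $(x,\omega)\mapsto T(x,t,\omega)$ is jointly measurable for each $t$. It is *isotropic stationary* if $\mathbb E\,T(x,t)=0$, $\mathbb E\,T(x,t)^2<\infty$ and $\mathbb E[T(x,t)T(y,s)]=\mathbb E[T(gx,t+h)T(gy,s+h)]$ for all $x,y\in S^2$, $g\in SO(3)$, $t,s,h\in\mathbb Z$. Put $r_t(x,y)=\mathbb E[T(x,t)T(y,0)]$ and assume that every $r_t$ is continuous on $S^2\times S^2$; let $\mathscr R_t$ be the operator $(\mathscr R_t h)(x)=\int_{S^2} r_t(x,y)h(y)\,dy$ on $L^2(S^2)$. Consider the conditions (i) $\sum_{t\in\mathbb Z}\|r_t\|_2<\infty$; (ii) $\sum_{t\in\mathbb Z}\|\mathscr R_t\|_{\mathrm{TR}}<\infty$.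 Under (i) the spectral density kernel is $f_\lambda=\frac1{2\pi}\sum_{t\in\mathbb Z}e^{-i\lambda t}r_t$ (convergence in $\|\cdot\|_2$); under (ii) the spectral density operator is $\mathscr F_\lambda=\frac1{2\pi}\sum_{t\in\mathbb Z}e^{-i\lambda t}\mathscr R_t$ (convergence in $\|\cdot\|_{\mathrm{TR}}$), $\lambda\in[-\pi,\pi]$. Spherical harmonics of degree $\ell$ are the restrictions to $S^2$ of homogeneous harmonic polynomials of degree $\ell$ (spanned by $Y_{\ell,m}$, $|m|\le\ell$), and $P_\ell$ is the Legendre polynomial. A jointly measurable field $Z$ is a *spherical white noise*, $Z\sim\mathrm{SWN}(0,\{C_\ell\})$, $C_\ell\ge0$, if $\mathbb E\,Z(x,t)=0$, $\mathbb E\,Z(x,t)^2<\infty$, $\mathbb E[Z(x,t)Z(y,t)]=\sum_{\ell\ge0}\frac{2\ell+1}{4\pi}C_\ell P_\ell(\langle x,y\rangle)$ with $\sum_\ell\frac{2\ell+1}{4\pi}C_\ell<\infty$, and for $t\ne s$ all harmonic coefficients $\int Z(x,t)\overline{Y_{\ell,m}(x)}\,dx$ and $\int Z(x,s)\overline{Y_{\ell',m'}(x)}\,dx$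 are uncorrelated. A field $T$ with $T(\cdot,t)\in L^2(S^2)$ almost surely is a $\mathrm{SPHAR}(p)$ process driven by $Z$ if $$T(x,t)=\sum_{j=1}^p(\Phi_jT(\cdot,t-j))(x)+Z(x,t)$$ in $L^2(\Omega)$ for all $(x,t)$ and in $L^2(S^2\times\Omega)$ for all $t$, where $(\Phi_jf)(x)=\int_{S^2}k_j(\langle x,y\rangle)f(y)\,dy$ with $k_j:[-1,1]\to\mathbb R$ continuous. It is *causal* if, $\phi_{\ell;j}$ denoting the eigenvalue of $\Phi_j$ on the spherical harmonics of degree $\ell$, one has $1-\phi_{\ell;1}z-\cdots-\phi_{\ell;p}z^p\neq0$ for all $\ell\ge0$ and all complex $|z|\le1$. A field is *band-limited* if, for some $L$ and for every $t$, almost surely $T(\cdot,t)$ is a linear combination of spherical harmonics of degrees at most $L$. **Theorem.** Let $T$ be an isotropic stationary space-time spherical random field with continuous covariance kernels $r_t$. 1. If (i) holds, with spectral density kernels $f_\lambda$, then for every $\varepsilon>0$ there are (on some probability space) integers $L,p\ge0$ and an isotropic stationary, causal, band-limited $\mathrm{SPHAR}(p)$ process $T_L$, driven by a band-limited white noise $Z_L\sim\mathrm{SWN}(0,\{\sigma_\ell^2\})$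 with $\sigma^2_\ell=0$ for $\ell>L$ (both fields of degrees at most $L$), which has continuous covariance kernels, satisfies (i), and has spectral density kernels $\tilde f_\lambda$ with $$\|\tilde f_\lambda-f_\lambda\|_2\le\varepsilon\qquad\text{for all }\lambda\in[-\pi,\pi].$$ 2. If (ii) holds, with spectral density operators $\mathscr F_\lambda$, then for every $\varepsilon>0$ there is (on some probability space) a process $T_L$ of the same kind, which satisfies (ii) and has spectral density operators $\tilde{\mathscr F}_\lambda$ with $$\|\tilde{\mathscr F}_\lambda-\mathscr F_\lambda\|_{\mathrm{TR}}\le\varepsilon\qquad\text{for all }\lambda\in[-\pi,\pi].$$ -/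

import Mathlib

open MeasureTheory Filter Topology
open scoped ENNReal

noncomputable section

namespace SphereTime

/-! ### The sphere, its surface measure and rotations -/

/-- Euclidean three-space. -/
abbrev E3 : Type := EuclideanSpace ℝ (Fin 3)

/-- The unit sphere of Euclidean three-space. -/
abbrev S2 : Type := Metric.sphere (0 : E3) 1

/-- The surface (Lebesgue) measure `dx` on the sphere, of total mass `4 * π`. -/
abbrev surf : Measure S2 := (volume : Measure E3).toSphere

/-- Complex square-integrable functions on the sphere. -/
abbrev L2S : Type := Lp ℂ 2 surf

/-- Complex square-integrable kernels on the product of the sphere with itself. -/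
abbrev L2SS : Type := Lp ℂ 2 (surf.prod surf)

/-- A linear isometry of three-space acting on the sphere. -/
def rotate (g : E3 ≃ₗᵢ[ℝ] E3) (x : S2) : S2 :=
  ⟨g x, by simp⟩

/-- `g` is a rotation, that is, an element of `SO(3)`. -/
def IsRotation (g : E3 ≃ₗᵢ[ℝ] E3) : Prop :=
  LinearMap.det (g.toLinearEquiv : E3 →ₗ[ℝ] E3) = 1

/-! ### Legendre polynomials and spherical harmonics -/

/-- The Legendre polynomial of degree `l` (Rodrigues' formula), normalised by `P_l(1) = 1`. -/
def legendre (l : ℕ) : Polynomial ℝ :=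
  Polynomial.C (1 / (2 ^ l * (l.factorial : ℝ))) *
    Polynomial.derivative^[l] ((Polynomial.X ^ 2 - 1) ^ l)

/-- The Laplacian of a polynomial in three variables. -/
def polyLaplacian (q : MvPolynomial (Fin 3) ℂ) : MvPolynomial (Fin 3) ℂ :=
  ∑ i : Fin 3, MvPolynomial.pderiv i (MvPolynomial.pderiv i q)

/-- The restriction to the sphere of a polynomial in three variables, as a linear map. -/
def restrictToSphere : MvPolynomial (Fin 3) ℂ →ₗ[ℂ] (S2 → ℂ) where
  toFun q := fun x => MvPolynomial.eval (fun i => ((x : E3) i : ℂ)) q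
  map_add' q r := by ext x; simp
  map_smul' c q := by ext x; simp

/-- `f` is a spherical harmonic of degree `l`: the restriction to the sphere of a homogeneous
harmonic polynomial of degree `l`. -/
def IsSphericalHarmonic (l : ℕ) (f : S2 → ℂ) : Prop :=
  ∃ q : MvPolynomial (Fin 3) ℂ, q.IsHomogeneous l ∧ polyLaplacian q = 0 ∧ restrictToSphere q = f

/-- The space spanned by the functions `Y_{l,m}`, `m = -l, …, l`: all spherical harmonics of
degree `l`. -/
def harmonicSpace (l : ℕ) : Submodule ℂ (S2 → ℂ) :=
  Submodule.span ℂ {f | IsSphericalHarmonic l f}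

/-- The harmonic coefficient `∫ u(x) conj(Y(x)) dx` of a real function `u` along `Y`. -/
def harmonicCoeff (u : S2 → ℝ) (Y : S2 → ℂ) : ℂ :=
  ∫ x, (u x : ℂ) * star (Y x) ∂surf

/-! ### Space-time spherical random fields -/

variable {Ω : Type*} [MeasurableSpace Ω]

/-- A real, zero-mean space-time spherical random field with finite second moments which is
jointly measurable in space and chance, isotropic in space and stationary in time. -/
structure IsIsotropicStationary (μ : Measure Ω) (T : S2 → ℤ → Ω → ℝ) : Prop where
  measurable : ∀ t : ℤ, Measurable (fun z : S2 × Ω => T z.1 t z.2)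
  memLp : ∀ (x : S2) (t : ℤ), MemLp (T x t) 2 μ
  mean_zero : ∀ (x : S2) (t : ℤ), ∫ ω, T x t ω ∂μ = 0
  invariant : ∀ g : E3 ≃ₗᵢ[ℝ] E3, IsRotation g → ∀ (x y : S2) (t s h : ℤ),
    ∫ ω, T x t ω * T y s ω ∂μ
      = ∫ ω, T (rotate g x) (t + h) ω * T (rotate g y) (s + h) ω ∂μ

/-- The autocovariance kernel `r_t(x, y) = E[T(x, t) T(y, 0)]`. -/
def covKernel (μ : Measure Ω) (T : S2 → ℤ → Ω → ℝ) (t : ℤ) (x y : S2) : ℝ :=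
  ∫ ω, T x t ω * T y 0 ω ∂μ

/-- All autocovariance kernels are continuous. -/
def HasContinuousCov (μ : Measure Ω) (T : S2 → ℤ → Ω → ℝ) : Prop :=
  ∀ t : ℤ, Continuous (fun z : S2 × S2 => covKernel μ T t z.1 z.2)

/-- The autocovariance kernel as a (complex-valued) continuous function. -/
def covCont {μ : Measure Ω} {T : S2 → ℤ → Ω → ℝ} (hc : HasContinuousCov μ T) (t : ℤ) :
    C(S2 × S2, ℂ) :=
  ⟨fun z => (covKernel μ T t z.1 z.2 : ℂ), Complex.continuous_ofReal.comp (hc t)⟩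

/-- The autocovariance kernel as an element of the space of square-integrable kernels. -/
def covL2 {μ : Measure Ω} {T : S2 → ℤ → Ω → ℝ} (hc : HasContinuousCov μ T) (t : ℤ) : L2SS :=
  ContinuousMap.toLp 2 (surf.prod surf) ℂ (covCont hc t)

/-! ### Integral operators and the trace norm -/

/-- The section `y ↦ conj (K (x, y))` of a continuous kernel. -/
def conjSection (K : C(S2 × S2, ℂ)) (x : S2) : C(S2, ℂ) :=
  ⟨fun y => star (K (x, y)), by fun_prop⟩

theorem norm_conjSection_le (K : C(S2 × S2, ℂ)) (x : S2) : ‖conjSection K x‖ ≤ ‖K‖ := by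
  refine (ContinuousMap.norm_le _ (norm_nonneg _)).2 fun y => ?_
  simpa [conjSection] using K.norm_coe_le_norm (x, y)

theorem inner_conjSection_ae (K : C(S2 × S2, ℂ)) (x : S2) (h : L2S) :
    (fun y => inner ℂ (ContinuousMap.toLp 2 surf ℂ (conjSection K x) y) (h y))
      =ᵐ[surf] fun y => K (x, y) * h y := by
  filter_upwards [ContinuousMap.coeFn_toLp (p := 2) (𝕜 := ℂ) surf (conjSection K x)] with y hy
  rw [hy]
  simp [conjSection, mul_comm]

theorem integrable_kernel_mul (K : C(S2 × S2, ℂ)) (x : S2) (h : L2S) :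
    Integrable (fun y => K (x, y) * h y) surf :=
  (L2.integrable_inner (𝕜 := ℂ) (ContinuousMap.toLp 2 surf ℂ (conjSection K x)) h).congr
    (inner_conjSection_ae K x h)

theorem integral_kernel_eq_inner (K : C(S2 × S2, ℂ)) (x : S2) (h : L2S) :
    ∫ y, K (x, y) * h y ∂surf
      = inner ℂ (ContinuousMap.toLp 2 surf ℂ (conjSection K x)) h := by
  rw [L2.inner_def]
  exact (integral_congr_ae (inner_conjSection_ae K x h)).symm

theorem norm_integral_kernel_le (K : C(S2 × S2, ℂ)) (x : S2) (h : L2S) :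
    ‖∫ y, K (x, y) * h y ∂surf‖
      ≤ ‖(ContinuousMap.toLp 2 surf ℂ : C(S2, ℂ) →L[ℂ] L2S)‖ * ‖K‖ * ‖h‖ := by
  rw [integral_kernel_eq_inner]
  refine (norm_inner_le_norm _ _).trans (mul_le_mul_of_nonneg_right ?_ (norm_nonneg _))
  exact (ContinuousLinearMap.le_opNorm _ _).trans
    (mul_le_mul_of_nonneg_left (norm_conjSection_le K x) (norm_nonneg _))

theorem continuous_integral_kernel (K : C(S2 × S2, ℂ)) (h : L2S) :
    Continuous (fun x => ∫ y, K (x, y) * h y ∂surf) := by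
  have hi : Integrable (fun y => h y) surf := (Lp.memLp h).integrable (by norm_num)
  refine continuous_of_dominated (bound := fun y => ‖K‖ * ‖h y‖)
    (fun x => (integrable_kernel_mul K x h).aestronglyMeasurable) (fun x => ?_)
    (hi.norm.const_mul _) ?_
  · refine Eventually.of_forall fun y => ?_
    rw [norm_mul]
    exact mul_le_mul_of_nonneg_right (K.norm_coe_le_norm _) (norm_nonneg _)
  · exact Eventually.of_forall fun y => by fun_prop

/-- Right integration against a continuous kernel, with values in continuous functions. -/
def integralOpCont (K : C(S2 × S2, ℂ)) : L2S →L[ℂ] C(S2, ℂ) :=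
  LinearMap.mkContinuous
    { toFun := fun h => ⟨fun x => ∫ y, K (x, y) * h y ∂surf, continuous_integral_kernel K h⟩
      map_add' := fun h₁ h₂ => by
        ext x
        change ∫ y, K (x, y) * (h₁ + h₂ : L2S) y ∂surf
          = ∫ y, K (x, y) * h₁ y ∂surf + ∫ y, K (x, y) * h₂ y ∂surf
        simp only [integral_kernel_eq_inner, inner_add_right]
      map_smul' := fun c h => by
        ext x
        change ∫ y, K (x, y) * (c • h : L2S) y ∂surf = c * ∫ y, K (x, y) * h y ∂surf
        simp only [integral_kernel_eq_inner, inner_smul_right] }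
    (‖(ContinuousMap.toLp 2 surf ℂ : C(S2, ℂ) →L[ℂ] L2S)‖ * ‖K‖)
    (fun h => (ContinuousMap.norm_le _ (by positivity)).2
      fun x => norm_integral_kernel_le K x h)

/-- The operator on `L²` of the sphere induced by a continuous kernel through right
integration, `h ↦ ∫ K(·, y) h(y) dy`. -/
def integralOp (K : C(S2 × S2, ℂ)) : L2S →L[ℂ] L2S :=
  (ContinuousMap.toLp 2 surf ℂ : C(S2, ℂ) →L[ℂ] L2S).comp (integralOpCont K)

theorem integralOp_ae (K : C(S2 × S2, ℂ)) (h : L2S) :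
    integralOp K h =ᵐ[surf] fun x => ∫ y, K (x, y) * h y ∂surf :=
  ContinuousMap.coeFn_toLp (p := 2) (𝕜 := ℂ) surf (integralOpCont K h)

/-- The trace (nuclear) norm of a bounded operator on a Hilbert space: the infimum of
`∑ ‖u i‖ ‖v i‖` over all representations of the operator as `∑ u i ⊗ v i`, where
`(u ⊗ v) h = ⟨h, v⟩ u`; it is `∞` for an operator which is not of trace class. -/
def traceNorm {H : Type*} [NormedAddCommGroup H] [InnerProductSpace ℂ H] (A : H →L[ℂ] H) :
    ℝ≥0∞ :=
  ⨅ (u : ℕ → H) (v : ℕ → H) (_ : ∀ h : H, HasSum (fun i => inner ℂ (v i) h • u i) (A h)),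
    ∑' i, ‖u i‖ₑ * ‖v i‖ₑ

/-! ### Spectral densities -/

section Spectral

variable {μ : Measure Ω} {T : S2 → ℤ → Ω → ℝ}

/-- The autocovariance operator `R_t`. -/
def covOp (hc : HasContinuousCov μ T) (t : ℤ) : L2S →L[ℂ] L2S :=
  integralOp (covCont hc t)

/-- Absolute summability of the autocovariance kernels in the `L²` norm. -/
def SummableCovKernels (hc : HasContinuousCov μ T) : Prop :=
  Summable (fun t : ℤ => ‖covL2 hc t‖)

/-- Absolute summability of the autocovariance operators in the trace norm. -/
def SummableCovOps (hc : HasContinuousCov μ T) : Prop :=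
  ∑' t : ℤ, traceNorm (covOp hc t) ≠ ∞

/-- The spectral density kernel at frequency `lam`, the sum being taken in `L²`. -/
def specKernel (hc : HasContinuousCov μ T) (lam : ℝ) : L2SS :=
  (1 / (2 * (Real.pi : ℂ))) •
    ∑' t : ℤ, Complex.exp (-(Complex.I * (lam : ℂ) * (t : ℂ))) • covL2 hc t

/-- The spectral density operator at frequency `lam`. The sum is taken in the operator norm;
if it converges in the (stronger) trace norm, the two sums agree. -/
def specOp (hc : HasContinuousCov μ T) (lam : ℝ) : L2S →L[ℂ] L2S :=
  (1 / (2 * (Real.pi : ℂ))) •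
    ∑' t : ℤ, Complex.exp (-(Complex.I * (lam : ℂ) * (t : ℂ))) • covOp hc t

end Spectral

/-! ### Spherical white noise and spherical autoregressions -/

/-- `Z` is a spherical white noise with angular power spectrum `C`. -/
structure IsSphericalWhiteNoise (μ : Measure Ω) (Z : S2 → ℤ → Ω → ℝ) (C : ℕ → ℝ) : Prop where
  measurable : ∀ t : ℤ, Measurable (fun z : S2 × Ω => Z z.1 t z.2)
  memLp : ∀ (x : S2) (t : ℤ), MemLp (Z x t) 2 μ
  mean_zero : ∀ (x : S2) (t : ℤ), ∫ ω, Z x t ω ∂μ = 0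
  spectrum_nonneg : ∀ l, 0 ≤ C l
  spectrum_summable : Summable (fun l : ℕ => (2 * (l : ℝ) + 1) / (4 * Real.pi) * C l)
  covariance : ∀ (t : ℤ) (x y : S2),
    HasSum (fun l : ℕ => (2 * (l : ℝ) + 1) / (4 * Real.pi) * C l *
        (legendre l).eval (inner ℝ (x : E3) (y : E3)))
      (∫ ω, Z x t ω * Z y t ω ∂μ)
  uncorrelated : ∀ t s : ℤ, t ≠ s → ∀ l l' : ℕ, ∀ Y ∈ harmonicSpace l, ∀ Y' ∈ harmonicSpace l',
    ∫ ω, harmonicCoeff (fun x => Z x t ω) Y * star (harmonicCoeff (fun x => Z x s ω) Y') ∂μ = 0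

/-- The isotropic kernel operator `(Φ f)(x) = ∫ k(⟨x, y⟩) f(y) dy`. -/
def isotropicOp {F : Type*} [NormedAddCommGroup F] [NormedSpace ℝ F] (k : ℝ → ℝ) (f : S2 → F)
    (x : S2) : F :=
  ∫ y, k (inner ℝ (x : E3) (y : E3)) • f y ∂surf

/-- `c` is the eigenvalue of the isotropic kernel operator with kernel `k` on the spherical
harmonics of degree `l`. -/
def IsHarmonicEigenvalue (k : ℝ → ℝ) (l : ℕ) (c : ℝ) : Prop :=
  ∀ Y ∈ harmonicSpace l, ∀ x : S2, isotropicOp k Y x = (c : ℂ) * Y x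

/-- `T` is a spherical functional autoregression of order `p`, driven by the spherical white
noise `Z` with angular power spectrum `C`, and with autoregressive operators `Φ_{j+1}` given by
the continuous kernels `k j`, `j < p`. The defining equation holds in `L²(Ω)` at every point and
in `L²(S2 × Ω)` at every time. -/
structure IsSPHAR (μ : Measure Ω) (p : ℕ) (k : Fin p → ℝ → ℝ) (T Z : S2 → ℤ → Ω → ℝ)
    (C : ℕ → ℝ) : Prop where
  kernel_continuous : ∀ j, ContinuousOn (k j) (Set.Icc (-1) 1)
  measurable : ∀ t : ℤ, Measurable (fun z : S2 × Ω => T z.1 t z.2)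
  sq_integrable : ∀ t : ℤ, ∀ᵐ ω ∂μ, MemLp (fun x => T x t ω) 2 surf
  noise : IsSphericalWhiteNoise μ Z C
  equation : ∀ (x : S2) (t : ℤ), ∀ᵐ ω ∂μ,
    T x t ω = ∑ j : Fin p, isotropicOp (k j) (fun y => T y (t - ((j : ℕ) + 1 : ℤ)) ω) x + Z x t ω
  equation_prod : ∀ t : ℤ, ∀ᵐ z ∂(surf.prod μ),
    T z.1 t z.2 =
      ∑ j : Fin p, isotropicOp (k j) (fun y => T y (t - ((j : ℕ) + 1 : ℤ)) z.2) z.1 + Z z.1 t z.2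

/-- Causality: for every degree `l` the polynomial `1 - φ_{l;1} z - ⋯ - φ_{l;p} z ^ p`, formed
with the eigenvalues of the autoregressive operators, has no zero in the closed unit disk. -/
def IsCausal (p : ℕ) (k : Fin p → ℝ → ℝ) : Prop :=
  ∃ φ : ℕ → Fin p → ℝ,
    (∀ l j, IsHarmonicEigenvalue (k j) l (φ l j)) ∧
    ∀ l, ∀ z : ℂ, ‖z‖ ≤ 1 → 1 - ∑ j : Fin p, (φ l j : ℂ) * z ^ ((j : ℕ) + 1) ≠ 0

/-- `T` is band-limited at multipole `L`: almost surely `T(·, t)` is a finite combination of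
spherical harmonics of degrees at most `L`. -/
def IsBandLimited (μ : Measure Ω) (L : ℕ) (T : S2 → ℤ → Ω → ℝ) : Prop :=
  ∀ t : ℤ, ∀ᵐ ω ∂μ, (fun x => (T x t ω : ℂ)) ∈ ⨆ l ∈ Finset.range (L + 1), harmonicSpace l

/-- `T` is an isotropic stationary, causal, band-limited spherical autoregression (of some
finite order, and up to some finite multipole, together with its noise). -/
def IsCausalBandLimitedSPHAR (μ : Measure Ω) (T : S2 → ℤ → Ω → ℝ) : Prop :=
  IsIsotropicStationary μ T ∧
  ∃ (L p : ℕ) (k : Fin p → ℝ → ℝ) (Z : S2 → ℤ → Ω → ℝ) (C : ℕ → ℝ),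
    IsSPHAR μ p k T Z C ∧ IsCausal p k ∧
    IsBandLimited μ L T ∧ IsBandLimited μ L Z ∧ ∀ l, L < l → C l = 0

end SphereTime

end

open SphereTime

noncomputable section

namespace SphereTime

/-! ### Gaussian moments and integrals of polynomials over the sphere -/

/-! Isotropy forces `r_t(x, y)` to depend only on `⟨x, y⟩`, because rotations act transitively on
pairs of points at a given angle (`exists_rotation`). By the Funk-Hecke formula (`funk_hecke`) all
the operators `R_t` then act as scalars `γ_l(t)` (`angularSpec`) on the harmonics of each degree
`l`. The problem splits into cutting off high degrees and approximating finitely many scalar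
spectral densities.

The cut-off is uniform in the frequency because the phases have modulus one. It suffices that the
norms of the tails, summed over `t`, tend to zero with the cut-off degree. For each fixed `t` the
tail vanishes in the limit, by polynomial approximation of the kernel in `L²`
(`tendsto_norm_tailL2`), and in trace norm by strong convergence of the harmonic projections
(`tendsto_bandProj`, `tendsto_traceNorm_comp`). Dominated convergence then gives the sum over `t`.

For fixed `l` the function `f_l(λ) = ∑ γ_l(t) cos(tλ)` is continuous. It is nonnegative because
`γ_l` is, up to a positive factor, the autocovariance of a scalar harmonic coefficient of the field
(`tsum_angularSpec_mul_cos_nonneg`). Such a function is uniformly close to some `σ / |q(e^{-iλ})|²`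
with `q` zero-free on the closed disk (`exists_ar_near`). To see this, approximate `-log(f_l + δ)`
by a polynomial in `cos λ`, write half of it as the real part of a polynomial `B(e^{-iλ})`, and
replace `exp B`, which has no zeros, by a Taylor polynomial of the exponential in `B`.

The limiting process is built explicitly. The seeds are independent in time, and each is a uniform
point `ξ_t` of the sphere with a random sign. The noise is the signed sum of multiples of `P_l(⟨x,
ξ_t⟩)`. The convolution identity for Legendre polynomials gives it the required covariance and makes
different degrees uncorrelated although they share the same seed. Filtering degree `l` by the
absolutely summable power series `1 / q_l` solves the autoregression for every outcome
(`linFilter_eq`), and its spectral density is `σ_l / |q_l|²` (`tsum_exp_mul_maCov`).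

The harmonic analysis rests on one identity, integration by parts on the sphere (`sphInt_X_mul`),
obtained from the Gaussian measure in polar coordinates. It yields orthogonality of degrees, the
reproducing property of Legendre polynomials (`integral_legendre_mul`), and from there Funk-Hecke.
-/

theorem integrable_pow_mul_exp (n : ℕ) :
    Integrable (fun t : ℝ => t ^ n * Real.exp (-(t ^ 2 / 2))) := by
  have h := integrable_rpow_mul_exp_neg_mul_sq (b := 1 / 2) (by norm_num) (s := n)
    (by have : (0 : ℝ) ≤ n := n.cast_nonneg
        linarith)
  refine h.congr (Eventually.of_forall fun t => ?_)
  simp only [Real.rpow_natCast]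
  congr 2
  ring

/-- The (unnormalised) moments of the standard Gaussian weight on the line. -/
def gaussMoment (n : ℕ) : ℝ := ∫ t : ℝ, t ^ n * Real.exp (-(t ^ 2 / 2))

/-- Integration by parts: the derivative of `t ^ n * exp (-t² / 2)` has integral zero. For `n = 0`
the factor `n` makes the truncated index `n - 1` harmless. -/
theorem gaussMoment_succ (n : ℕ) : gaussMoment (n + 1) = n * gaussMoment (n - 1) := by
  have hd : ∀ t : ℝ, HasDerivAt (fun t : ℝ => t ^ n * Real.exp (-(t ^ 2 / 2)))
      (n * (t ^ (n - 1) * Real.exp (-(t ^ 2 / 2))) - t ^ (n + 1) * Real.exp (-(t ^ 2 / 2))) t := by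
    intro t
    have h1 : HasDerivAt (fun t : ℝ => -(t ^ 2 / 2)) (-t) t := by
      have := ((hasDerivAt_pow 2 t).div_const 2).neg
      refine this.congr_deriv ?_
      norm_num
    refine ((hasDerivAt_pow n t).mul h1.exp).congr_deriv ?_
    ring
  have h1 := (integrable_pow_mul_exp (n - 1)).const_mul (n : ℝ)
  have h2 := integrable_pow_mul_exp (n + 1)
  have := integral_eq_zero_of_hasDerivAt_of_integrable hd (h1.sub h2) (integrable_pow_mul_exp n)
  rw [integral_sub h1 h2, integral_const_mul] at this
  unfold gaussMoment
  linarith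

/-- Evaluation of a complex polynomial at a point of Euclidean three-space. -/
def evalE (q : MvPolynomial (Fin 3) ℂ) (x : E3) : ℂ :=
  MvPolynomial.eval (fun i => ((x i : ℝ) : ℂ)) q

theorem evalE_smul {q : MvPolynomial (Fin 3) ℂ} {d : ℕ} (hq : q.IsHomogeneous d) (r : ℝ) (x : E3) :
    evalE q (r • x) = (r : ℂ) ^ d * evalE q x := by
  unfold evalE
  rw [MvPolynomial.eval_eq, MvPolynomial.eval_eq, Finset.mul_sum]
  refine Finset.sum_congr rfl fun s hs => ?_
  have hd : ∑ i ∈ s.support, s i = d := by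
    have := hq (MvPolynomial.mem_support_iff.1 hs)
    simpa [Finsupp.weight_apply, Finsupp.sum] using this
  simp only [PiLp.smul_apply, smul_eq_mul, Complex.ofReal_mul, mul_pow, Finset.prod_mul_distrib]
  rw [Finset.prod_pow_eq_pow_sum, hd]
  ring

/-- The integral of a polynomial against the Gaussian weight. -/
def gaussInt (q : MvPolynomial (Fin 3) ℂ) : ℂ :=
  ∫ x : E3, evalE q x * (Real.exp (-(‖x‖ ^ 2 / 2)) : ℂ)

theorem evalE_monomial_mul_exp (s : Fin 3 →₀ ℕ) (c : ℂ) (x : E3) :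
    evalE (MvPolynomial.monomial s c) x * (Real.exp (-(‖x‖ ^ 2 / 2)) : ℂ)
      = c * ∏ i, ((x i ^ s i * Real.exp (-(x i ^ 2 / 2)) : ℝ) : ℂ) := by
  have h : Real.exp (-(‖x‖ ^ 2 / 2)) = ∏ i, Real.exp (-(x i ^ 2 / 2)) := by
    rw [← Real.exp_sum, EuclideanSpace.norm_sq_eq]
    simp [Finset.sum_div, Finset.sum_neg_distrib]
  rw [h, evalE, MvPolynomial.eval_monomial, Finsupp.prod_fintype _ _ (by simp)]
  push_cast
  rw [Finset.prod_mul_distrib, mul_assoc]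

theorem integral_euclidean (f : (Fin 3 → ℝ) → ℂ) :
    ∫ x : E3, f (fun i => x i) = ∫ y : Fin 3 → ℝ, f y :=
  (EuclideanSpace.volume_preserving_symm_measurableEquiv_toLp (Fin 3)).integral_comp'
    (g := f)

theorem integrable_gauss (q : MvPolynomial (Fin 3) ℂ) :
    Integrable (fun x : E3 => evalE q x * (Real.exp (-(‖x‖ ^ 2 / 2)) : ℂ)) := by
  induction q using MvPolynomial.induction_on' with
  | monomial s c =>
    simp only [evalE_monomial_mul_exp]
    refine Integrable.const_mul ?_ c
    have h : Integrable (fun y : Fin 3 → ℝ =>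
        ∏ i, ((y i ^ s i * Real.exp (-(y i ^ 2 / 2)) : ℝ) : ℂ)) :=
      Integrable.fintype_prod (f := fun i t => ((t ^ s i * Real.exp (-(t ^ 2 / 2)) : ℝ) : ℂ))
        fun i => (integrable_pow_mul_exp (s i)).ofReal
    exact ((EuclideanSpace.volume_preserving_symm_measurableEquiv_toLp
      (Fin 3)).integrable_comp_emb (MeasurableEquiv.measurableEmbedding _)).2 h
  | add p q hp hq =>
    refine (hp.add hq).congr (Eventually.of_forall fun x => ?_)
    simp [evalE, add_mul]

theorem gaussInt_add (p q : MvPolynomial (Fin 3) ℂ) :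
    gaussInt (p + q) = gaussInt p + gaussInt q := by
  unfold gaussInt
  rw [← integral_add (integrable_gauss p) (integrable_gauss q)]
  simp [evalE, add_mul]

theorem gaussInt_monomial (s : Fin 3 →₀ ℕ) (c : ℂ) :
    gaussInt (MvPolynomial.monomial s c) = c * ∏ i, (gaussMoment (s i) : ℂ) := by
  unfold gaussInt
  simp only [evalE_monomial_mul_exp]
  rw [integral_const_mul,
    integral_euclidean (fun y => ∏ i, ((y i ^ s i * Real.exp (-(y i ^ 2 / 2)) : ℝ) : ℂ)),
    integral_fintype_prod_volume_eq_prod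
      (fun i t => ((t ^ s i * Real.exp (-(t ^ 2 / 2)) : ℝ) : ℂ))]
  simp only [gaussMoment, integral_complex_ofReal]

/-- The Gaussian weight factors over coordinates, so on monomials this is the one-dimensional moment
recursion in the variable `i`. -/
theorem gaussInt_X_mul (i : Fin 3) (q : MvPolynomial (Fin 3) ℂ) :
    gaussInt (MvPolynomial.X i * q) = gaussInt (MvPolynomial.pderiv i q) := by
  induction q using MvPolynomial.induction_on' with
  | monomial s c =>
    rw [MvPolynomial.pderiv_monomial, MvPolynomial.X, MvPolynomial.monomial_mul, gaussInt_monomial,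
      gaussInt_monomial, ← Finset.mul_prod_erase _ _ (Finset.mem_univ i),
      ← Finset.mul_prod_erase _ (fun j => (gaussMoment ((s - fun₀ | i => 1) j) : ℂ))
        (Finset.mem_univ i)]
    have h : ∀ j ∈ Finset.univ.erase i, (gaussMoment ((fun₀ | i => 1) j + s j) : ℂ)
        = gaussMoment (s j - (fun₀ | i => 1) j) := by
      intro j hj
      rw [Finsupp.single_eq_of_ne (Finset.ne_of_mem_erase hj)]
      simp
    simp only [Finsupp.coe_add, Pi.add_apply, Finsupp.coe_tsub, Pi.sub_apply]
    rw [Finset.prod_congr rfl h, Finsupp.single_eq_same, add_comm 1, gaussMoment_succ]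
    push_cast
    ring
  | add p q hp hq => rw [mul_add, gaussInt_add, hp, hq, map_add, gaussInt_add]

/-! ### From Gaussian integrals to integrals over the sphere -/

theorem continuous_restrictToSphere (q : MvPolynomial (Fin 3) ℂ) :
    Continuous (restrictToSphere q) := by
  change Continuous fun x : S2 => MvPolynomial.eval (fun i => ((x : E3) i : ℂ)) q
  simp only [MvPolynomial.eval_eq]
  fun_prop

theorem integrable_of_continuous {F : Type*} [NormedAddCommGroup F] [NormedSpace ℝ F]
    {f : S2 → F} (hf : Continuous f) : Integrable f surf :=
  hf.integrable_of_hasCompactSupport (HasCompactSupport.of_compactSpace f)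

/-- The integral of a polynomial over the sphere. -/
def sphInt (q : MvPolynomial (Fin 3) ℂ) : ℂ := ∫ x, restrictToSphere q x ∂surf

theorem sphInt_add (p q : MvPolynomial (Fin 3) ℂ) : sphInt (p + q) = sphInt p + sphInt q := by
  unfold sphInt
  rw [← integral_add (integrable_of_continuous (continuous_restrictToSphere p))
    (integrable_of_continuous (continuous_restrictToSphere q))]
  simp

theorem sphInt_smul (c : ℂ) (q : MvPolynomial (Fin 3) ℂ) : sphInt (c • q) = c * sphInt q := by
  unfold sphInt
  rw [← integral_const_mul]
  simp

/-- `sphInt` as a linear map. -/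
def sphIntL : MvPolynomial (Fin 3) ℂ →ₗ[ℂ] ℂ where
  toFun := sphInt
  map_add' := sphInt_add
  map_smul' := sphInt_smul

theorem sphInt_sum {ι : Type*} (s : Finset ι) (f : ι → MvPolynomial (Fin 3) ℂ) :
    sphInt (∑ i ∈ s, f i) = ∑ i ∈ s, sphInt (f i) :=
  map_sum sphIntL f s

theorem sphInt_zero : sphInt 0 = 0 := map_zero sphIntL

/-- The radial part of the Gaussian integral of a homogeneous polynomial of degree `d`. -/
def radial (d : ℕ) : ℝ := ∫ r : Set.Ioi (0 : ℝ), (r : ℝ) ^ d * Real.exp (-((r : ℝ) ^ 2 / 2))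
    ∂(Measure.volumeIoiPow 2)

/-- The radial integral is a Gamma value, but only its being nonzero matters: it allows the radial
factors to be cancelled. -/
theorem radial_pos (d : ℕ) : 0 < radial d := by
  have h : radial d = ∫ r in Set.Ioi (0 : ℝ), r ^ ((d + 2 : ℕ) : ℝ) *
      Real.exp (-(1 / 2 : ℝ) * r ^ (2 : ℝ)) := by
    unfold radial
    simp only [Measure.volumeIoiPow, ENNReal.ofReal]
    rw [integral_withDensity_eq_integral_smul
      ((measurable_subtype_coe.pow_const _).real_toNNReal),
      integral_subtype_comap measurableSet_Ioi
        fun a : ℝ => Real.toNNReal (a ^ 2) • (a ^ d * Real.exp (-(a ^ 2 / 2)))]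
    refine setIntegral_congr_fun measurableSet_Ioi fun r hr => ?_
    simp only [NNReal.smul_def, Real.coe_toNNReal _ (sq_nonneg r), Real.rpow_natCast,
      Real.rpow_ofNat, smul_eq_mul]
    rw [pow_add, show -(r ^ 2 / 2) = -(1 / 2) * r ^ 2 by ring]
    ring
  have hd : (0 : ℝ) ≤ ((d + 2 : ℕ) : ℝ) := Nat.cast_nonneg _
  rw [h, integral_rpow_mul_exp_neg_mul_rpow (by norm_num) (by linarith) (by norm_num)]
  have := Real.Gamma_pos_of_pos (s := (((d + 2 : ℕ) : ℝ) + 1) / 2) (by positivity)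
  positivity

/-- Polar coordinates: by homogeneity the integrand separates into `r ^ d` times the Gaussian
weight, and the values of `q` on the unit sphere. -/
theorem gaussInt_eq_radial_mul {q : MvPolynomial (Fin 3) ℂ} {d : ℕ} (hq : q.IsHomogeneous d) :
    gaussInt q = radial d * sphInt q := by
  set F : E3 → ℂ := fun x => evalE q x * (Real.exp (-(‖x‖ ^ 2 / 2)) : ℂ) with hF
  have h0 : ∫ x : ({(0)}ᶜ : Set E3), F x ∂((volume : Measure E3).comap (↑)) = gaussInt q := by
    rw [integral_subtype_comap (measurableSet_singleton _).compl F, restrict_compl_singleton]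
    rfl
  have h1 := ((volume : Measure E3).measurePreserving_homeomorphUnitSphereProd.symm
    (homeomorphUnitSphereProd E3).toMeasurableEquiv).integral_comp
    (MeasurableEquiv.measurableEmbedding _) (fun x : ({(0)}ᶜ : Set E3) => F x)
  rw [← h0, ← h1]
  have hdim : Module.finrank ℝ E3 - 1 = 2 := by simp
  rw [hdim, mul_comm]
  unfold sphInt radial
  rw [← integral_complex_ofReal, ← integral_prod_mul]
  refine integral_congr_ae (Eventually.of_forall fun z => ?_)
  have hz : (((homeomorphUnitSphereProd E3).symm z : ({(0)}ᶜ : Set E3)) : E3)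
      = (z.2 : ℝ) • (z.1 : E3) := homeomorphUnitSphereProd_symm_apply_coe E3 z
  have hr : (0 : ℝ) < z.2 := z.2.2
  have hn : ‖(z.2 : ℝ) • (z.1 : E3)‖ = z.2 := by
    rw [norm_smul, norm_eq_of_mem_sphere, mul_one, Real.norm_of_nonneg hr.le]
  change F (((homeomorphUnitSphereProd E3).symm z : ({(0)}ᶜ : Set E3)) : E3) = _
  rw [hz, hF]
  simp only
  rw [hn, evalE_smul hq]
  push_cast
  change _ = evalE q z.1 * _
  ring

/-- The squared norm as a polynomial. -/
def normSqPoly : MvPolynomial (Fin 3) ℂ := ∑ i, MvPolynomial.X i * MvPolynomial.X i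

theorem sum_sq_sphere (x : S2) : ∑ i, ((x : E3) i : ℂ) * ((x : E3) i : ℂ) = 1 := by
  have h := EuclideanSpace.norm_sq_eq (x : E3)
  rw [norm_eq_of_mem_sphere] at h
  simp only [Real.norm_eq_abs, sq_abs] at h
  have : ((∑ i, (x : E3) i ^ 2 : ℝ) : ℂ) = 1 := by rw [← h]; simp
  rw [← this]
  push_cast
  exact Finset.sum_congr rfl fun i _ => by ring

theorem restrictToSphere_mul (p q : MvPolynomial (Fin 3) ℂ) (x : S2) :
    restrictToSphere (p * q) x = restrictToSphere p x * restrictToSphere q x :=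
  map_mul (MvPolynomial.eval fun i => ((x : E3) i : ℂ)) p q

theorem restrictToSphere_normSqPoly (x : S2) : restrictToSphere normSqPoly x = 1 := by
  rw [← sum_sq_sphere x]
  simp [restrictToSphere, normSqPoly]

/-- Integration by parts on the sphere. Gaussian integration by parts relates the two sides up to
the ratio of two radial constants, whose degrees differ by two, and this ratio is `d + 2`. -/
theorem sphInt_X_mul {q : MvPolynomial (Fin 3) ℂ} {d : ℕ} (hq : q.IsHomogeneous d) (i : Fin 3) :
    (d + 2) * sphInt (MvPolynomial.X i * q) = sphInt (MvPolynomial.pderiv i q) := by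
  have hX : (MvPolynomial.X i * q).IsHomogeneous (1 + d) :=
    (MvPolynomial.isHomogeneous_X ℂ i).mul hq
  have h1 := gaussInt_X_mul i q
  rw [gaussInt_eq_radial_mul hX] at h1
  have hR : ∀ n, (radial n : ℂ) ≠ 0 := fun n => by exact_mod_cast (radial_pos n).ne'
  rcases Nat.eq_zero_or_pos d with rfl | hd
  · have h0 : MvPolynomial.pderiv i q = 0 := by
      rw [MvPolynomial.totalDegree_eq_zero_iff_eq_C.1 (Nat.le_zero.1 hq.totalDegree_le),
        MvPolynomial.pderiv_C]
    have hz : gaussInt 0 = 0 := by simp [gaussInt, evalE]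
    rw [h0, hz] at h1
    rw [h0, sphInt_zero, (mul_eq_zero.1 h1).resolve_left (hR _), mul_zero]
  · set q' := MvPolynomial.pderiv i q with hq'
    have hh : q'.IsHomogeneous (d - 1) := hq.pderiv
    -- The ratio of radial constants is found without evaluating them: `|x|² q'` and `q'` agree on
    -- the sphere, and integrating by parts in each coordinate yields `3` from the three copies of
    -- `q'` plus `d - 1` from Euler's identity.
    have hmul : gaussInt (normSqPoly * q') = ((d : ℂ) + 2) * gaussInt q' := by
      unfold normSqPoly
      rw [Finset.sum_mul]
      have hs : ∀ (s : Finset (Fin 3)) (f : Fin 3 → MvPolynomial (Fin 3) ℂ),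
          gaussInt (∑ j ∈ s, f j) = ∑ j ∈ s, gaussInt (f j) := by
        intro s f
        induction s using Finset.induction_on with
        | empty => simp [gaussInt, evalE]
        | insert a s ha ih => rw [Finset.sum_insert ha, gaussInt_add, ih, Finset.sum_insert ha]
      have hn : ∀ n : ℕ, gaussInt (n • q') = n * gaussInt q' := by
        intro n
        induction n with
        | zero => simp [gaussInt, evalE]
        | succ n ih => rw [succ_nsmul, gaussInt_add, ih]; push_cast; ring
      have hj : ∀ j, gaussInt (MvPolynomial.X j * MvPolynomial.X j * q')
          = gaussInt (MvPolynomial.X j * MvPolynomial.pderiv j q') + gaussInt q' := by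
        intro j
        rw [mul_assoc, gaussInt_X_mul, Derivation.leibniz, gaussInt_add,
          MvPolynomial.pderiv_X_self, smul_eq_mul, smul_eq_mul, mul_one]
      rw [hs, Finset.sum_congr rfl fun j _ => hj j, Finset.sum_add_distrib, ← hs,
        hh.sum_X_mul_pderiv, hn, Nat.cast_sub hd]
      simp
      ring
    have hN : (normSqPoly * q').IsHomogeneous (1 + d) := by
      have hn : normSqPoly.IsHomogeneous 2 :=
        MvPolynomial.IsHomogeneous.sum _ _ _ fun j _ =>
          (MvPolynomial.isHomogeneous_X ℂ j).mul (MvPolynomial.isHomogeneous_X ℂ j)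
      have := hn.mul hh
      rwa [show 2 + (d - 1) = 1 + d by omega] at this
    have hsp : sphInt (normSqPoly * q') = sphInt q' := by
      unfold sphInt
      simp [restrictToSphere_mul, restrictToSphere_normSqPoly]
    rw [gaussInt_eq_radial_mul hN, hsp, ← h1] at hmul
    have := mul_left_cancel₀ (hR (1 + d)) (hmul.trans (by ring :
      _ = (radial (1 + d) : ℂ) * ((d + 2) * sphInt (MvPolynomial.X i * q))))
    exact this.symm

theorem surf_real_univ : surf.real Set.univ = 4 * Real.pi := by
  rw [Measure.toSphere_real_apply_univ, measureReal_def, EuclideanSpace.volume_ball_fin_three]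
  simp [ENNReal.toReal_ofReal (by positivity : (0 : ℝ) ≤ Real.pi * 4 / 3)]
  ring

/-! ### Harmonic polynomials -/

theorem evalE_const_smul (c : ℂ) (q : MvPolynomial (Fin 3) ℂ) (x : E3) :
    evalE (c • q) x = c * evalE q x := by
  rw [evalE, MvPolynomial.smul_eq_C_mul, map_mul, MvPolynomial.eval_C, evalE]

theorem evalE_sum {ι : Type*} (s : Finset ι) (f : ι → MvPolynomial (Fin 3) ℂ) (x : E3) :
    evalE (∑ i ∈ s, f i) x = ∑ i ∈ s, evalE (f i) x :=
  map_sum (MvPolynomial.eval fun i => ((x i : ℝ) : ℂ)) f s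

theorem evalE_mul (p q : MvPolynomial (Fin 3) ℂ) (x : E3) :
    evalE (p * q) x = evalE p x * evalE q x :=
  map_mul (MvPolynomial.eval fun i => ((x i : ℝ) : ℂ)) p q

theorem evalE_X (i : Fin 3) (x : E3) : evalE (MvPolynomial.X i) x = (x i : ℝ) :=
  MvPolynomial.eval_X i

theorem polyLaplacian_add (p q : MvPolynomial (Fin 3) ℂ) :
    polyLaplacian (p + q) = polyLaplacian p + polyLaplacian q := by
  simp [polyLaplacian, Finset.sum_add_distrib]

theorem polyLaplacian_smul (c : ℂ) (q : MvPolynomial (Fin 3) ℂ) :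
    polyLaplacian (c • q) = c • polyLaplacian q := by
  simp [polyLaplacian, Finset.smul_sum]

theorem polyLaplacian_sum {ι : Type*} (s : Finset ι) (f : ι → MvPolynomial (Fin 3) ℂ) :
    polyLaplacian (∑ i ∈ s, f i) = ∑ i ∈ s, polyLaplacian (f i) :=
  map_sum (⟨⟨polyLaplacian, polyLaplacian_add⟩, polyLaplacian_smul⟩ :
    MvPolynomial (Fin 3) ℂ →ₗ[ℂ] MvPolynomial (Fin 3) ℂ) f s

theorem pderiv_comm (i j : Fin 3) (q : MvPolynomial (Fin 3) ℂ) :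
    MvPolynomial.pderiv i (MvPolynomial.pderiv j q)
      = MvPolynomial.pderiv j (MvPolynomial.pderiv i q) := by
  have h : ⁅MvPolynomial.pderiv (R := ℂ) i, MvPolynomial.pderiv (R := ℂ) j⁆ = 0 := by
    refine MvPolynomial.derivation_ext fun k => ?_
    rw [Derivation.commutator_apply]
    rw [MvPolynomial.pderiv_X, MvPolynomial.pderiv_X]
    simp [Pi.single_apply, apply_ite]
  have := congrArg (fun D => D q) h
  rw [Derivation.commutator_apply] at this
  exact sub_eq_zero.1 this

theorem polyLaplacian_pderiv {q : MvPolynomial (Fin 3) ℂ} (hq : polyLaplacian q = 0) (i : Fin 3) :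
    polyLaplacian (MvPolynomial.pderiv i q) = 0 := by
  unfold polyLaplacian at *
  simp_rw [pderiv_comm _ i]
  rw [← map_sum, hq, map_zero]

/-- Induction on the degree of `q`. Euler's identity writes `d p q` as `∑ X_i p ∂_i q`, and
integration by parts turns this into integrals of `∂_i p ∂_i q` and `p ∂_i ∂_i q`, which vanish by
induction since `∂_i p` is still harmonic. In degree zero, Euler's identity is applied to `p`
instead, leaving the Laplacian of `p`. -/
theorem sphInt_mul_eq_zero {d : ℕ} : ∀ {l : ℕ} {p q : MvPolynomial (Fin 3) ℂ},
    p.IsHomogeneous l → polyLaplacian p = 0 → q.IsHomogeneous d → d < l → sphInt (p * q) = 0 := by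
  induction d using Nat.strong_induction_on with
  | _ d ih =>
    intro l p q hp hΔ hq hdl
    rcases Nat.eq_zero_or_pos d with rfl | hd
    · obtain ⟨c, rfl⟩ : ∃ c, q = MvPolynomial.C c :=
        ⟨_, MvPolynomial.totalDegree_eq_zero_iff_eq_C.1 (Nat.le_zero.1 hq.totalDegree_le)⟩
      rw [mul_comm, ← MvPolynomial.smul_eq_C_mul, sphInt_smul]
      have h1 : sphInt (∑ i, MvPolynomial.X i * MvPolynomial.pderiv i p) = l * sphInt p := by
        rw [hp.sum_X_mul_pderiv, ← Nat.cast_smul_eq_nsmul ℂ, sphInt_smul]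
      have h2 : ((l - 1 : ℕ) + 2 : ℂ) *
          sphInt (∑ i, MvPolynomial.X i * MvPolynomial.pderiv i p) = 0 := by
        rw [sphInt_sum, Finset.mul_sum]
        simp_rw [sphInt_X_mul hp.pderiv]
        rw [← sphInt_sum]
        change sphInt (polyLaplacian p) = 0
        rw [hΔ, sphInt_zero]
      have h3 : ((l - 1 : ℕ) + 2 : ℂ) ≠ 0 := by norm_cast
      have h4 : (l : ℂ) ≠ 0 := by exact_mod_cast hdl.ne'
      rw [h1] at h2
      rw [(mul_eq_zero.1 ((mul_eq_zero.1 h2).resolve_left h3)).resolve_left h4, mul_zero]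
    · have h1 : sphInt (∑ i, MvPolynomial.X i * (p * MvPolynomial.pderiv i q))
          = d * sphInt (p * q) := by
        simp_rw [mul_left_comm _ p]
        rw [← Finset.mul_sum, hq.sum_X_mul_pderiv, ← Nat.cast_smul_eq_nsmul ℂ,
          mul_smul_comm, sphInt_smul]
      have h2 : (((l + (d - 1) : ℕ) : ℂ) + 2) *
          sphInt (∑ i, MvPolynomial.X i * (p * MvPolynomial.pderiv i q)) = 0 := by
        rw [sphInt_sum, Finset.mul_sum]
        refine Finset.sum_eq_zero fun i _ => ?_
        rw [sphInt_X_mul (hp.mul hq.pderiv), Derivation.leibniz, smul_eq_mul, smul_eq_mul,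
          sphInt_add, ih (d - 1 - 1) (by omega) hp hΔ hq.pderiv.pderiv (by omega), zero_add,
          mul_comm, ih (d - 1) (by omega) hp.pderiv (polyLaplacian_pderiv hΔ i) hq.pderiv
            (by omega)]
      have h3 : (((l + (d - 1) : ℕ) : ℂ) + 2) ≠ 0 := by norm_cast
      have h4 : (d : ℂ) ≠ 0 := by exact_mod_cast hd.ne'
      rw [h1] at h2
      exact (mul_eq_zero.1 ((mul_eq_zero.1 h2).resolve_left h3)).resolve_left h4

/-- The linear form `⟨x, ·⟩`. -/
def linPoly (x : E3) : MvPolynomial (Fin 3) ℂ := ∑ i, ((x i : ℝ) : ℂ) • MvPolynomial.X i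

theorem linPoly_isHomogeneous (x : E3) : (linPoly x).IsHomogeneous 1 := by
  refine MvPolynomial.IsHomogeneous.sum _ _ _ fun i _ => ?_
  rw [MvPolynomial.smul_eq_C_mul]
  simpa using (MvPolynomial.isHomogeneous_C (Fin 3) (x i : ℂ)).mul
    (MvPolynomial.isHomogeneous_X ℂ i)

theorem pderiv_linPoly (x : E3) (i : Fin 3) :
    MvPolynomial.pderiv i (linPoly x) = MvPolynomial.C ((x i : ℝ) : ℂ) := by
  unfold linPoly
  rw [map_sum]
  simp only [Derivation.map_smul, MvPolynomial.pderiv_X, Pi.single_apply, smul_ite, smul_zero]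
  rw [Finset.sum_eq_single i]
  · simp [MvPolynomial.smul_eq_C_mul]
  · intro j _ hj
    simp [hj]
  · simp

theorem pderiv_linPoly_pow (x : E3) (i : Fin 3) (n : ℕ) :
    MvPolynomial.pderiv i (linPoly x ^ n)
      = ((n : ℂ) * ((x i : ℝ) : ℂ)) • linPoly x ^ (n - 1) := by
  rw [Derivation.leibniz_pow, pderiv_linPoly, ← Nat.cast_smul_eq_nsmul ℂ, smul_eq_mul, mul_comm,
    ← MvPolynomial.smul_eq_C_mul, smul_smul]

theorem evalE_linPoly (x y : E3) : evalE (linPoly x) y = (inner ℝ x y : ℝ) := by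
  rw [linPoly, evalE_sum]
  simp only [evalE_const_smul, evalE_X]
  simp [PiLp.inner_apply, mul_comm]

/-- The constant in the Funk-Hecke formula for powers. -/
def powConst : ℕ → ℝ
  | 0 => 4 * Real.pi
  | (l + 1) => (l + 1) / (2 * l + 3) * powConst l

/-- Induction on `l`: integrating by parts one factor `⟨x, ·⟩` replaces `p` by its derivative `D` in
the direction `x`. The other term contains a power `l - 1` of the linear form and dies by
orthogonality. `D` is harmonic of degree `l`, and Euler's identity gives `D(x) = (l + 1) p(x)`. -/
theorem sphInt_mul_linPoly_pow (x : E3) {l : ℕ} : ∀ {p : MvPolynomial (Fin 3) ℂ},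
    p.IsHomogeneous l → polyLaplacian p = 0 →
      sphInt (p * linPoly x ^ l) = powConst l * evalE p x := by
  induction l with
  | zero =>
    intro p hp _
    obtain ⟨c, rfl⟩ : ∃ c, p = MvPolynomial.C c :=
      ⟨_, MvPolynomial.totalDegree_eq_zero_iff_eq_C.1 (Nat.le_zero.1 hp.totalDegree_le)⟩
    have h : ∀ y : S2, restrictToSphere (MvPolynomial.C c) y = c := fun y => by
      simp [restrictToSphere]
    rw [sphInt, pow_zero, mul_one]
    simp only [h, integral_const, surf_real_univ, powConst, evalE, MvPolynomial.eval_C]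
    simp
  | succ l ih =>
    intro p hp hΔ
    set D : MvPolynomial (Fin 3) ℂ := ∑ i, ((x i : ℝ) : ℂ) • MvPolynomial.pderiv i p with hD
    have hDh : D.IsHomogeneous l := by
      refine MvPolynomial.IsHomogeneous.sum _ _ _ fun i _ => ?_
      rw [MvPolynomial.smul_eq_C_mul]
      simpa using (MvPolynomial.isHomogeneous_C (Fin 3) (x i : ℂ)).mul (hp.pderiv (i := i))
    have hDΔ : polyLaplacian D = 0 := by
      rw [hD, polyLaplacian_sum]
      refine Finset.sum_eq_zero fun i _ => ?_
      rw [polyLaplacian_smul, polyLaplacian_pderiv hΔ, smul_zero]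
    have hDx : evalE D x = (l + 1) * evalE p x := by
      have := congrArg (fun q => evalE q x) hp.sum_X_mul_pderiv
      simp only [← Nat.cast_smul_eq_nsmul ℂ, evalE_const_smul, evalE_sum, evalE_mul, evalE_X]
        at this
      simp only [hD, evalE_sum, evalE_const_smul, this]
      push_cast
      ring
    have hlp : (linPoly x ^ l).IsHomogeneous l := by
      simpa using (linPoly_isHomogeneous x).pow l
    have hm := hp.mul hlp
    have hi : ∀ i, ((2 * l + 3 : ℕ) : ℂ) * sphInt (MvPolynomial.X i * (p * linPoly x ^ l))
        = sphInt (MvPolynomial.pderiv i p * linPoly x ^ l) := by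
      intro i
      have h := sphInt_X_mul hm i
      rw [Derivation.leibniz, sphInt_add, pderiv_linPoly_pow, smul_eq_mul, mul_smul_comm,
        sphInt_smul, sphInt_mul_eq_zero hp hΔ (q := linPoly x ^ (l - 1)) (d := l - 1)
          (by simpa using (linPoly_isHomogeneous x).pow (l - 1)) (by omega), mul_zero, zero_add,
        smul_eq_mul, mul_comm (linPoly x ^ l)] at h
      rw [← h]
      push_cast
      ring
    have hexp : p * linPoly x ^ (l + 1)
        = ∑ i, ((x i : ℝ) : ℂ) • (MvPolynomial.X i * (p * linPoly x ^ l)) := by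
      rw [pow_succ, ← mul_assoc]
      nth_rw 2 [linPoly]
      rw [Finset.mul_sum]
      exact Finset.sum_congr rfl fun i _ => by rw [mul_smul_comm, mul_comm]
    have hmain : ((2 * l + 3 : ℕ) : ℂ) * sphInt (p * linPoly x ^ (l + 1))
        = sphInt (D * linPoly x ^ l) := by
      rw [hexp, sphInt_sum, Finset.mul_sum, hD, Finset.sum_mul, sphInt_sum]
      refine Finset.sum_congr rfl fun i _ => ?_
      rw [sphInt_smul, smul_mul_assoc, sphInt_smul, ← hi i]
      ring
    rw [ih hDh hDΔ, hDx] at hmain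
    have h3 : ((2 * l + 3 : ℕ) : ℂ) ≠ 0 := by norm_cast
    apply mul_left_cancel₀ h3
    rw [hmain, powConst]
    have h4 : (2 * (l : ℂ) + 3) ≠ 0 := by exact_mod_cast h3
    push_cast
    rw [div_mul_eq_mul_div, div_mul_eq_mul_div, mul_div_cancel₀ _ h4]
    ring

/-! ### Legendre polynomials -/

/-- The coefficient of `X ^ (l - 2 k)` in the Legendre polynomial of degree `l`. -/
def legCoeff (l k : ℕ) : ℝ :=
  (-1) ^ k * (2 * l - 2 * k).factorial /
    (2 ^ l * k.factorial * (l - k).factorial * (l - 2 * k).factorial)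

/-- Binomial expansion in Rodrigues' formula; the terms with `2 k > l` have degree below `l` and are
killed by the `l` derivatives. -/
theorem legendre_eq_sum (l : ℕ) :
    legendre l = ∑ k ∈ Finset.range (l / 2 + 1),
      Polynomial.C (legCoeff l k) * Polynomial.X ^ (l - 2 * k) := by
  unfold legendre
  rw [sub_eq_add_neg, add_comm, add_pow, Polynomial.iterate_derivative_sum, Finset.mul_sum]
  have hterm : ∀ k ∈ Finset.range (l + 1),
      Polynomial.C (1 / (2 ^ l * (l.factorial : ℝ))) * Polynomial.derivative^[l]
        ((-1) ^ k * (Polynomial.X ^ 2) ^ (l - k) * (l.choose k : Polynomial ℝ))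
      = if k ∈ Finset.range (l / 2 + 1) then
          Polynomial.C (legCoeff l k) * Polynomial.X ^ (l - 2 * k) else 0 := by
    intro k hk
    have hk' : k ≤ l := by simpa [Nat.lt_succ_iff] using hk
    have e : ((-1) ^ k * (Polynomial.X ^ 2) ^ (l - k) * (l.choose k : Polynomial ℝ))
        = Polynomial.C ((-1) ^ k * (l.choose k : ℝ)) * Polynomial.X ^ (2 * l - 2 * k) := by
      rw [← pow_mul, Nat.mul_sub]
      simp
      ring
    rw [e, Polynomial.iterate_derivative_C_mul, Polynomial.iterate_derivative_X_pow_eq_C_mul,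
      ← mul_assoc, ← mul_assoc, ← Polynomial.C_mul, ← Polynomial.C_mul]
    split_ifs with h
    · have h2 : 2 * k ≤ l := by
        have : k < l / 2 + 1 := by simpa using h
        omega
      rw [show 2 * l - 2 * k - l = l - 2 * k by omega]
      congr 2
      have hd : ((2 * l - 2 * k).descFactorial l : ℝ)
          = (2 * l - 2 * k).factorial / (l - 2 * k).factorial := by
        rw [Nat.descFactorial_eq_div (by omega), show 2 * l - 2 * k - l = l - 2 * k by omega,
          Nat.cast_div (Nat.factorial_dvd_factorial (by omega)) (by positivity)]
      rw [hd, legCoeff, Nat.cast_choose ℝ hk']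
      have := (Nat.cast_pos (α := ℝ)).2 (Nat.factorial_pos l)
      field_simp
    · have h2 : l < 2 * k := by
        have : ¬ k < l / 2 + 1 := by simpa using h
        omega
      rw [Nat.descFactorial_of_lt (by omega)]
      simp
  rw [Finset.sum_congr rfl hterm, Finset.sum_ite_mem]
  congr 1
  ext k
  simp
  omega

/-- The Legendre equation at the level of coefficients; it is exactly what makes `zonalPoly`
harmonic. -/
theorem legCoeff_succ {l k : ℕ} (h : 2 * k + 2 ≤ l) :
    legCoeff l (k + 1) * (2 * (k + 1) * (2 * l - 2 * k - 1))
      = -(legCoeff l k * ((l - 2 * k : ℕ) * ((l - 2 * k : ℕ) - 1))) := by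
  obtain ⟨j, rfl⟩ := Nat.exists_eq_add_of_le h
  unfold legCoeff
  rw [show 2 * (2 * k + 2 + j) - 2 * (k + 1) = 2 * k + 2 * j + 2 by omega,
    show 2 * (2 * k + 2 + j) - 2 * k = 2 * k + 2 * j + 2 + 1 + 1 by omega,
    show 2 * k + 2 + j - (k + 1) = k + j + 1 by omega,
    show 2 * k + 2 + j - k = k + j + 1 + 1 by omega,
    show 2 * k + 2 + j - 2 * (k + 1) = j by omega,
    show 2 * k + 2 + j - 2 * k = j + 1 + 1 by omega,
    Nat.factorial_succ (2 * k + 2 * j + 2 + 1), Nat.factorial_succ (2 * k + 2 * j + 2),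
    Nat.factorial_succ (k + j + 1), Nat.factorial_succ (j + 1), Nat.factorial_succ j,
    Nat.factorial_succ k]
  have h1 := (Nat.cast_pos (α := ℝ)).2 (Nat.factorial_pos k)
  have h2 := (Nat.cast_pos (α := ℝ)).2 (Nat.factorial_pos j)
  have h3 := (Nat.cast_pos (α := ℝ)).2 (Nat.factorial_pos (k + j + 1))
  push_cast
  field_simp
  ring

/-- The constant of the reproducing formula: only the leading coefficient of `P_l` contributes
there. -/
theorem powConst_mul_legCoeff (l : ℕ) : powConst l * legCoeff l 0 = 4 * Real.pi / (2 * l + 1) := by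
  induction l with
  | zero => simp [powConst, legCoeff]
  | succ l ih =>
    have h : legCoeff (l + 1) 0 = legCoeff l 0 * ((2 * l + 1) / (l + 1)) := by
      unfold legCoeff
      simp only [mul_zero, Nat.sub_zero]
      rw [show 2 * (l + 1) = 2 * l + 1 + 1 by ring, Nat.factorial_succ (2 * l + 1),
        Nat.factorial_succ (2 * l), Nat.factorial_succ l]
      have h1 := (Nat.cast_pos (α := ℝ)).2 (Nat.factorial_pos l)
      push_cast
      field_simp
      ring
    rw [h, powConst]
    calc _ = powConst l * legCoeff l 0 * ((l + 1) / (2 * l + 3) * ((2 * l + 1) / (l + 1))) := by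
          ring
      _ = _ := by
          rw [ih]
          push_cast
          field_simp
          ring

theorem natDegree_legendre_le (l : ℕ) : (legendre l).natDegree ≤ l := by
  rw [legendre_eq_sum]
  refine Polynomial.natDegree_sum_le_of_forall_le _ _ fun k _ => ?_
  exact (Polynomial.natDegree_C_mul_X_pow_le _ _).trans (Nat.sub_le _ _)

theorem coeff_legendre_self (l : ℕ) : (legendre l).coeff l = legCoeff l 0 := by
  rw [legendre_eq_sum, Polynomial.finsetSum_coeff, Finset.sum_eq_single 0]
  · simp
  · intro k hk h0
    rw [Polynomial.coeff_C_mul, Polynomial.coeff_X_pow, if_neg, mul_zero]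
    have : k < l / 2 + 1 := by simpa using hk
    omega
  · simp

theorem legCoeff_zero_pos (l : ℕ) : 0 < legCoeff l 0 := by
  unfold legCoeff
  positivity

/-- Taylor expansion at `1` turns `(X ^ 2 - 1) ^ l` into `(X + 2) ^ l * X ^ l`, whose coefficient of
`X ^ l` is `2 ^ l`. -/
theorem legendre_eval_one (l : ℕ) : (legendre l).eval 1 = 1 := by
  have h1 : (Polynomial.derivative^[l] ((Polynomial.X ^ 2 - 1 : Polynomial ℝ) ^ l)).eval 1
      = l.factorial * 2 ^ l := by
    rw [← Polynomial.factorial_smul_hasseDeriv]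
    have ht := Polynomial.taylor_coeff (1 : ℝ) ((Polynomial.X ^ 2 - 1 : Polynomial ℝ) ^ l) l
    have e : Polynomial.taylor (1 : ℝ) ((Polynomial.X ^ 2 - 1 : Polynomial ℝ) ^ l)
        = (Polynomial.X + 2) ^ l * Polynomial.X ^ l := by
      rw [← mul_pow]
      simp [Polynomial.taylor_apply]
      ring
    rw [e, Polynomial.coeff_mul_X_pow'] at ht
    simp [Polynomial.coeff_zero_eq_eval_zero] at ht
    simp [← ht]
  unfold legendre
  rw [Polynomial.eval_mul, h1, Polynomial.eval_C]
  have := (Nat.cast_pos (α := ℝ)).2 (Nat.factorial_pos l)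
  field_simp

/-! ### Zonal harmonics and the reproducing property -/

theorem polyLaplacian_mul (p q : MvPolynomial (Fin 3) ℂ) :
    polyLaplacian (p * q) = polyLaplacian p * q + p * polyLaplacian q
      + 2 * ∑ i, MvPolynomial.pderiv i p * MvPolynomial.pderiv i q := by
  unfold polyLaplacian
  rw [Finset.sum_mul, Finset.mul_sum, Finset.mul_sum, ← Finset.sum_add_distrib,
    ← Finset.sum_add_distrib]
  refine Finset.sum_congr rfl fun i _ => ?_
  simp only [Derivation.leibniz, smul_eq_mul, map_add]
  ring

theorem pderiv_normSqPoly (i : Fin 3) :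
    MvPolynomial.pderiv i normSqPoly = 2 * MvPolynomial.X i := by
  unfold normSqPoly
  rw [map_sum, Finset.sum_eq_single i]
  · rw [Derivation.leibniz, MvPolynomial.pderiv_X_self, smul_eq_mul]
    ring
  · intro j _ hj
    rw [Derivation.leibniz, MvPolynomial.pderiv_X_of_ne hj, smul_zero, add_zero]
  · simp

theorem pderiv_normSqPoly_pow (i : Fin 3) (k : ℕ) : MvPolynomial.pderiv i (normSqPoly ^ k)
    = ((2 * k : ℕ) : ℂ) • (normSqPoly ^ (k - 1) * MvPolynomial.X i) := by
  rw [Derivation.leibniz_pow, pderiv_normSqPoly, ← Nat.cast_smul_eq_nsmul ℂ, smul_eq_mul,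
    mul_left_comm, ← smul_mul_assoc, ← mul_smul_comm, Nat.cast_mul, mul_comm _ (k : ℂ), mul_smul,
    smul_mul_assoc, MvPolynomial.smul_eq_C_mul, MvPolynomial.smul_eq_C_mul,
    MvPolynomial.smul_eq_C_mul]
  simp only [Nat.cast_ofNat, map_natCast, map_ofNat]
  ring

theorem polyLaplacian_normSqPoly_pow (k : ℕ) : polyLaplacian (normSqPoly ^ k)
    = ((2 * k * (2 * k + 1) : ℕ) : ℂ) • normSqPoly ^ (k - 1) := by
  rcases k with _ | k
  · simp [polyLaplacian]
  have h : ∀ i : Fin 3, MvPolynomial.pderiv i (MvPolynomial.pderiv i (normSqPoly ^ (k + 1)))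
      = ((2 * (k + 1) : ℕ) : ℂ) • (normSqPoly ^ k + ((2 * k : ℕ) : ℂ) •
        (normSqPoly ^ (k - 1) * (MvPolynomial.X i * MvPolynomial.X i))) := by
    intro i
    rw [pderiv_normSqPoly_pow, Derivation.map_smul, Derivation.leibniz, Nat.add_sub_cancel,
      pderiv_normSqPoly_pow, MvPolynomial.pderiv_X_self, smul_eq_mul, smul_eq_mul, mul_one,
      mul_smul_comm, mul_left_comm]
  have h2 : ((2 * k : ℕ) : ℂ) • (normSqPoly ^ (k - 1) * normSqPoly)
      = ((2 * k : ℕ) : ℂ) • normSqPoly ^ k := by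
    rcases k with _ | k
    · simp
    · rw [Nat.add_sub_cancel, pow_succ]
  unfold polyLaplacian
  rw [Finset.sum_congr rfl fun i _ => h i, ← Finset.smul_sum, Finset.sum_add_distrib,
    ← Finset.smul_sum, ← Finset.mul_sum]
  change _ • (_ + _ • (_ * normSqPoly)) = _
  rw [h2, Nat.add_sub_cancel, Finset.sum_const, Finset.card_univ, Fintype.card_fin,
    ← Nat.cast_smul_eq_nsmul ℂ, ← add_smul, smul_smul]
  congr 1
  push_cast
  ring

theorem polyLaplacian_linPoly_pow (x : S2) (m : ℕ) : polyLaplacian (linPoly x ^ m)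
    = ((m : ℂ) * ((m - 1 : ℕ) : ℂ)) • linPoly x ^ (m - 2) := by
  unfold polyLaplacian
  simp only [pderiv_linPoly_pow, Derivation.map_smul, smul_smul]
  rw [← Finset.sum_smul, Nat.sub_sub]
  congr 1
  calc _ = (m : ℂ) * ((m - 1 : ℕ) : ℂ) * ∑ i, ((x : E3) i : ℂ) * ((x : E3) i : ℂ) := by
        rw [Finset.mul_sum]
        exact Finset.sum_congr rfl fun i _ => by ring
    _ = _ := by rw [sum_sq_sphere, mul_one]

theorem sum_pderiv_mul_pderiv (x : E3) (m k : ℕ) :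
    ∑ i, MvPolynomial.pderiv i (linPoly x ^ m) * MvPolynomial.pderiv i (normSqPoly ^ k)
      = ((m : ℂ) * (2 * k : ℕ)) • (linPoly x ^ m * normSqPoly ^ (k - 1)) := by
  simp only [pderiv_linPoly_pow, pderiv_normSqPoly_pow]
  have h : ∀ i : Fin 3, (((m : ℂ) * ((x i : ℝ) : ℂ)) • linPoly x ^ (m - 1)) *
      ((2 * k : ℕ) : ℂ) • (normSqPoly ^ (k - 1) * MvPolynomial.X i)
      = ((m : ℂ) * (2 * k : ℕ)) • (linPoly x ^ (m - 1) * normSqPoly ^ (k - 1) *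
        (((x i : ℝ) : ℂ) • MvPolynomial.X i)) := by
    intro i
    simp only [MvPolynomial.smul_eq_C_mul, map_mul]
    ring
  simp only [h]
  rw [← Finset.smul_sum, ← Finset.mul_sum]
  change _ • (_ * linPoly x) = _
  rcases m with _ | m
  · simp
  · rw [Nat.add_sub_cancel, pow_succ]
    congr 1
    ring

/-- The homogeneous harmonic polynomial of degree `l` which restricts to the zonal harmonic with
pole `x`. -/
def zonalPoly (l : ℕ) (x : S2) : MvPolynomial (Fin 3) ℂ :=
  ∑ k ∈ Finset.range (l / 2 + 1),
    (legCoeff l k : ℂ) • (linPoly x ^ (l - 2 * k) * normSqPoly ^ k)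

theorem normSqPoly_isHomogeneous : normSqPoly.IsHomogeneous 2 :=
  MvPolynomial.IsHomogeneous.sum _ _ _ fun j _ =>
    (MvPolynomial.isHomogeneous_X ℂ j).mul (MvPolynomial.isHomogeneous_X ℂ j)

theorem zonalPoly_isHomogeneous (l : ℕ) (x : S2) : (zonalPoly l x).IsHomogeneous l := by
  refine MvPolynomial.IsHomogeneous.sum _ _ _ fun k hk => ?_
  have hk' : k < l / 2 + 1 := by simpa using hk
  rw [MvPolynomial.smul_eq_C_mul]
  have := (MvPolynomial.isHomogeneous_C (Fin 3) (legCoeff l k : ℂ)).mul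
    (((linPoly_isHomogeneous x).pow (l - 2 * k)).mul (normSqPoly_isHomogeneous.pow k))
  rwa [show 0 + (1 * (l - 2 * k) + 2 * k) = l by omega] at this

/-- The Laplacian of each summand has two pieces, and the first piece of index `k` cancels the
second of index `k + 1` by `legCoeff_succ`. The unpaired pieces vanish: at the top because `l - 2 k`
is `0` or `1`, at the bottom because of a factor `k`. -/
theorem polyLaplacian_zonalPoly (l : ℕ) (x : S2) : polyLaplacian (zonalPoly l x) = 0 := by
  have hterm : ∀ k, polyLaplacian ((legCoeff l k : ℂ) • (linPoly x ^ (l - 2 * k) * normSqPoly ^ k))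
      = ((legCoeff l k * ((l - 2 * k : ℕ) * (l - 2 * k - 1 : ℕ)) : ℝ) : ℂ) •
          (linPoly x ^ (l - 2 * k - 2) * normSqPoly ^ k)
        + ((legCoeff l k * (2 * k * (2 * k + 1) + 4 * k * (l - 2 * k : ℕ)) : ℝ) : ℂ) •
          (linPoly x ^ (l - 2 * k) * normSqPoly ^ (k - 1)) := by
    intro k
    rw [polyLaplacian_smul, polyLaplacian_mul, polyLaplacian_linPoly_pow,
      polyLaplacian_normSqPoly_pow, sum_pderiv_mul_pderiv]
    simp only [MvPolynomial.smul_eq_C_mul]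
    push_cast
    simp only [map_mul, map_add, map_natCast, map_one, map_ofNat]
    ring
  unfold zonalPoly
  rw [polyLaplacian_sum, Finset.sum_congr rfl fun k _ => hterm k, Finset.sum_add_distrib,
    Finset.sum_range_succ, Finset.sum_range_succ' (fun k => _ • (_ * normSqPoly ^ (k - 1)))]
  have h1 : (((l - 2 * (l / 2) : ℕ) : ℝ) * (l - 2 * (l / 2) - 1 : ℕ)) = 0 := by
    have : l - 2 * (l / 2) = 0 ∨ l - 2 * (l / 2) - 1 = 0 := by omega
    rcases this with h | h <;> simp [h]
  rw [h1]
  simp only [mul_zero, Nat.cast_zero, zero_mul, zero_add, Complex.ofReal_zero, zero_smul, add_zero]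
  rw [← Finset.sum_add_distrib]
  refine Finset.sum_eq_zero fun k hk => ?_
  have hk' : 2 * k + 2 ≤ l := by
    have : k < l / 2 := by simpa using hk
    omega
  have h := legCoeff_succ hk'
  rw [Nat.add_sub_cancel, show l - 2 * k - 2 = l - 2 * (k + 1) by omega, ← add_smul,
    ← Complex.ofReal_add]
  have e : legCoeff l k * ((l - 2 * k : ℕ) * (l - 2 * k - 1 : ℕ)) + legCoeff l (k + 1) *
      (2 * (k + 1 : ℕ) * (2 * (k + 1 : ℕ) + 1) + 4 * (k + 1 : ℕ) * (l - 2 * (k + 1) : ℕ)) = 0 := by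
    obtain ⟨j, rfl⟩ := Nat.exists_eq_add_of_le hk'
    rw [show 2 * k + 2 + j - 2 * k = j + 2 by omega] at h ⊢
    rw [show 2 * k + 2 + j - 2 * (k + 1) = j by omega, show j + 2 - 1 = j + 1 by omega]
    push_cast at h ⊢
    linear_combination h
  rw [e, Complex.ofReal_zero, zero_smul]

theorem restrictToSphere_zonalPoly (l : ℕ) (x y : S2) : restrictToSphere (zonalPoly l x) y
    = ((legendre l).eval (inner ℝ (x : E3) (y : E3)) : ℝ) := by
  have hp : ∀ (p : MvPolynomial (Fin 3) ℂ) (n : ℕ), evalE (p ^ n) y = evalE p y ^ n :=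
    fun p n => map_pow (MvPolynomial.eval fun i => (((y : E3) i : ℝ) : ℂ)) p n
  have hn : evalE normSqPoly y = 1 := restrictToSphere_normSqPoly y
  change evalE _ _ = _
  rw [legendre_eq_sum, zonalPoly, evalE_sum, Polynomial.eval_finsetSum]
  simp only [evalE_const_smul, evalE_mul, hp, evalE_linPoly, hn]
  simp

theorem legendre_mem_harmonicSpace (l : ℕ) (x : S2) :
    (fun y : S2 => (((legendre l).eval (inner ℝ (x : E3) (y : E3)) : ℝ) : ℂ))
      ∈ harmonicSpace l :=
  Submodule.subset_span ⟨zonalPoly l x, zonalPoly_isHomogeneous l x, polyLaplacian_zonalPoly l x,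
    funext fun y => restrictToSphere_zonalPoly l x y⟩

theorem exists_poly_of_mem_harmonicSpace {l : ℕ} {Y : S2 → ℂ} (hY : Y ∈ harmonicSpace l) :
    ∃ q : MvPolynomial (Fin 3) ℂ, q.IsHomogeneous l ∧ polyLaplacian q = 0 ∧
      restrictToSphere q = Y := by
  induction hY using Submodule.span_induction with
  | mem f hf => exact hf
  | zero => exact ⟨0, MvPolynomial.isHomogeneous_zero _ _ _, by simp [polyLaplacian], map_zero _⟩
  | add f g _ _ hf hg =>
    obtain ⟨p, h1, h2, rfl⟩ := hf
    obtain ⟨q, h3, h4, rfl⟩ := hg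
    exact ⟨p + q, h1.add h3, by rw [polyLaplacian_add, h2, h4, add_zero], map_add _ _ _⟩
  | smul c f _ hf =>
    obtain ⟨p, h1, h2, rfl⟩ := hf
    refine ⟨c • p, ?_, by rw [polyLaplacian_smul, h2, smul_zero], map_smul _ _ _⟩
    rw [MvPolynomial.smul_eq_C_mul]
    simpa using (MvPolynomial.isHomogeneous_C (Fin 3) c).mul h1

theorem continuous_of_mem_harmonicSpace {l : ℕ} {Y : S2 → ℂ} (hY : Y ∈ harmonicSpace l) :
    Continuous Y := by
  obtain ⟨q, _, _, rfl⟩ := exists_poly_of_mem_harmonicSpace hY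
  exact continuous_restrictToSphere q

/-- Expand `P_l` in powers of `⟨x, y⟩`. Powers below `l` are orthogonal to harmonics of degree `l`,
and the top power is handled by `sphInt_mul_linPoly_pow`. -/
theorem integral_legendre_mul (l : ℕ) (x : S2) {Y : S2 → ℂ} (hY : Y ∈ harmonicSpace l) :
    ∫ y : S2, (((legendre l).eval (inner ℝ (x : E3) (y : E3)) : ℝ) : ℂ) * Y y ∂surf
      = ((4 * Real.pi / (2 * l + 1) : ℝ) : ℂ) * Y x := by
  obtain ⟨q, hq, hΔ, rfl⟩ := exists_poly_of_mem_harmonicSpace hY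
  have h1 : ∀ y : S2, (((legendre l).eval (inner ℝ (x : E3) (y : E3)) : ℝ) : ℂ) *
      restrictToSphere q y = restrictToSphere (∑ n ∈ Finset.range (l + 1),
        (((legendre l).coeff n : ℝ) : ℂ) • (q * linPoly x ^ n)) y := by
    intro y
    have hp : ∀ (p : MvPolynomial (Fin 3) ℂ) (n : ℕ), evalE (p ^ n) y = evalE p y ^ n :=
      fun p n => map_pow (MvPolynomial.eval fun i => (((y : E3) i : ℝ) : ℂ)) p n
    change _ * evalE q y = evalE _ y
    rw [Polynomial.eval_eq_sum_range' (Nat.lt_succ_of_le (natDegree_legendre_le l)), evalE_sum]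
    push_cast
    rw [Finset.sum_mul]
    refine Finset.sum_congr rfl fun n _ => ?_
    rw [evalE_const_smul, evalE_mul, hp, evalE_linPoly]
    ring
  simp only [h1]
  change sphInt _ = _
  rw [sphInt_sum, Finset.sum_range_succ, Finset.sum_eq_zero, zero_add, sphInt_smul,
    sphInt_mul_linPoly_pow _ hq hΔ, coeff_legendre_self, ← powConst_mul_legCoeff]
  · change _ * (_ * restrictToSphere q x) = _
    push_cast
    ring
  · intro n hn
    rw [sphInt_smul, sphInt_mul_eq_zero hq hΔ (d := n)
      (by simpa using (linPoly_isHomogeneous x).pow n) (by simpa using hn), mul_zero]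

theorem integral_mul_of_mem_harmonicSpace {l l' : ℕ} (h : l ≠ l') {Y Y' : S2 → ℂ}
    (hY : Y ∈ harmonicSpace l) (hY' : Y' ∈ harmonicSpace l') : ∫ y, Y y * Y' y ∂surf = 0 := by
  obtain ⟨p, hp, hpΔ, rfl⟩ := exists_poly_of_mem_harmonicSpace hY
  obtain ⟨q, hq, hqΔ, rfl⟩ := exists_poly_of_mem_harmonicSpace hY'
  have h1 : ∫ y, restrictToSphere p y * restrictToSphere q y ∂surf = sphInt (p * q) := by
    simp [sphInt, restrictToSphere_mul]
  rw [h1]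
  rcases lt_or_gt_of_ne h with hl | hl
  · rw [mul_comm, sphInt_mul_eq_zero hq hqΔ hp hl]
  · rw [sphInt_mul_eq_zero hp hpΔ hq hl]

theorem integral_legendre_mul_of_ne {l l' : ℕ} (h : l ≠ l') (x : S2) {Y : S2 → ℂ}
    (hY : Y ∈ harmonicSpace l') :
    ∫ y : S2, (((legendre l).eval (inner ℝ (x : E3) (y : E3)) : ℝ) : ℂ) * Y y ∂surf = 0 :=
  integral_mul_of_mem_harmonicSpace h (legendre_mem_harmonicSpace l x) hY

theorem integral_legendre_mul_legendre (l l' : ℕ) (x z : S2) :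
    ∫ y : S2, (legendre l).eval (inner ℝ (x : E3) (y : E3)) *
        (legendre l').eval (inner ℝ (y : E3) (z : E3)) ∂surf
      = if l = l' then 4 * Real.pi / (2 * l + 1) * (legendre l).eval (inner ℝ (x : E3) (z : E3))
        else 0 := by
  have e : ∀ y : S2, inner ℝ (y : E3) (z : E3) = inner ℝ (z : E3) (y : E3) := fun y =>
    real_inner_comm _ _
  apply Complex.ofReal_injective
  rw [← integral_complex_ofReal]
  simp only [Complex.ofReal_mul, e]
  split_ifs with h
  · subst h
    rw [integral_legendre_mul l x (legendre_mem_harmonicSpace l z),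
      real_inner_comm (x : E3) (z : E3)]
    simp
  · rw [integral_legendre_mul_of_ne h x (legendre_mem_harmonicSpace l' z)]
    simp

/-! ### The Funk-Hecke formula -/

theorem inner_mem_Icc (x y : S2) : inner ℝ (x : E3) (y : E3) ∈ Set.Icc (-1 : ℝ) 1 := by
  have h := abs_real_inner_le_norm (x : E3) (y : E3)
  rw [norm_eq_of_mem_sphere, norm_eq_of_mem_sphere, mul_one] at h
  exact abs_le.1 h

theorem inner_self_sphere (x : S2) : inner ℝ (x : E3) (x : E3) = 1 := by
  rw [real_inner_self_eq_norm_sq, norm_eq_of_mem_sphere, one_pow]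

/-- A pole of the sphere. -/
def pole : S2 := ⟨EuclideanSpace.single 0 1, by simp⟩

theorem continuous_legendre_inner (l : ℕ) (x : S2) :
    Continuous fun y : S2 => (legendre l).eval (inner ℝ (x : E3) (y : E3)) := by
  have := (legendre l).continuous
  fun_prop

theorem continuous_legendre_inner' (l : ℕ) (x : S2) :
    Continuous fun y : S2 => (legendre l).eval (inner ℝ (y : E3) (x : E3)) := by
  have := (legendre l).continuous
  fun_prop

/-- `P_l` has exact degree `l`, so leading terms can be removed one at a time. -/
theorem exists_legendre_expansion (n : ℕ) (p : Polynomial ℝ) (hp : p.natDegree ≤ n) :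
    ∃ a : ℕ → ℝ, p = ∑ l ∈ Finset.range (n + 1), Polynomial.C (a l) * legendre l := by
  induction n generalizing p with
  | zero =>
    refine ⟨fun _ => p.coeff 0, ?_⟩
    have h : legendre 0 = 1 := by simp [legendre]
    rw [Finset.sum_range_one, h, mul_one]
    exact Polynomial.eq_C_of_natDegree_le_zero hp
  | succ n ih =>
    set c := p.coeff (n + 1) / legCoeff (n + 1) 0 with hc
    have hq : (p - Polynomial.C c * legendre (n + 1)).natDegree ≤ n := by
      have h1 : (p - Polynomial.C c * legendre (n + 1)).natDegree ≤ n + 1 :=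
        (Polynomial.natDegree_sub_le _ _).trans (max_le hp
          ((Polynomial.natDegree_C_mul_le _ _).trans (natDegree_legendre_le _)))
      refine Nat.le_of_lt_succ (lt_of_le_of_ne h1 fun h => ?_)
      have h2 : (p - Polynomial.C c * legendre (n + 1)).coeff (n + 1) = 0 := by
        rw [Polynomial.coeff_sub, Polynomial.coeff_C_mul, coeff_legendre_self, hc,
          div_mul_cancel₀ _ (legCoeff_zero_pos _).ne', sub_self]
      have h3 : (p - Polynomial.C c * legendre (n + 1)) = 0 := by
        rw [← Polynomial.leadingCoeff_eq_zero, Polynomial.leadingCoeff, h, h2]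
      rw [h3, Polynomial.natDegree_zero] at h
      exact absurd h (by omega)
    obtain ⟨a, ha⟩ := ih _ hq
    refine ⟨fun l => if l = n + 1 then c else a l, ?_⟩
    rw [Finset.sum_range_succ]
    dsimp only
    rw [if_pos rfl]
    have : ∑ l ∈ Finset.range (n + 1), Polynomial.C (if l = n + 1 then c else a l) * legendre l
        = ∑ l ∈ Finset.range (n + 1), Polynomial.C (a l) * legendre l := by
      refine Finset.sum_congr rfl fun l hl => ?_
      rw [if_neg (by have := Finset.mem_range.1 hl; omega)]
    rw [this, ← ha, sub_add_cancel]

/-- The eigenvalue on the harmonics of degree `l` of the isotropic operator with kernel `κ`. -/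
def fhCoeff (κ : ℝ → ℝ) (l : ℕ) : ℝ :=
  ∫ z : S2, κ (inner ℝ (pole : E3) (z : E3)) * (legendre l).eval (inner ℝ (z : E3) (pole : E3))
    ∂surf

/-- In the Legendre expansion of `p` only the term of degree `l` survives. Evaluating at `x = y =
pole`, where `P_l(1) = 1`, identifies the resulting scalar as `fhCoeff`. -/
theorem funk_hecke_polynomial (p : Polynomial ℝ) (l : ℕ) (x y : S2) :
    ∫ z : S2, p.eval (inner ℝ (x : E3) (z : E3)) * (legendre l).eval (inner ℝ (z : E3) (y : E3))
      ∂surf = fhCoeff (fun c => p.eval c) l * (legendre l).eval (inner ℝ (x : E3) (y : E3)) := by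
  obtain ⟨a, ha⟩ := exists_legendre_expansion p.natDegree p le_rfl
  have key : ∀ x y : S2, ∫ z : S2, p.eval (inner ℝ (x : E3) (z : E3)) *
      (legendre l).eval (inner ℝ (z : E3) (y : E3)) ∂surf
      = (if l ∈ Finset.range (p.natDegree + 1) then a l * (4 * Real.pi / (2 * l + 1)) else 0)
        * (legendre l).eval (inner ℝ (x : E3) (y : E3)) := by
    intro x y
    have e : ∀ z : S2, p.eval (inner ℝ (x : E3) (z : E3)) *
        (legendre l).eval (inner ℝ (z : E3) (y : E3)) = ∑ l' ∈ Finset.range (p.natDegree + 1),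
          a l' * ((legendre l').eval (inner ℝ (x : E3) (z : E3)) *
            (legendre l).eval (inner ℝ (z : E3) (y : E3))) := by
      intro z
      conv_lhs => rw [ha]
      rw [Polynomial.eval_finsetSum, Finset.sum_mul]
      refine Finset.sum_congr rfl fun l' _ => ?_
      rw [Polynomial.eval_mul, Polynomial.eval_C, mul_assoc]
    simp only [e]
    have hi : ∀ l' ∈ Finset.range (p.natDegree + 1), Integrable (fun z : S2 =>
        a l' * ((legendre l').eval (inner ℝ (x : E3) (z : E3)) *
          (legendre l).eval (inner ℝ (z : E3) (y : E3)))) surf := fun l' _ =>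
      integrable_of_continuous (continuous_const.mul
        ((continuous_legendre_inner l' x).mul (continuous_legendre_inner' l y)))
    rw [integral_finsetSum _ hi]
    simp only [integral_const_mul, integral_legendre_mul_legendre]
    simp only [mul_ite, mul_zero, Finset.sum_ite_eq']
    split_ifs <;> ring
  unfold fhCoeff
  rw [key, key, inner_self_sphere, legendre_eval_one, mul_one]

theorem exists_legendre_bound (l : ℕ) :
    ∃ M : ℝ, 0 ≤ M ∧ ∀ c ∈ Set.Icc (-1 : ℝ) 1, |(legendre l).eval c| ≤ M := by
  obtain ⟨M, hM⟩ := (isCompact_Icc (a := (-1 : ℝ)) (b := 1)).exists_bound_of_continuousOn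
    (legendre l).continuousOn
  refine ⟨max M 0, le_max_right _ _, fun c hc => ?_⟩
  exact (hM c hc).trans (le_max_left _ _)

/-- Weierstrass approximation reduces to polynomial kernels, since both sides depend continuously on
`κ` in the uniform norm on `[-1, 1]`. -/
theorem funk_hecke {κ : ℝ → ℝ} (hκ : Continuous κ) (l : ℕ) (x y : S2) :
    ∫ z : S2, κ (inner ℝ (x : E3) (z : E3)) * (legendre l).eval (inner ℝ (z : E3) (y : E3)) ∂surf
      = fhCoeff κ l * (legendre l).eval (inner ℝ (x : E3) (y : E3)) := by
  obtain ⟨M, hM0, hM⟩ := exists_legendre_bound l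
  have hb : ∀ ε > 0, ∀ p : Polynomial ℝ, (∀ c ∈ Set.Icc (-1 : ℝ) 1, |p.eval c - κ c| < ε) →
      ∀ x y : S2, |(∫ z : S2, κ (inner ℝ (x : E3) (z : E3)) *
          (legendre l).eval (inner ℝ (z : E3) (y : E3)) ∂surf) -
        ∫ z : S2, p.eval (inner ℝ (x : E3) (z : E3)) *
          (legendre l).eval (inner ℝ (z : E3) (y : E3)) ∂surf| ≤ ε * M * (4 * Real.pi) := by
    intro ε hε p hp x y
    have hpc := p.continuous
    have c1 := continuous_legendre_inner' l y
    have i1 : Integrable (fun z : S2 => κ (inner ℝ (x : E3) (z : E3)) *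
          (legendre l).eval (inner ℝ (z : E3) (y : E3))) surf :=
      integrable_of_continuous (by fun_prop)
    have i2 : Integrable (fun z : S2 => p.eval (inner ℝ (x : E3) (z : E3)) *
          (legendre l).eval (inner ℝ (z : E3) (y : E3))) surf :=
      integrable_of_continuous (by fun_prop)
    rw [← integral_sub i1 i2, ← Real.norm_eq_abs, ← surf_real_univ]
    refine norm_integral_le_of_norm_le_const (Eventually.of_forall fun z => ?_)
    rw [← sub_mul, norm_mul]
    refine mul_le_mul ?_ (hM _ (inner_mem_Icc _ _)) (norm_nonneg _) hε.le
    rw [norm_sub_rev]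
    exact (hp _ (inner_mem_Icc _ _)).le
  by_contra hne
  set δ := |(∫ z : S2, κ (inner ℝ (x : E3) (z : E3)) *
    (legendre l).eval (inner ℝ (z : E3) (y : E3)) ∂surf)
      - fhCoeff κ l * (legendre l).eval (inner ℝ (x : E3) (y : E3))| with hδ
  have hδ0 : 0 < δ := abs_pos.2 (sub_ne_zero.2 hne)
  -- With accuracy `δ / K` the errors of the two sides add up to `δ (K - 1) / K`, which is less than
  -- the supposed discrepancy `δ`.
  set K := M * (4 * Real.pi) * (1 + M) + 1 with hK
  have hK0 : 0 < K := by positivity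
  obtain ⟨p, hp⟩ := exists_polynomial_near_of_continuousOn (-1) 1 κ hκ.continuousOn (δ / K)
    (by positivity)
  have h1 := hb _ (by positivity) p hp x y
  have h2 := hb _ (by positivity) p hp pole pole
  rw [funk_hecke_polynomial] at h1
  change |fhCoeff κ l - fhCoeff (fun c => p.eval c) l| ≤ _ at h2
  have h3 := hM _ (inner_mem_Icc x y)
  have h4 : δ ≤ δ / K * M * (4 * Real.pi) + δ / K * M * (4 * Real.pi) * M := by
    calc δ = |((∫ z : S2, κ (inner ℝ (x : E3) (z : E3)) *
          (legendre l).eval (inner ℝ (z : E3) (y : E3)) ∂surf)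
          - fhCoeff (fun c => p.eval c) l * (legendre l).eval (inner ℝ (x : E3) (y : E3)))
          - (fhCoeff κ l - fhCoeff (fun c => p.eval c) l) *
            (legendre l).eval (inner ℝ (x : E3) (y : E3))| := by
          rw [hδ]
          congr 1
          ring
      _ ≤ _ := by
          refine (abs_sub _ _).trans (add_le_add h1 ?_)
          rw [abs_mul]
          exact mul_le_mul h2 h3 (abs_nonneg _) (by positivity)
  have h5 : δ / K * M * (4 * Real.pi) + δ / K * M * (4 * Real.pi) * M = δ * ((K - 1) / K) := by
    rw [hK]
    field_simp
    ring
  rw [h5] at h4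
  have h6 : (K - 1) / K < 1 := by
    rw [div_lt_one hK0]
    linarith
  nlinarith

/-! ### Isotropic kernels and their operators -/

/-- The kernel `(x, y) ↦ κ ⟨x, y⟩`. -/
def zonalKer (κ : ℝ → ℝ) (hκ : Continuous κ) : C(S2 × S2, ℂ) :=
  ⟨fun z => (κ (inner ℝ (z.1 : E3) (z.2 : E3)) : ℂ), by fun_prop⟩

/-- The reproducing kernel of the spherical harmonics of degree `l`. -/
def legKer (l : ℕ) : C(S2 × S2, ℂ) :=
  zonalKer (fun c => (2 * l + 1) / (4 * Real.pi) * (legendre l).eval c)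
    (continuous_const.mul (legendre l).continuous)

theorem legKer_apply (l : ℕ) (x y : S2) : legKer l (x, y)
    = ((2 * l + 1 : ℝ) / (4 * Real.pi) * (legendre l).eval (inner ℝ (x : E3) (y : E3)) : ℝ) := rfl

theorem integral_zonalKer_mul_legKer {κ : ℝ → ℝ} (hκ : Continuous κ) (l : ℕ) (x y : S2) :
    ∫ z, zonalKer κ hκ (x, z) * legKer l (z, y) ∂surf = (fhCoeff κ l : ℂ) * legKer l (x, y) := by
  have e : ∀ z : S2, zonalKer κ hκ (x, z) * legKer l (z, y)
      = (((2 * l + 1 : ℝ) / (4 * Real.pi) * (κ (inner ℝ (x : E3) (z : E3)) *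
        (legendre l).eval (inner ℝ (z : E3) (y : E3))) : ℝ) : ℂ) := by
    intro z
    rw [legKer_apply, zonalKer]
    simp only [ContinuousMap.coe_mk]
    push_cast
    ring
  simp only [e]
  rw [integral_complex_ofReal, integral_const_mul, funk_hecke hκ, legKer_apply]
  push_cast
  ring

theorem zonalKer_comm {κ : ℝ → ℝ} (hκ : Continuous κ) (x y : S2) :
    zonalKer κ hκ (x, y) = zonalKer κ hκ (y, x) := by
  simp only [zonalKer, ContinuousMap.coe_mk, real_inner_comm]

theorem integral_legKer_mul_zonalKer {κ : ℝ → ℝ} (hκ : Continuous κ) (l : ℕ) (x y : S2) :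
    ∫ z, legKer l (x, z) * zonalKer κ hκ (z, y) ∂surf = (fhCoeff κ l : ℂ) * legKer l (x, y) := by
  have h := integral_zonalKer_mul_legKer hκ l y x
  have e : legKer l (y, x) = legKer l (x, y) := zonalKer_comm _ _ _
  rw [e] at h
  rw [← h]
  refine integral_congr_ae (Eventually.of_forall fun z => ?_)
  have e2 : legKer l (x, z) = legKer l (z, x) := zonalKer_comm _ _ _
  change legKer l (x, z) * zonalKer κ hκ (z, y) = zonalKer κ hκ (y, z) * legKer l (z, x)
  rw [e2, zonalKer_comm hκ z y, mul_comm]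

theorem integral_legKer_mul_legKer (l l' : ℕ) (x y : S2) :
    ∫ z, legKer l (x, z) * legKer l' (z, y) ∂surf = if l = l' then legKer l (x, y) else 0 := by
  have e : ∀ z : S2, legKer l (x, z) * legKer l' (z, y)
      = (((2 * l + 1 : ℝ) / (4 * Real.pi) * ((2 * l' + 1 : ℝ) / (4 * Real.pi)) *
        ((legendre l).eval (inner ℝ (x : E3) (z : E3)) *
        (legendre l').eval (inner ℝ (z : E3) (y : E3))) : ℝ) : ℂ) := by
    intro z
    rw [legKer_apply, legKer_apply]
    push_cast
    ring
  simp only [e]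
  rw [integral_complex_ofReal, integral_const_mul, integral_legendre_mul_legendre]
  split_ifs with h
  · subst h
    rw [legKer_apply]
    congr 1
    have := Real.pi_pos
    field_simp
  · simp

/-! ### Algebra of integral operators -/

theorem integralOp_add (K₁ K₂ : C(S2 × S2, ℂ)) :
    integralOp (K₁ + K₂) = integralOp K₁ + integralOp K₂ := by
  ext1 h
  change ContinuousMap.toLp 2 surf ℂ _
    = ContinuousMap.toLp 2 surf ℂ _ + ContinuousMap.toLp 2 surf ℂ _
  rw [← map_add]
  congr 1
  ext x
  change ∫ y, (K₁ + K₂) (x, y) * h y ∂surf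
    = ∫ y, K₁ (x, y) * h y ∂surf + ∫ y, K₂ (x, y) * h y ∂surf
  rw [← integral_add (integrable_kernel_mul K₁ x h) (integrable_kernel_mul K₂ x h)]
  simp [add_mul]

theorem integralOp_smul (c : ℂ) (K : C(S2 × S2, ℂ)) :
    integralOp (c • K) = c • integralOp K := by
  ext1 h
  refine Eq.trans ?_ (map_smul (ContinuousMap.toLp 2 surf ℂ : C(S2, ℂ) →L[ℂ] L2S) c
    (integralOpCont K h))
  change ContinuousMap.toLp 2 surf ℂ _ = ContinuousMap.toLp 2 surf ℂ _
  congr 1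
  ext x
  change ∫ y, (c • K) (x, y) * h y ∂surf = c • ∫ y, K (x, y) * h y ∂surf
  rw [smul_eq_mul, ← integral_const_mul]
  simp [mul_assoc]

/-- `integralOp` as a linear map. -/
def integralOpL : C(S2 × S2, ℂ) →ₗ[ℂ] L2S →L[ℂ] L2S where
  toFun := integralOp
  map_add' := integralOp_add
  map_smul' := integralOp_smul

theorem integralOp_sum {ι : Type*} (s : Finset ι) (K : ι → C(S2 × S2, ℂ)) :
    integralOp (∑ i ∈ s, K i) = ∑ i ∈ s, integralOp (K i) :=
  map_sum integralOpL K s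

theorem integrable_coeFn (h : L2S) : Integrable (fun y => h y) surf :=
  (Lp.memLp h).integrable (by norm_num)

theorem integralOp_comp {K₁ K₂ K₃ : C(S2 × S2, ℂ)}
    (hK : ∀ x y, ∫ z, K₁ (x, z) * K₂ (z, y) ∂surf = K₃ (x, y)) :
    (integralOp K₁).comp (integralOp K₂) = integralOp K₃ := by
  ext1 h
  change ContinuousMap.toLp 2 surf ℂ _ = ContinuousMap.toLp 2 surf ℂ _
  congr 1
  ext x
  change ∫ z, K₁ (x, z) * integralOp K₂ h z ∂surf = ∫ y, K₃ (x, y) * h y ∂surf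
  have h1 : ∫ z, K₁ (x, z) * integralOp K₂ h z ∂surf
      = ∫ z, ∫ y, K₁ (x, z) * (K₂ (z, y) * h y) ∂surf ∂surf := by
    refine integral_congr_ae ?_
    filter_upwards [integralOp_ae K₂ h] with z hz
    rw [hz, integral_const_mul]
  have hint : Integrable (Function.uncurry fun z y => K₁ (x, z) * (K₂ (z, y) * h y))
      (surf.prod surf) := by
    have h0 : Integrable (fun w : S2 × S2 => (1 : ℂ) * h w.2) (surf.prod surf) :=
      (integrable_const (1 : ℂ)).mul_prod (integrable_coeFn h)
    have hc : Continuous fun w : S2 × S2 => K₁ (x, w.1) * K₂ w := by fun_prop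
    obtain ⟨C, hC⟩ := isCompact_univ.exists_bound_of_continuousOn hc.continuousOn
    refine (h0.bdd_mul (c := C) hc.aestronglyMeasurable
      (Eventually.of_forall fun w => hC w trivial)).congr (Eventually.of_forall fun w => ?_)
    simp only [Function.uncurry, one_mul]
    ring
  rw [h1, integral_integral_swap hint]
  refine integral_congr_ae (Eventually.of_forall fun y => ?_)
  simp only [← mul_assoc]
  rw [integral_mul_const, hK]

theorem inner_integralOp {K : C(S2 × S2, ℂ)} (hK : ∀ x y, star (K (x, y)) = K (y, x))
    (f g : L2S) : inner ℂ (integralOp K f) g = inner ℂ f (integralOp K g) := by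
  rw [L2.inner_def, L2.inner_def]
  have h1 : ∫ x, inner ℂ (integralOp K f x) (g x) ∂surf
      = ∫ x, ∫ y, star (f y) * (K (y, x) * g x) ∂surf ∂surf := by
    refine integral_congr_ae ?_
    filter_upwards [integralOp_ae K f] with x hx
    rw [hx]
    simp only [RCLike.inner_apply]
    rw [← integral_conj, ← integral_const_mul]
    refine integral_congr_ae (Eventually.of_forall fun y => ?_)
    simp only [map_mul]
    have := hK x y
    rw [← this]
    simp only [RCLike.star_def]
    ring
  have h2 : ∫ y, inner ℂ (f y) (integralOp K g y) ∂surf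
      = ∫ y, ∫ x, star (f y) * (K (y, x) * g x) ∂surf ∂surf := by
    refine integral_congr_ae ?_
    filter_upwards [integralOp_ae K g] with y hy
    rw [hy]
    simp only [RCLike.inner_apply]
    rw [integral_const_mul, RCLike.star_def, mul_comm]
  rw [h1, h2]
  refine (integral_integral_swap (f := fun y x => star (f y) * (K (y, x) * g x)) ?_).symm
  have h0 : Integrable (fun w : S2 × S2 => star (f w.1) * g w.2) (surf.prod surf) :=
    ((Complex.conjCLE : ℂ →L[ℝ] ℂ).integrable_comp (integrable_coeFn f)).mul_prod (integrable_coeFn g)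
  refine (h0.bdd_mul (c := ‖K‖) K.continuous.aestronglyMeasurable
    (Eventually.of_forall fun w => K.norm_coe_le_norm w)).congr (Eventually.of_forall fun w => ?_)
  simp only [Function.uncurry]
  ring

/-! ### Projections onto band-limited functions -/

/-- The orthogonal projection onto the harmonics of degree at most `L`. -/
def bandProj (L : ℕ) : L2S →L[ℂ] L2S := ∑ l ∈ Finset.range (L + 1), integralOp (legKer l)

theorem star_legKer (l : ℕ) (x y : S2) : star (legKer l (x, y)) = legKer l (y, x) := by
  rw [legKer_apply, legKer_apply, real_inner_comm]
  simp

/-- Convolution of the reproducing kernels makes the operators mutually orthogonal idempotents, so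
`bandProj` is itself an idempotent. -/
theorem legKer_comp (l l' : ℕ) : (integralOp (legKer l)).comp (integralOp (legKer l'))
    = if l = l' then integralOp (legKer l) else 0 := by
  split_ifs with h
  · exact integralOp_comp fun x y => by rw [integral_legKer_mul_legKer, if_pos h]
  · rw [integralOp_comp (K₃ := 0) fun x y => by
      rw [integral_legKer_mul_legKer, if_neg h]; rfl]
    exact map_zero integralOpL

theorem bandProj_comp_legKer {L l : ℕ} (h : l ≤ L) :
    (bandProj L).comp (integralOp (legKer l)) = integralOp (legKer l) := by
  unfold bandProj
  rw [ContinuousLinearMap.finsetSum_comp]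
  simp only [legKer_comp]
  rw [Finset.sum_ite_eq' _ l, if_pos (Finset.mem_range.2 (by omega))]

theorem bandProj_comp_self (L : ℕ) : (bandProj L).comp (bandProj L) = bandProj L := by
  conv_lhs => rw [bandProj, ← bandProj]
  nth_rw 2 [bandProj]
  rw [ContinuousLinearMap.comp_finsetSum]
  exact Finset.sum_congr rfl fun l hl =>
    bandProj_comp_legKer (Nat.lt_succ_iff.1 (Finset.mem_range.1 hl))

theorem inner_bandProj (L : ℕ) (f g : L2S) :
    inner ℂ (bandProj L f) g = inner ℂ f (bandProj L g) := by
  unfold bandProj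
  simp only [sum_apply, sum_inner, inner_sum]
  exact Finset.sum_congr rfl fun l _ => inner_integralOp (star_legKer l) f g

/-- Self-adjointness and idempotence give `‖P f‖² = ⟨f, P f⟩`; then Cauchy-Schwarz. -/
theorem norm_bandProj_apply_le (L : ℕ) (f : L2S) : ‖bandProj L f‖ ≤ ‖f‖ := by
  have h : ‖bandProj L f‖ * ‖bandProj L f‖ ≤ ‖f‖ * ‖bandProj L f‖ := by
    have h1 : inner ℂ (bandProj L f) (bandProj L f) = inner ℂ f (bandProj L f) := by
      rw [inner_bandProj, ← ContinuousLinearMap.comp_apply, bandProj_comp_self]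
    have h2 := norm_inner_le_norm (𝕜 := ℂ) f (bandProj L f)
    rw [← h1, inner_self_eq_norm_sq_to_K] at h2
    simpa [← sq] using h2
  rcases (norm_nonneg (bandProj L f)).eq_or_lt' with h0 | h0
  · rw [h0]
    exact norm_nonneg f
  · exact le_of_mul_le_mul_right h h0

/-! ### Strong convergence of the projections -/

theorem integralOp_toLp {K : C(S2 × S2, ℂ)} {f g : C(S2, ℂ)}
    (h : ∀ x, ∫ y, K (x, y) * f y ∂surf = g x) :
    integralOp K (ContinuousMap.toLp 2 surf ℂ f) = ContinuousMap.toLp 2 surf ℂ g := by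
  change ContinuousMap.toLp 2 surf ℂ _ = ContinuousMap.toLp 2 surf ℂ _
  congr 1
  ext x
  change ∫ y, K (x, y) * ContinuousMap.toLp 2 surf ℂ f y ∂surf = g x
  rw [← h]
  refine integral_congr_ae ?_
  filter_upwards [ContinuousMap.coeFn_toLp (p := 2) (𝕜 := ℂ) surf f] with y hy
  rw [hy]

/-- The section `x ↦ K (x, y)` of a kernel. -/
def kerSection (K : C(S2 × S2, ℂ)) (y : S2) : C(S2, ℂ) := ⟨fun x => K (x, y), by fun_prop⟩

theorem bandProj_section_legKer {L l : ℕ} (h : l ≤ L) (y : S2) :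
    bandProj L (ContinuousMap.toLp 2 surf ℂ (kerSection (legKer l) y))
      = ContinuousMap.toLp 2 surf ℂ (kerSection (legKer l) y) := by
  have h1 : ∀ l', integralOp (legKer l') (ContinuousMap.toLp 2 surf ℂ (kerSection (legKer l) y))
      = if l' = l then ContinuousMap.toLp 2 surf ℂ (kerSection (legKer l) y) else 0 := by
    intro l'
    rw [integralOp_toLp (g := if l' = l then kerSection (legKer l) y else 0)]
    · split_ifs <;> simp
    · intro x
      change ∫ z, legKer l' (x, z) * legKer l (z, y) ∂surf = _
      rw [integral_legKer_mul_legKer]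
      split_ifs with hl
      · subst hl; rfl
      · rfl
  unfold bandProj
  rw [sum_apply]
  simp only [h1]
  rw [Finset.sum_ite_eq' _ l, if_pos (Finset.mem_range.2 (by omega))]

theorem bandProj_section_polynomial (p : Polynomial ℝ) {L : ℕ} (h : p.natDegree ≤ L) (y : S2) :
    bandProj L (ContinuousMap.toLp 2 surf ℂ (kerSection (zonalKer _ p.continuous) y))
      = ContinuousMap.toLp 2 surf ℂ (kerSection (zonalKer _ p.continuous) y) := by
  obtain ⟨a, ha⟩ := exists_legendre_expansion L p h
  have e : kerSection (zonalKer _ p.continuous) y = ∑ l ∈ Finset.range (L + 1),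
      ((a l * (4 * Real.pi / (2 * l + 1)) : ℝ) : ℂ) • kerSection (legKer l) y := by
    ext x
    rw [ContinuousMap.sum_apply]
    change ((p.eval (inner ℝ (x : E3) (y : E3)) : ℝ) : ℂ)
      = ∑ l ∈ Finset.range (L + 1), ((a l * (4 * Real.pi / (2 * l + 1)) : ℝ) : ℂ) * legKer l (x, y)
    conv_lhs => rw [ha]
    rw [Polynomial.eval_finsetSum, Complex.ofReal_sum]
    refine Finset.sum_congr rfl fun l _ => ?_
    rw [legKer_apply, ← Complex.ofReal_mul, Polynomial.eval_mul, Polynomial.eval_C]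
    congr 1
    have := Real.pi_pos
    field_simp
  rw [e]
  simp only [map_sum, map_smul]
  refine Finset.sum_congr rfl fun l hl => ?_
  rw [bandProj_section_legKer (Nat.lt_succ_iff.1 (Finset.mem_range.1 hl))]

/-- The functions on which the projections converge to the identity. -/
def ConvSet : Submodule ℂ L2S where
  carrier := {u | Tendsto (fun L => bandProj L u) atTop (𝓝 u)}
  add_mem' h₁ h₂ := by
    simp only [Set.mem_ofPred_eq, map_add] at *
    exact h₁.add h₂
  zero_mem' := by simp
  smul_mem' c u h := by
    simp only [Set.mem_ofPred_eq, map_smul] at *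
    exact h.const_smul c

theorem mem_convSet {u : L2S} : u ∈ ConvSet ↔ Tendsto (fun L => bandProj L u) atTop (𝓝 u) :=
  Iff.rfl

/-- The projections are contractions, so the set on which they converge to the identity is closed.
-/
theorem mem_convSet_of_approx {u : L2S} (h : ∀ ε > 0, ∃ v ∈ ConvSet, ‖u - v‖ < ε) :
    u ∈ ConvSet := by
  rw [mem_convSet, Metric.tendsto_atTop]
  intro ε hε
  obtain ⟨v, hv, huv⟩ := h (ε / 3) (by positivity)
  obtain ⟨N, hN⟩ := Metric.tendsto_atTop.1 (mem_convSet.1 hv) (ε / 3) (by positivity)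
  refine ⟨N, fun n hn => ?_⟩
  have h1 := hN n hn
  rw [dist_eq_norm] at h1 ⊢
  calc ‖bandProj n u - u‖ = ‖bandProj n (u - v) + (bandProj n v - v) - (u - v)‖ := by
        congr 1
        rw [map_sub]
        abel
    _ ≤ ‖bandProj n (u - v)‖ + ‖bandProj n v - v‖ + ‖u - v‖ :=
        (norm_sub_le _ _).trans (add_le_add_left (norm_add_le _ _) _)
    _ < ε := by linarith [norm_bandProj_apply_le n (u - v)]

/-- A zonal function with polynomial profile is fixed by `bandProj L` once `L` reaches its degree;
general profiles follow by Weierstrass approximation. -/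
theorem zonal_mem_convSet {κ : ℝ → ℝ} (hκ : Continuous κ) (y : S2) :
    ContinuousMap.toLp 2 surf ℂ (kerSection (zonalKer κ hκ) y) ∈ ConvSet := by
  refine mem_convSet_of_approx fun ε hε => ?_
  set C := ‖(ContinuousMap.toLp 2 surf ℂ : C(S2, ℂ) →L[ℂ] L2S)‖ + 1 with hC
  have hC0 : 0 < C := by positivity
  obtain ⟨p, hp⟩ := exists_polynomial_near_of_continuousOn (-1) 1 κ hκ.continuousOn (ε / C)
    (by positivity)
  refine ⟨ContinuousMap.toLp 2 surf ℂ (kerSection (zonalKer _ p.continuous) y), ?_, ?_⟩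
  · refine mem_convSet.2 (tendsto_const_nhds.congr' ?_)
    filter_upwards [eventually_ge_atTop p.natDegree] with L hL
    exact (bandProj_section_polynomial p hL y).symm
  · rw [← map_sub]
    have hn : ‖kerSection (zonalKer κ hκ) y - kerSection (zonalKer _ p.continuous) y‖ ≤ ε / C := by
      refine (ContinuousMap.norm_le _ (by positivity)).2 fun x => ?_
      change ‖((κ (inner ℝ (x : E3) (y : E3)) : ℝ) : ℂ)
        - ((p.eval (inner ℝ (x : E3) (y : E3)) : ℝ) : ℂ)‖ ≤ _
      rw [← Complex.ofReal_sub, Complex.norm_real, norm_sub_rev]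
      exact (hp _ (inner_mem_Icc x y)).le
    calc _ ≤ ‖(ContinuousMap.toLp 2 surf ℂ : C(S2, ℂ) →L[ℂ] L2S)‖ * (ε / C) :=
          (ContinuousLinearMap.le_opNorm _ _).trans
            (mul_le_mul_of_nonneg_left hn (norm_nonneg _))
      _ < C * (ε / C) := mul_lt_mul_of_pos_right (by rw [hC]; linarith) (by positivity)
      _ = ε := by field_simp

/-- The function `x ↦ exp ⟨x, v⟩` on the sphere. -/
def expFn (v : E3) : C(S2, ℂ) := ⟨fun x => (Real.exp (inner ℝ (x : E3) v) : ℂ), by fun_prop⟩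

/-- For `v ≠ 0` the exponential is zonal about the direction of `v`; for `v = 0` it is constant. -/
theorem expFn_mem_convSet (v : E3) : ContinuousMap.toLp 2 surf ℂ (expFn v) ∈ ConvSet := by
  by_cases hv : v = 0
  · convert zonal_mem_convSet (κ := fun _ => 1) continuous_const pole using 2
    ext x
    simp [expFn, kerSection, zonalKer, hv]
  · have hv' : ‖v‖ ≠ 0 := norm_ne_zero_iff.2 hv
    convert zonal_mem_convSet (κ := fun c => Real.exp (‖v‖ * c)) (by fun_prop)
      ⟨‖v‖⁻¹ • v, by simp [norm_smul, hv']⟩ using 2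
    ext x
    change (Real.exp (inner ℝ (x : E3) v) : ℂ)
      = (Real.exp (‖v‖ * inner ℝ (x : E3) (‖v‖⁻¹ • v)) : ℂ)
    rw [inner_smul_right, mul_inv_cancel_left₀ hv']

/-- The star subalgebra generated by the exponentials. -/
def expSubalgebra : StarSubalgebra ℂ C(S2, ℂ) where
  toSubalgebra := Algebra.adjoin ℂ (Set.range expFn)
  star_mem' := by
    change Algebra.adjoin ℂ (Set.range expFn) ≤ star (Algebra.adjoin ℂ (Set.range expFn))
    refine Algebra.adjoin_le ?_
    rintro - ⟨v, rfl⟩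
    refine Algebra.subset_adjoin ⟨v, ?_⟩
    ext x
    exact (Complex.conj_ofReal _).symm

/-- A product of two exponentials is again one, so the generated algebra is merely their linear
span, and membership in the subspace `ConvSet` can be checked on single exponentials. -/
theorem expSubalgebra_coe :
    Subalgebra.toSubmodule expSubalgebra.toSubalgebra = Submodule.span ℂ (Set.range expFn) := by
  apply Algebra.adjoin_eq_span_of_subset
  refine Set.Subset.trans ?_ Submodule.subset_span
  intro x hx
  refine Submonoid.closure_induction (fun _ => id) ⟨0, ?_⟩ ?_ hx
  · ext z
    simp [expFn]
  · rintro - - - - ⟨v, rfl⟩ ⟨w, rfl⟩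
    refine ⟨v + w, ?_⟩
    ext z
    simp [expFn, inner_add_right, Complex.exp_add]

theorem expSubalgebra_separatesPoints : expSubalgebra.SeparatesPoints := by
  intro x y hxy
  refine ⟨_, ⟨expFn x, Algebra.subset_adjoin ⟨x, rfl⟩, rfl⟩, fun h => hxy ?_⟩
  have h1 : inner ℝ (x : E3) (x : E3) = inner ℝ (y : E3) (x : E3) :=
    Real.exp_injective (Complex.ofReal_injective h)
  rw [inner_self_sphere] at h1
  have := (inner_eq_one_iff_of_norm_eq_one (𝕜 := ℝ) (norm_eq_of_mem_sphere y)
    (norm_eq_of_mem_sphere x)).1 h1.symm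
  exact Subtype.ext this.symm

/-- Completeness of the spherical harmonics. The exponentials span a point-separating star
subalgebra, so Stone-Weierstrass puts every continuous function in the closed subspace `ConvSet`,
and continuous functions are dense in `L²`. -/
theorem tendsto_bandProj (u : L2S) : Tendsto (fun L => bandProj L u) atTop (𝓝 u) := by
  have hcl : IsClosed (ConvSet : Set L2S) := by
    refine isClosed_of_closure_subset fun u hu => mem_convSet_of_approx fun ε hε => ?_
    obtain ⟨v, hv, h⟩ := Metric.mem_closure_iff.1 hu ε hε
    exact ⟨v, hv, by rwa [← dist_eq_norm]⟩
  set J := (ContinuousMap.toLp 2 surf ℂ : C(S2, ℂ) →L[ℂ] L2S) with hJ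
  have h1 : (expSubalgebra : Set C(S2, ℂ)) ⊆ J ⁻¹' (ConvSet : Set L2S) := by
    intro f hf
    have hf' : f ∈ Submodule.span ℂ (Set.range expFn) := by
      rw [← expSubalgebra_coe]
      exact hf
    have : Submodule.span ℂ (Set.range expFn) ≤ ConvSet.comap (J : C(S2, ℂ) →ₗ[ℂ] L2S) := by
      refine Submodule.span_le.2 ?_
      rintro - ⟨v, rfl⟩
      exact expFn_mem_convSet v
    exact this hf'
  have h2 : ∀ f : C(S2, ℂ), J f ∈ (ConvSet : Set L2S) := by
    intro f
    have h3 : f ∈ expSubalgebra.topologicalClosure := by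
      rw [ContinuousMap.starSubalgebra_topologicalClosure_eq_top_of_separatesPoints _
        expSubalgebra_separatesPoints]
      trivial
    exact closure_minimal h1 (hcl.preimage J.continuous) h3
  have h3 : closure (Set.range J) ⊆ (ConvSet : Set L2S) :=
    closure_minimal (by rintro - ⟨f, rfl⟩; exact h2 f) hcl
  have h4 : DenseRange J := ContinuousMap.toLp_denseRange ℂ surf ℂ (by norm_num)
  exact mem_convSet.1 (h3 (h4 u))

/-! ### The trace norm -/

section TraceNorm

variable {H : Type*} [NormedAddCommGroup H] [InnerProductSpace ℂ H]

/-- Representations indexed by any countable type are allowed: inject it into `ℕ` and pad with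
zeros. -/
theorem traceNorm_le_tsum {κ : Type*} [Countable κ] {A : H →L[ℂ] H} (u v : κ → H)
    (h : ∀ x : H, HasSum (fun i => inner ℂ (v i) x • u i) (A x)) :
    traceNorm A ≤ ∑' i, ‖u i‖ₑ * ‖v i‖ₑ := by
  obtain ⟨f, hf⟩ := exists_injective_nat κ
  have e : ∀ x : H, (fun n => inner ℂ (Function.extend f v 0 n) x • Function.extend f u 0 n)
      = Function.extend f (fun i => inner ℂ (v i) x • u i) 0 := by
    intro x
    ext1 n
    by_cases hn : ∃ i, f i = n
    · obtain ⟨i, rfl⟩ := hn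
      simp only [hf.extend_apply]
    · simp only [Function.extend_apply' _ _ _ hn]
      simp
  have e2 : (fun n => ‖Function.extend f u 0 n‖ₑ * ‖Function.extend f v 0 n‖ₑ)
      = Function.extend f (fun i => ‖u i‖ₑ * ‖v i‖ₑ) 0 := by
    ext1 n
    by_cases hn : ∃ i, f i = n
    · obtain ⟨i, rfl⟩ := hn
      simp only [hf.extend_apply]
    · simp only [Function.extend_apply' _ _ _ hn]
      simp
  rw [← tsum_extend_zero hf, ← e2]
  refine iInf_le_of_le (Function.extend f u 0) (iInf_le_of_le (Function.extend f v 0)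
    (iInf_le_of_le (fun x => ?_) le_rfl))
  rw [e]
  exact (hasSum_extend_zero hf).2 (h x)

theorem exists_repr_of_traceNorm_lt {A : H →L[ℂ] H} {c : ℝ≥0∞} (h : traceNorm A < c) :
    ∃ u v : ℕ → H, (∀ x : H, HasSum (fun i => inner ℂ (v i) x • u i) (A x)) ∧
      ∑' i, ‖u i‖ₑ * ‖v i‖ₑ < c := by
  unfold traceNorm at h
  simp only [iInf_lt_iff] at h
  obtain ⟨u, v, hr, hlt⟩ := h
  exact ⟨u, v, hr, hlt⟩

theorem enorm_inner_smul_le (u v x : H) :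
    ‖(inner ℂ v x : ℂ) • u‖ₑ ≤ ‖u‖ₑ * ‖v‖ₑ * ‖x‖ₑ := by
  rw [enorm_smul, mul_comm, mul_assoc]
  gcongr
  simp only [enorm_eq_nnnorm]
  exact_mod_cast norm_inner_le_norm (𝕜 := ℂ) v x

theorem traceNorm_zero : traceNorm (0 : H →L[ℂ] H) = 0 := by
  refine le_antisymm ((traceNorm_le_tsum (κ := Empty) (fun _ => 0) (fun _ => 0) ?_).trans ?_)
    zero_le
  · intro x
    simp
  · simp

/-- Countable subadditivity, for sums that converge only strongly. Nearly optimal representations of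
the summands, with a summable total slack, are concatenated into one indexed by `ι × ℕ`. -/
theorem traceNorm_le_tsum_traceNorm [CompleteSpace H] {ι : Type*} [Countable ι]
    {A : ι → H →L[ℂ] H} {B : H →L[ℂ] H} (h : ∀ x, HasSum (fun i => A i x) (B x)) :
    traceNorm B ≤ ∑' i, traceNorm (A i) := by
  by_cases hfin : ∑' i, traceNorm (A i) = ∞
  · rw [hfin]
    exact le_top
  refine ENNReal.le_of_forall_pos_le_add fun δ hδ _ => ?_
  obtain ⟨δ', hδ', hsum⟩ := ENNReal.exists_pos_sum_of_countable'
    (ENNReal.coe_ne_zero.2 hδ.ne') ι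
  have hi : ∀ i, traceNorm (A i) < traceNorm (A i) + δ' i := fun i =>
    ENNReal.lt_add_right (ENNReal.ne_top_of_tsum_ne_top hfin i) (hδ' i).ne'
  choose u v hrep hlt using fun i => exists_repr_of_traceNorm_lt (hi i)
  have hS : ∑' p : ι × ℕ, ‖u p.1 p.2‖ₑ * ‖v p.1 p.2‖ₑ ≤ ∑' i, traceNorm (A i) + δ := by
    rw [ENNReal.tsum_prod']
    calc _ ≤ ∑' i, (traceNorm (A i) + δ' i) := ENNReal.tsum_le_tsum fun i => (hlt i).le
      _ = ∑' i, traceNorm (A i) + ∑' i, δ' i := ENNReal.tsum_add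
      _ ≤ _ := by gcongr
  refine (traceNorm_le_tsum (κ := ι × ℕ) (fun p => u p.1 p.2) (fun p => v p.1 p.2) ?_).trans hS
  intro x
  -- Absolute convergence of the double series permits summing it by rows, which identifies its
  -- value with `B x`.
  have hs : Summable fun p : ι × ℕ => (inner ℂ (v p.1 p.2) x : ℂ) • u p.1 p.2 := by
    refine Summable.of_enorm (ne_top_of_le_ne_top ?_
      (ENNReal.tsum_le_tsum fun p => enorm_inner_smul_le (u p.1 p.2) (v p.1 p.2) x))
    rw [ENNReal.tsum_mul_right]
    refine ENNReal.mul_ne_top (ne_top_of_le_ne_top ?_ hS) enorm_ne_top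
    exact ENNReal.add_ne_top.2 ⟨hfin, ENNReal.coe_ne_top⟩
  have h1 := hs.hasSum.prod_fiberwise fun i => hrep i x
  rw [← h1.unique (h x)]
  exact hs.hasSum

theorem traceNorm_add_le [CompleteSpace H] (A B : H →L[ℂ] H) :
    traceNorm (A + B) ≤ traceNorm A + traceNorm B := by
  have h := traceNorm_le_tsum_traceNorm (ι := Bool) (A := fun b => cond b A B) (B := A + B) ?_
  · rwa [tsum_fintype, Fintype.sum_bool] at h
  · intro x
    have := hasSum_fintype fun b : Bool => (cond b A B) x
    rwa [Fintype.sum_bool] at this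

theorem traceNorm_sum_le [CompleteSpace H] {ι : Type*} (s : Finset ι) (A : ι → H →L[ℂ] H) :
    traceNorm (∑ i ∈ s, A i) ≤ ∑ i ∈ s, traceNorm (A i) := by
  classical
  induction s using Finset.induction_on with
  | empty => simp [traceNorm_zero]
  | insert a s ha ih =>
    rw [Finset.sum_insert ha, Finset.sum_insert ha]
    exact (traceNorm_add_le _ _).trans (by gcongr)

theorem traceNorm_comp_le_of_repr {A B : H →L[ℂ] H} {u v : ℕ → H}
    (h : ∀ x : H, HasSum (fun i => inner ℂ (v i) x • u i) (A x)) :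
    traceNorm (B.comp A) ≤ ∑' i, ‖B (u i)‖ₑ * ‖v i‖ₑ := by
  refine traceNorm_le_tsum (fun i => B (u i)) v fun x => ?_
  have := (h x).mapL B
  simpa using this

theorem traceNorm_comp_le (A B : H →L[ℂ] H) :
    traceNorm (B.comp A) ≤ ‖B‖ₑ * traceNorm A := by
  by_cases hB : B = 0
  · rw [hB, ContinuousLinearMap.zero_comp, traceNorm_zero]
    exact zero_le
  have hB0 : ‖B‖ₑ ≠ 0 := by
    rw [← ofReal_norm]
    exact (ENNReal.ofReal_pos.2 (norm_pos_iff.2 hB)).ne'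
  rw [mul_comm]
  refine (ENNReal.div_le_iff hB0 enorm_ne_top).1 ?_
  refine le_iInf fun u => le_iInf fun v => le_iInf fun h => ?_
  rw [ENNReal.div_le_iff hB0 enorm_ne_top, mul_comm, ← ENNReal.tsum_mul_left]
  refine (traceNorm_comp_le_of_repr h).trans (ENNReal.tsum_le_tsum fun i => ?_)
  rw [← mul_assoc]
  gcongr
  exact B.le_opENorm _

theorem traceNorm_smul_le (c : ℂ) (A : H →L[ℂ] H) : traceNorm (c • A) ≤ ‖c‖ₑ * traceNorm A := by
  have h : c • A = (c • ContinuousLinearMap.id ℂ H).comp A := by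
    ext x
    simp
  rw [h]
  refine (traceNorm_comp_le _ _).trans ?_
  gcongr
  refine ContinuousLinearMap.opENorm_le_bound _ fun x => ?_
  rw [smul_apply, enorm_smul]
  rfl

/-- Hence a series summable in trace norm is summable in operator norm, the norm in which `specOp`
is defined. -/
theorem enorm_le_traceNorm (A : H →L[ℂ] H) : ‖A‖ₑ ≤ traceNorm A := by
  refine le_iInf fun u => le_iInf fun v => le_iInf fun h => ?_
  refine ContinuousLinearMap.opENorm_le_bound _ fun x => ?_
  rw [← (h x).tsum_eq, ← ENNReal.tsum_mul_right]
  exact enorm_tsum_le_tsum_enorm.trans (ENNReal.tsum_le_tsum fun i => enorm_inner_smul_le _ _ _)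

theorem tendsto_ennreal_tsum_of_dominated {ι : Type*} {F : ℕ → ι → ℝ≥0∞} {b : ι → ℝ≥0∞}
    (hb : ∑' i, b i ≠ ∞) (hF : ∀ n i, F n i ≤ b i)
    (hlim : ∀ i, Tendsto (fun n => F n i) atTop (𝓝 0)) :
    Tendsto (fun n => ∑' i, F n i) atTop (𝓝 0) := by
  let _ : MeasurableSpace ι := ⊤
  have := tendsto_lintegral_of_dominated_convergence (μ := Measure.count) (F := F) (f := 0) b
    (fun n => measurable_from_top) (fun n => Eventually.of_forall (hF n))
    (by rwa [lintegral_count]) (Eventually.of_forall hlim)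
  simpa [lintegral_count] using this

/-- In a fixed representation of `A`, composing with `B n` only changes the vectors `u i` into `B n
(u i)`. Each tends to zero and the sum is dominated, so bounded strong convergence improves to
convergence in trace norm. -/
theorem tendsto_traceNorm_comp {A : H →L[ℂ] H} (hA : traceNorm A ≠ ∞) {B : ℕ → H →L[ℂ] H}
    {C : ℝ≥0∞} (hC : C ≠ ∞) (hB : ∀ n x, ‖B n x‖ₑ ≤ C * ‖x‖ₑ)
    (hlim : ∀ x, Tendsto (fun n => B n x) atTop (𝓝 0)) :
    Tendsto (fun n => traceNorm ((B n).comp A)) atTop (𝓝 0) := by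
  obtain ⟨u, v, hr, hlt⟩ := exists_repr_of_traceNorm_lt (lt_top_iff_ne_top.2 hA)
  refine tendsto_of_tendsto_of_tendsto_of_le_of_le tendsto_const_nhds
    (tendsto_ennreal_tsum_of_dominated (F := fun n i => ‖B n (u i)‖ₑ * ‖v i‖ₑ)
      (b := fun i => C * (‖u i‖ₑ * ‖v i‖ₑ)) ?_ ?_ ?_) (fun n => zero_le)
      (fun n => traceNorm_comp_le_of_repr hr)
  · rw [ENNReal.tsum_mul_left]
    exact ENNReal.mul_ne_top hC hlt.ne
  · intro n i
    rw [← mul_assoc]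
    gcongr
    exact hB n _
  · intro i
    have h1 : Tendsto (fun n => ‖B n (u i)‖ₑ) atTop (𝓝 0) := by
      simpa using (hlim (u i)).enorm
    simpa using ENNReal.Tendsto.mul_const h1 (Or.inr enorm_ne_top)

end TraceNorm

/-! ### Polynomial zonal kernels are of trace class -/

/-- The kernel `⟨x, y⟩ ^ n * u x * v y`. -/
def powKer (n : ℕ) (u v : C(S2, ℂ)) : C(S2 × S2, ℂ) :=
  ⟨fun z => ((inner ℝ (z.1 : E3) (z.2 : E3) : ℝ) : ℂ) ^ n * (u z.1 * v z.2), by fun_prop⟩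

/-- For `n = 0` the operator has rank at most one. Writing one factor `⟨x, y⟩` as `∑ x_i y_i` and
absorbing the coordinates into `u` and `v` lowers `n`; this is why `u` and `v` are kept general. -/
theorem traceNorm_powKer_ne_top (n : ℕ) : ∀ u v : C(S2, ℂ),
    traceNorm (integralOp (powKer n u v)) ≠ ∞ := by
  induction n with
  | zero =>
    intro u v
    refine ne_top_of_le_ne_top ?_ (traceNorm_le_tsum (κ := Unit)
      (fun _ => ContinuousMap.toLp 2 surf ℂ u) (fun _ => ContinuousMap.toLp 2 surf ℂ (star v)) ?_)
    · rw [tsum_fintype]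
      simp [ENNReal.mul_ne_top]
    · intro h
      have e : integralOp (powKer 0 u v) h
          = (inner ℂ (ContinuousMap.toLp 2 surf ℂ (star v)) h : ℂ) •
            ContinuousMap.toLp 2 surf ℂ u := by
        refine Eq.trans ?_ (map_smul (ContinuousMap.toLp 2 surf ℂ : C(S2, ℂ) →L[ℂ] L2S) _ u)
        change ContinuousMap.toLp 2 surf ℂ _ = ContinuousMap.toLp 2 surf ℂ _
        congr 1
        ext x
        change ∫ y, ((inner ℝ (x : E3) (y : E3) : ℝ) : ℂ) ^ 0 * (u x * v y) * h y ∂surf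
          = (inner ℂ (ContinuousMap.toLp 2 surf ℂ (star v)) h : ℂ) * u x
        rw [L2.inner_def, ← integral_mul_const]
        refine integral_congr_ae ?_
        filter_upwards [ContinuousMap.coeFn_toLp (p := 2) (𝕜 := ℂ) surf (star v)] with y hy
        rw [hy]
        simp
        ring
      rw [e]
      exact hasSum_unique _
  | succ n ih =>
    intro u v
    have e : powKer (n + 1) u v = ∑ i : Fin 3,
        powKer n (⟨fun x => ((x : E3) i : ℂ), by fun_prop⟩ * u)
          (⟨fun x => ((x : E3) i : ℂ), by fun_prop⟩ * v) := by
      ext ⟨x, y⟩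
      rw [ContinuousMap.sum_apply]
      simp only [powKer, ContinuousMap.coe_mk, ContinuousMap.mul_apply]
      rw [pow_succ, mul_assoc, ← Finset.mul_sum]
      congr 1
      rw [PiLp.inner_apply, Complex.ofReal_sum, Finset.sum_mul]
      refine Finset.sum_congr rfl fun i _ => ?_
      simp
      ring
    rw [e, integralOp_sum]
    refine ne_top_of_le_ne_top ?_ (traceNorm_sum_le _ _)
    exact ENNReal.sum_ne_top.2 fun i _ => ih _ _

theorem traceNorm_legKer_ne_top (l : ℕ) : traceNorm (integralOp (legKer l)) ≠ ∞ := by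
  have e : legKer l = ∑ n ∈ Finset.range ((legendre l).natDegree + 1),
      (((2 * l + 1 : ℝ) / (4 * Real.pi) * (legendre l).coeff n : ℝ) : ℂ) • powKer n 1 1 := by
    ext ⟨x, y⟩
    rw [legKer_apply, ContinuousMap.sum_apply, Polynomial.eval_eq_sum_range, Finset.mul_sum,
      Complex.ofReal_sum]
    refine Finset.sum_congr rfl fun n _ => ?_
    simp [powKer]
    ring
  rw [e, integralOp_sum]
  refine ne_top_of_le_ne_top (ENNReal.sum_ne_top.2 fun n _ => ?_) (traceNorm_sum_le _ _)
  rw [integralOp_smul]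
  exact ne_top_of_le_ne_top (ENNReal.mul_ne_top enorm_ne_top (traceNorm_powKer_ne_top n 1 1))
    (traceNorm_smul_le _ _)

/-! ### Approximation by autoregressive spectral densities -/

/-- Split off linear factors. A root `r` has `|r| > 1`, so `1 / (X - r)` is a convergent geometric
series, and Cauchy products preserve absolute summability. -/
theorem exists_inverse_summable (n : ℕ) : ∀ q : Polynomial ℂ, q.natDegree = n →
    (∀ z : ℂ, ‖z‖ ≤ 1 → q.eval z ≠ 0) →
    ∃ ψ : PowerSeries ℂ, Summable (fun k => ‖PowerSeries.coeff k ψ‖) ∧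
      (q : PowerSeries ℂ) * ψ = 1 := by
  induction n with
  | zero =>
    intro q hq h0
    obtain ⟨c, rfl⟩ : ∃ c, q = Polynomial.C c := ⟨_, Polynomial.eq_C_of_natDegree_eq_zero hq⟩
    have hc : c ≠ 0 := by simpa using h0 0 (by simp)
    refine ⟨PowerSeries.C c⁻¹, ?_, ?_⟩
    · refine summable_of_ne_finset_zero (s := {0}) fun k hk => ?_
      rw [PowerSeries.coeff_C, if_neg (by simpa using hk), norm_zero]
    · rw [Polynomial.coe_C, ← map_mul, mul_inv_cancel₀ hc, map_one]
  | succ n ih =>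
    intro q hq h0
    obtain ⟨r, hr⟩ := IsAlgClosed.exists_root q (by
      intro h
      rw [Polynomial.natDegree_eq_zero_iff_degree_le_zero.2 h.le] at hq
      omega)
    obtain ⟨q', rfl⟩ := Polynomial.dvd_iff_isRoot.2 hr
    have hr1 : 1 < ‖r‖ := by
      by_contra hle
      exact h0 r (not_lt.1 hle) hr
    have hr0 : r ≠ 0 := norm_pos_iff.1 (by linarith)
    have hq0 : q' ≠ 0 := by
      rintro rfl
      simp at hq
    have hd : q'.natDegree = n := by
      rw [Polynomial.natDegree_mul (Polynomial.X_sub_C_ne_zero r) hq0,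
        Polynomial.natDegree_X_sub_C] at hq
      omega
    obtain ⟨ψ, hψ, hmul⟩ := ih q' hd fun z hz h => h0 z hz (by simp [h])
    set g : PowerSeries ℂ := PowerSeries.mk fun k => -(r⁻¹) ^ (k + 1) with hg
    have hgs : Summable fun k => ‖PowerSeries.coeff k g‖ := by
      simp only [hg, PowerSeries.coeff_mk, norm_neg, norm_pow, norm_inv]
      exact (summable_nat_add_iff (f := fun k => ‖r‖⁻¹ ^ k) 1).2
        (summable_geometric_of_lt_one (by positivity) (inv_lt_one_of_one_lt₀ hr1))
    have hgm : ((Polynomial.X - Polynomial.C r : Polynomial ℂ) : PowerSeries ℂ) * g = 1 := by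
      rw [Polynomial.coe_sub, Polynomial.coe_X, Polynomial.coe_C, sub_mul]
      ext k
      rw [map_sub, PowerSeries.coeff_C_mul, PowerSeries.coeff_one]
      rcases k with _ | k
      · rw [PowerSeries.coeff_zero_X_mul]
        simp [hg, hr0]
      · rw [PowerSeries.coeff_succ_X_mul]
        simp only [hg, PowerSeries.coeff_mk]
        rw [if_neg (Nat.succ_ne_zero k), pow_succ _ (k + 1)]
        field_simp
        simp
    clear_value g
    refine ⟨g * ψ, ?_, ?_⟩
    · simp only [PowerSeries.coeff_mul]
      exact summable_norm_sum_mul_antidiagonal_of_summable_norm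
        (f := fun k => PowerSeries.coeff k g) (g := fun k => PowerSeries.coeff k ψ) hgs hψ
    · rw [Polynomial.coe_mul, mul_mul_mul_comm, hgm, hmul, one_mul]

/-- Moving average coefficients of a causal autoregression, indexed by all integers. -/
theorem exists_ma_coeff (p : ℕ) (φ : ℕ → ℝ)
    (h : ∀ z : ℂ, ‖z‖ ≤ 1 → 1 - ∑ j : Fin p, (φ j : ℂ) * z ^ ((j : ℕ) + 1) ≠ 0) :
    ∃ ψ : ℤ → ℝ, Summable (fun n => |ψ n|) ∧
      ∀ n : ℤ, ψ n = (if n = 0 then 1 else 0) + ∑ j : Fin p, φ j * ψ (n - ((j : ℕ) + 1 : ℤ)) := by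
  set q : Polynomial ℂ :=
    1 - ∑ j : Fin p, Polynomial.C (φ j : ℂ) * Polynomial.X ^ ((j : ℕ) + 1) with hq
  obtain ⟨Ψ, hs, hm⟩ := exists_inverse_summable q.natDegree q rfl fun z hz => by
    have := h z hz
    rw [hq, Polynomial.eval_sub, Polynomial.eval_finsetSum]
    simpa using this
  -- The recursion has real coefficients, so it passes to real parts. Extending by zero to negative
  -- indices lets a single recursion hold on all of `ℤ`.
  set ψ : ℤ → ℝ := fun n => if 0 ≤ n then (PowerSeries.coeff n.toNat Ψ).re else 0 with hψ
  have hnat : ∀ k : ℕ, ψ k = (PowerSeries.coeff k Ψ).re := fun k => by simp [hψ]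
  have hneg : ∀ n : ℤ, n < 0 → ψ n = 0 := fun n hn => by simp [hψ, not_le.2 hn]
  refine ⟨ψ, ?_, fun n => ?_⟩
  · refine Summable.of_nat_of_neg_add_one ?_ ?_
    · refine Summable.of_nonneg_of_le (fun k => abs_nonneg _) (fun k => ?_) hs
      rw [hnat]
      exact Complex.abs_re_le_norm _
    · refine summable_zero.congr fun k => ?_
      rw [hneg _ (by omega), abs_zero]
  · rcases lt_or_ge n 0 with hn | hn
    · rw [hneg n hn, if_neg hn.ne, zero_add, Finset.sum_eq_zero]
      intro j _
      rw [hneg _ (by omega), mul_zero]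
    · lift n to ℕ using hn
      have hc := congrArg (fun f => (PowerSeries.coeff n f).re) hm
      rw [hq, Polynomial.coe_sub, Polynomial.coe_one, sub_mul, one_mul, map_sub,
        PowerSeries.coeff_one] at hc
      have hsum : ((∑ j : Fin p, Polynomial.C (φ j : ℂ) * Polynomial.X ^ ((j : ℕ) + 1) :
          Polynomial ℂ) : PowerSeries ℂ) = ∑ j : Fin p,
            PowerSeries.C (φ j : ℂ) * PowerSeries.X ^ ((j : ℕ) + 1) := by
        rw [← Polynomial.coeToPowerSeries.ringHom_apply, map_sum]
        simp
      rw [hsum, Finset.sum_mul, map_sum, Complex.sub_re, Complex.re_sum, sub_eq_iff_eq_add] at hc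
      rw [hnat, hc]
      congr 1
      · by_cases h0 : n = 0 <;> simp [h0]
      · refine Finset.sum_congr rfl fun j _ => ?_
        rw [mul_assoc, PowerSeries.coeff_C_mul, PowerSeries.coeff_X_pow_mul', Complex.re_ofReal_mul]
        split_ifs with hj
        · rw [← hnat]
          congr 2
          push_cast [Nat.cast_sub hj]
          ring
        · rw [hneg _ (by omega), Complex.zero_re]

/-- On the unit circle, shifting the index of the series by `j + 1` multiplies it by `w ^ (j + 1)`;
the recursion then says that the transfer function inverts the autoregressive polynomial. -/
theorem tsum_ma_mul_ar {p : ℕ} {φ : ℕ → ℝ} {ψ : ℤ → ℝ} (hs : Summable fun n => |ψ n|)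
    (hψ : ∀ n : ℤ, ψ n = (if n = 0 then 1 else 0) +
      ∑ j : Fin p, φ j * ψ (n - ((j : ℕ) + 1 : ℤ))) {w : ℂ} (hw : ‖w‖ = 1) :
    (∑' n : ℤ, (ψ n : ℂ) * w ^ n) * (1 - ∑ j : Fin p, (φ j : ℂ) * w ^ ((j : ℕ) + 1)) = 1 := by
  have hw0 : w ≠ 0 := norm_ne_zero_iff.1 (by rw [hw]; exact one_ne_zero)
  have hsw : Summable fun n : ℤ => (ψ n : ℂ) * w ^ n := by
    refine Summable.of_norm (hs.congr fun n => ?_)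
    rw [norm_mul, norm_zpow, hw, one_zpow, mul_one, Complex.norm_real, Real.norm_eq_abs]
  set S := ∑' n : ℤ, (ψ n : ℂ) * w ^ n with hS
  have hshift : ∀ j : Fin p, HasSum (fun n : ℤ =>
      (φ j : ℂ) * (ψ (n - ((j : ℕ) + 1 : ℤ)) * w ^ n)) ((φ j : ℂ) * (w ^ ((j : ℕ) + 1) * S)) := by
    intro j
    refine HasSum.mul_left _ ?_
    have h1 := (Equiv.subRight ((j : ℕ) + 1 : ℤ)).hasSum_iff.2
      (hsw.hasSum.mul_left (w ^ ((j : ℕ) + 1)))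
    convert h1 using 2 with n
    simp only [Function.comp_apply, Equiv.subRight_apply]
    rw [mul_left_comm, ← zpow_natCast, ← zpow_add₀ hw0]
    congr 2
    push_cast
    ring
  have h1 : HasSum (fun n : ℤ => (ψ n : ℂ) * w ^ n)
      (1 + ∑ j : Fin p, (φ j : ℂ) * (w ^ ((j : ℕ) + 1) * S)) := by
    have h2 := (hasSum_ite_eq (0 : ℤ) (1 : ℂ)).add
      (hasSum_sum fun j (_ : j ∈ Finset.univ) => hshift j)
    convert h2 using 2 with n
    conv_lhs => rw [hψ n]
    push_cast
    rw [add_mul, Finset.sum_mul]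
    congr 1
    · by_cases hn : n = 0 <;> simp [hn]
    · exact Finset.sum_congr rfl fun j _ => by ring
  have h3 := hsw.hasSum.unique h1
  rw [← hS] at h3
  rw [mul_sub, mul_one, Finset.mul_sum, sub_eq_iff_eq_add]
  refine h3.trans (congrArg _ (Finset.sum_congr rfl fun j _ => by ring))

/-! ### Autoregressive approximation of a scalar density -/

/-- Real parts of polynomials in `w = e^{-it}` are stable under multiplication by `cos t = (w + w⁻¹)
/ 2`, so they contain all powers of the cosine. -/
theorem exists_re_eval_eq_cos (q : Polynomial ℝ) : ∃ B : Polynomial ℝ, ∀ t : ℝ,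
    ((Polynomial.aeval (Complex.exp (-(Complex.I * t))) B : ℂ)).re = q.eval (Real.cos t) := by
  have hcos : ∀ t : ℝ, ((Complex.exp (-(Complex.I * t)) + Complex.exp (Complex.I * t)) / 2 : ℂ)
      = (Real.cos t : ℂ) := by
    intro t
    rw [Complex.ofReal_cos, Complex.cos]
    ring_nf
  have hinv : ∀ t : ℝ, Complex.exp (Complex.I * t) * Complex.exp (-(Complex.I * t)) = 1 := by
    intro t
    rw [← Complex.exp_add]
    simp
  -- multiplication by the cosine
  have hmul : ∀ B : Polynomial ℝ, ∃ B' : Polynomial ℝ, ∀ t : ℝ,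
      ((Polynomial.aeval (Complex.exp (-(Complex.I * t))) B' : ℂ)).re
        = ((Polynomial.aeval (Complex.exp (-(Complex.I * t))) B : ℂ)).re * Real.cos t := by
    intro B
    induction B using Polynomial.induction_on' with
    | add B C hB hC =>
      obtain ⟨B', hB'⟩ := hB
      obtain ⟨C', hC'⟩ := hC
      exact ⟨B' + C', fun t => by simp only [map_add, Complex.add_re, hB', hC', add_mul]⟩
    | monomial n a =>
      -- The constant term is separate because `w⁻¹` is not a polynomial in `w`; there `Re w = cos
      -- t` is used directly.
      rcases n with _ | n
      · refine ⟨Polynomial.monomial 1 a, fun t => ?_⟩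
        simp only [Polynomial.aeval_monomial, pow_one, pow_zero, mul_one]
        rw [Complex.coe_algebraMap, Complex.re_ofReal_mul, Complex.ofReal_re, Complex.exp_re]
        simp
      · refine ⟨Polynomial.monomial (n + 2) (a / 2) + Polynomial.monomial n (a / 2), fun t => ?_⟩
        rw [map_add, Polynomial.aeval_monomial, Polynomial.aeval_monomial,
          Polynomial.aeval_monomial, mul_comm _ (Real.cos t), ← Complex.re_ofReal_mul, ← hcos]
        congr 1
        have h := hinv t
        rw [pow_succ _ n, pow_succ _ (n + 1), pow_succ _ n]
        simp only [Complex.coe_algebraMap]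
        push_cast
        linear_combination (-(a : ℂ) / 2 * Complex.exp (-(Complex.I * t)) ^ n) * h
  have hmono : ∀ n : ℕ, ∃ B : Polynomial ℝ, ∀ t : ℝ,
      ((Polynomial.aeval (Complex.exp (-(Complex.I * t))) B : ℂ)).re = Real.cos t ^ n := by
    intro n
    induction n with
    | zero => exact ⟨1, fun t => by simp⟩
    | succ n ih =>
      obtain ⟨B, hB⟩ := ih
      obtain ⟨B', hB'⟩ := hmul B
      exact ⟨B', fun t => by rw [hB', hB, pow_succ]⟩
  induction q using Polynomial.induction_on' with
  | add p q hp hq =>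
    obtain ⟨B, hB⟩ := hp
    obtain ⟨C, hC⟩ := hq
    exact ⟨B + C, fun t => by simp only [map_add, Complex.add_re, hB, hC, Polynomial.eval_add]⟩
  | monomial n a =>
    obtain ⟨B, hB⟩ := hmono n
    refine ⟨Polynomial.C a * B, fun t => ?_⟩
    rw [map_mul, Polynomial.aeval_C, Complex.coe_algebraMap, Complex.re_ofReal_mul, hB,
      Polynomial.eval_monomial]

/-- Since `a ≥ m / 2`, the two fractions in the factored difference are at most `4 / m ^ 3` and `2 /
m ^ 3`. -/
theorem abs_inv_sq_sub_inv_sq_le {a b m τ : ℝ} (hm : 0 < m) (hb : m ≤ b) (hτ : τ ≤ m / 2)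
    (hab : |a - b| ≤ τ) : |1 / a ^ 2 - 1 / b ^ 2| ≤ 6 * τ / m ^ 3 := by
  have ha : m / 2 ≤ a := by linarith [(abs_le.1 hab).1]
  have ha0 : 0 < a := by linarith
  have hb0 : 0 < b := by linarith
  have e : 1 / a ^ 2 - 1 / b ^ 2 = (b - a) * (1 / (a ^ 2 * b) + 1 / (a * b ^ 2)) := by
    field_simp
    ring
  have h1 : 1 / (a ^ 2 * b) ≤ 1 / ((m / 2) ^ 2 * m) := by gcongr
  have h2 : 1 / (a * b ^ 2) ≤ 1 / ((m / 2) * m ^ 2) := by gcongr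
  rw [e, abs_mul, abs_sub_comm]
  have h3 : |1 / (a ^ 2 * b) + 1 / (a * b ^ 2)| ≤ 6 / m ^ 3 := by
    rw [abs_of_nonneg (by positivity)]
    refine (add_le_add h1 h2).trans (le_of_eq ?_)
    field_simp
    norm_num
  calc _ ≤ τ * (6 / m ^ 3) := mul_le_mul hab h3 (abs_nonneg _) ((abs_nonneg _).trans hab)
    _ = _ := by ring

/-- The Taylor polynomials of `exp ∘ B` approximate it uniformly on the closed unit disk. -/
theorem exists_polynomial_near_exp (B : Polynomial ℝ) {τ : ℝ} (hτ : 0 < τ) :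
    ∃ Φ : Polynomial ℝ, ∀ z : ℂ, ‖z‖ ≤ 1 →
      ‖Complex.exp (Polynomial.aeval z B) - Polynomial.aeval z Φ‖ < τ := by
  obtain ⟨R, hR⟩ := (isCompact_closedBall (0 : ℂ) 1).exists_bound_of_continuousOn
    (f := fun z => (Polynomial.aeval z B : ℂ)) (Polynomial.continuous_aeval B).continuousOn
  have h := tendstoUniformlyOn_tsum_nat (Real.summable_pow_div_factorial R)
    (s := Metric.closedBall (0 : ℂ) 1)
    (f := fun n z => (Polynomial.aeval z B : ℂ) ^ n / (n.factorial : ℂ)) (fun n z hz => by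
      rw [norm_div, norm_pow, Complex.norm_natCast]
      gcongr
      exact hR z hz)
  rw [Metric.tendstoUniformlyOn_iff] at h
  obtain ⟨N, hN⟩ := (h τ hτ).exists
  refine ⟨∑ n ∈ Finset.range N, Polynomial.C ((n.factorial : ℝ)⁻¹) * B ^ n, fun z hz => ?_⟩
  have h1 := hN z (by simpa using hz)
  rw [dist_eq_norm] at h1
  have e1 : Complex.exp (Polynomial.aeval z B)
      = ∑' n : ℕ, (Polynomial.aeval z B : ℂ) ^ n / (n.factorial : ℂ) := by
    rw [Complex.exp_eq_exp_ℂ, NormedSpace.exp_eq_tsum_div]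
  have e2 : Polynomial.aeval z (∑ n ∈ Finset.range N, Polynomial.C ((n.factorial : ℝ)⁻¹) * B ^ n)
      = ∑ n ∈ Finset.range N, (Polynomial.aeval z B : ℂ) ^ n / (n.factorial : ℂ) := by
    rw [map_sum]
    refine Finset.sum_congr rfl fun n _ => ?_
    rw [map_mul, map_pow, Polynomial.aeval_C, Complex.coe_algebraMap]
    push_cast
    ring
  rw [e1, e2]
  exact h1

/-- A nonnegative spectral density with absolutely summable autocovariances is uniformly close to
the spectral density of a causal autoregression. -/
theorem exists_ar_near (γ : ℤ → ℝ) (hγ : Summable fun t => |γ t|)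
    (hpos : ∀ s : ℝ, 0 ≤ ∑' t : ℤ, γ t * Real.cos (t * s)) {ε : ℝ} (hε : 0 < ε) :
    ∃ (q : Polynomial ℝ) (σ : ℝ), q.coeff 0 = 1 ∧ 0 ≤ σ ∧
      (∀ z : ℂ, ‖z‖ ≤ 1 → Polynomial.aeval z q ≠ 0) ∧
      ∀ s : ℝ, |σ / ‖(Polynomial.aeval (Complex.exp (-(Complex.I * s))) q : ℂ)‖ ^ 2
        - ∑' t : ℤ, γ t * Real.cos (t * s)| ≤ ε := by
  set f : ℝ → ℝ := fun s => ∑' t : ℤ, γ t * Real.cos (t * s) with hf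
  have hfc : Continuous f := by
    refine continuous_tsum (u := fun t => |γ t|) (fun t => by fun_prop) hγ fun t s => ?_
    rw [norm_mul, Real.norm_eq_abs]
    exact mul_le_of_le_one_right (abs_nonneg _) (Real.abs_cos_le_one _)
  -- Each `cos (t s)` is a Chebyshev polynomial in `cos s`, so `f` is a function of the cosine.
  have hfcos : ∀ s : ℝ, f (Real.arccos (Real.cos s)) = f s := by
    intro s
    refine tsum_congr fun t => ?_
    rw [← Polynomial.Chebyshev.T_real_cos, ← Polynomial.Chebyshev.T_real_cos,
      Real.cos_arccos (Real.neg_one_le_cos s) (Real.cos_le_one s)]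
  set δ := ε / 3 with hδ
  have hδ0 : 0 < δ := by positivity
  -- Raising the density by `δ` makes its logarithm finite where `f` vanishes. This costs one third
  -- of `ε`; the other two thirds go to approximating the logarithm and truncating the exponential.
  set F : ℝ → ℝ := fun c => f (Real.arccos c) + δ with hF
  have hFc : Continuous F := (hfc.comp Real.continuous_arccos).add continuous_const
  have hFpos : ∀ c, 0 < F c := fun c => add_pos_of_nonneg_of_pos (hpos _) hδ0
  obtain ⟨K, hK⟩ := (isCompact_Icc (a := (-1 : ℝ)) (b := 1)).exists_bound_of_continuousOn
    hFc.continuousOn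
  have hK0 : 0 < K := (norm_pos_iff.2 (hFpos 0).ne').trans_le (hK 0 (by norm_num))
  obtain ⟨η, hη, hexp⟩ := Metric.continuousAt_iff.1 (Real.continuous_exp.continuousAt (x := 0))
    (δ / K) (by positivity)
  obtain ⟨P, hP⟩ := exists_polynomial_near_of_continuousOn (-1) 1 (fun c => -Real.log (F c))
    (hFc.log fun c => (hFpos c).ne').neg.continuousOn η hη
  -- The factor `1 / 2` compensates the square in `|exp B| ^ 2`, which equals `exp (P (cos s))` on
  -- the circle.
  obtain ⟨B, hB⟩ := exists_re_eval_eq_cos (Polynomial.C (1 / 2) * P)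
  obtain ⟨R, hR⟩ := (isCompact_closedBall (0 : ℂ) 1).exists_bound_of_continuousOn
    (f := fun z => (Polynomial.aeval z B : ℂ)) (Polynomial.continuous_aeval B).continuousOn
  set m := Real.exp (-R) with hm
  have hm0 : 0 < m := Real.exp_pos _
  have hE : ∀ z : ℂ, ‖z‖ ≤ 1 → m ≤ ‖Complex.exp (Polynomial.aeval z B)‖ := by
    intro z hz
    rw [Complex.norm_exp, hm]
    refine Real.exp_le_exp.2 ?_
    have := hR z (by simpa using hz)
    linarith [(abs_le.1 ((Complex.abs_re_le_norm _).trans this)).1]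
  -- The first bound keeps `Φ` away from zero on the disk, the second makes the error `6 τ / m ^ 3`
  -- of the inverse squares at most `δ`.
  set τ := min (m / 2) (δ * m ^ 3 / 6) with hτ
  have hτ0 : 0 < τ := by positivity
  obtain ⟨Φ, hΦ⟩ := exists_polynomial_near_exp B hτ0
  have hτ1 : τ ≤ m / 2 := min_le_left _ _
  have hne : ∀ z : ℂ, ‖z‖ ≤ 1 → (Polynomial.aeval z Φ : ℂ) ≠ 0 := by
    intro z hz h0
    have := hΦ z hz
    rw [h0, sub_zero] at this
    linarith [hE z hz]
  have hΦ0 : Φ.coeff 0 ≠ 0 := by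
    have := hne 0 (by simp)
    rwa [← Polynomial.coeff_zero_eq_aeval_zero', Complex.coe_algebraMap, Ne,
      Complex.ofReal_eq_zero] at this
  -- Normalising the constant term to one is absorbed in the noise variance.
  refine ⟨Polynomial.C (Φ.coeff 0)⁻¹ * Φ, ((Φ.coeff 0)⁻¹) ^ 2, ?_, sq_nonneg _, ?_, ?_⟩
  · rw [Polynomial.coeff_C_mul, inv_mul_cancel₀ hΦ0]
  · intro z hz
    rw [map_mul, Polynomial.aeval_C, Complex.coe_algebraMap]
    exact mul_ne_zero (by exact_mod_cast inv_ne_zero hΦ0) (hne z hz)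
  · intro s
    set w := Complex.exp (-(Complex.I * s)) with hw
    have hw1 : ‖w‖ ≤ 1 := by
      rw [hw, Complex.norm_exp]
      simp
    have e1 : ((Φ.coeff 0)⁻¹) ^ 2 / ‖(Polynomial.aeval w (Polynomial.C (Φ.coeff 0)⁻¹ * Φ) : ℂ)‖ ^ 2
        = 1 / ‖(Polynomial.aeval w Φ : ℂ)‖ ^ 2 := by
      rw [map_mul, Polynomial.aeval_C, Complex.coe_algebraMap, norm_mul, mul_pow,
        Complex.norm_real, Real.norm_eq_abs, sq_abs]
      have := norm_pos_iff.2 (hne w hw1)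
      field_simp
    have e2 : 1 / ‖Complex.exp (Polynomial.aeval w B)‖ ^ 2 = Real.exp (-P.eval (Real.cos s)) := by
      rw [Complex.norm_exp, hB, ← Real.exp_nat_mul, one_div, ← Real.exp_neg]
      congr 1
      simp
    have h1 : |1 / ‖(Polynomial.aeval w Φ : ℂ)‖ ^ 2 - Real.exp (-P.eval (Real.cos s))| ≤ δ := by
      rw [← e2]
      refine (abs_inv_sq_sub_inv_sq_le hm0 (hE w hw1) hτ1 ?_).trans ?_
      · refine (abs_norm_sub_norm_le _ _).trans ?_
        rw [norm_sub_rev]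
        exact (hΦ w hw1).le
      · rw [div_le_iff₀ (by positivity)]
        have : τ ≤ δ * m ^ 3 / 6 := min_le_right _ _
        linarith
    have hcI : Real.cos s ∈ Set.Icc (-1 : ℝ) 1 := ⟨Real.neg_one_le_cos s, Real.cos_le_one s⟩
    have h2 : |Real.exp (-P.eval (Real.cos s)) - F (Real.cos s)| ≤ δ := by
      have e3 : Real.exp (-P.eval (Real.cos s)) - F (Real.cos s) = F (Real.cos s) *
          (Real.exp (-(P.eval (Real.cos s) - -Real.log (F (Real.cos s)))) - Real.exp 0) := by
        rw [mul_sub, neg_sub, sub_eq_add_neg (-Real.log _), Real.exp_add,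
          Real.exp_neg (Real.log _), Real.exp_log (hFpos _), Real.exp_zero, ← mul_assoc,
          mul_inv_cancel₀ (hFpos _).ne']
        ring
      have h3 := hexp (x := -(P.eval (Real.cos s) - -Real.log (F (Real.cos s)))) (by
        rw [dist_zero_right, norm_neg]
        exact hP _ hcI)
      rw [Real.dist_eq] at h3
      rw [e3, abs_mul]
      calc _ ≤ K * (δ / K) := mul_le_mul (hK _ hcI) h3.le (abs_nonneg _) hK0.le
        _ = δ := by field_simp
    have h4 : F (Real.cos s) - f s = δ := by
      rw [hF]
      simp only [hfcos]
      ring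
    rw [e1]
    calc |1 / ‖(Polynomial.aeval w Φ : ℂ)‖ ^ 2 - f s|
        = |(1 / ‖(Polynomial.aeval w Φ : ℂ)‖ ^ 2 - Real.exp (-P.eval (Real.cos s)))
          + (Real.exp (-P.eval (Real.cos s)) - F (Real.cos s)) + δ| := by
          congr 1
          rw [← h4]
          ring
      _ ≤ δ + δ + δ := by
          refine (abs_add_le _ _).trans (add_le_add ((abs_add_le _ _).trans (add_le_add h1 h2)) ?_)
          rw [abs_of_pos hδ0]
      _ = ε := by rw [hδ]; ring

/-! ### Random seeds: uniform points of the sphere with random signs -/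

/-- The uniform distribution on signed points of the sphere. -/
def seedMeasure : Measure (S2 × Bool) :=
  (ENNReal.ofReal (8 * Real.pi))⁻¹ • surf.prod Measure.count

theorem surf_univ : surf Set.univ = ENNReal.ofReal (4 * Real.pi) := by
  rw [← surf_real_univ, ofReal_measureReal]

instance : IsProbabilityMeasure seedMeasure := by
  constructor
  rw [seedMeasure, Measure.smul_apply, ← Set.univ_prod_univ, Measure.prod_prod, surf_univ,
    smul_eq_mul]
  have h : (Measure.count (Set.univ : Set Bool)) = ENNReal.ofReal 2 := by
    rw [Measure.count_univ]
    simp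
  have hp := Real.pi_pos
  rw [h, ← ENNReal.ofReal_mul (by positivity), show 4 * Real.pi * 2 = 8 * Real.pi by ring]
  exact ENNReal.inv_mul_cancel (by simpa using hp) ENNReal.ofReal_ne_top

theorem integral_seedMeasure {F : Type*} [NormedAddCommGroup F] [NormedSpace ℝ F] [CompleteSpace F]
    {f : S2 × Bool → F} (hf : ∀ b, Continuous fun x => f (x, b)) :
    ∫ e, f e ∂seedMeasure
      = (8 * Real.pi)⁻¹ • (∫ x, f (x, true) ∂surf + ∫ x, f (x, false) ∂surf) := by
  have hc : Continuous f := continuous_prod_of_discrete_right.2 hf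
  have hi : Integrable f (surf.prod Measure.count) :=
    hc.integrable_of_hasCompactSupport (HasCompactSupport.of_compactSpace f)
  have hp := Real.pi_pos
  rw [seedMeasure, integral_smul_measure, integral_prod _ hi]
  simp only [integral_count, Fintype.sum_bool]
  rw [integral_add (integrable_of_continuous (hf true)) (integrable_of_continuous (hf false)),
    ENNReal.toReal_inv, ENNReal.toReal_ofReal (by positivity)]

/-- The sign of a seed. -/
def sgn (b : Bool) : ℝ := cond b 1 (-1)

theorem abs_sgn (b : Bool) : |sgn b| = 1 := by cases b <;> simp [sgn]

/-- The random sign exists for this: it centres every degree, including the constant one, where the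
uniform point alone would not. -/
theorem integral_sgn_smul {F : Type*} [NormedAddCommGroup F] [NormedSpace ℝ F] [CompleteSpace F]
    {h : S2 → F} (hh : Continuous h) : ∫ e : S2 × Bool, sgn e.2 • h e.1 ∂seedMeasure = 0 := by
  rw [integral_seedMeasure (f := fun e : S2 × Bool => sgn e.2 • h e.1) fun b => by fun_prop]
  simp [sgn, integral_neg]

theorem integral_sgn_mul_sgn {h h' : S2 → ℝ} (hh : Continuous h) (hh' : Continuous h') :
    ∫ e : S2 × Bool, sgn e.2 * h e.1 * (sgn e.2 * h' e.1) ∂seedMeasure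
      = (4 * Real.pi)⁻¹ * ∫ x, h x * h' x ∂surf := by
  rw [integral_seedMeasure (f := fun e : S2 × Bool => sgn e.2 * h e.1 * (sgn e.2 * h' e.1))
    fun b => by fun_prop]
  simp only [sgn, cond_true, cond_false, one_mul, neg_one_mul, neg_mul_neg, smul_eq_mul]
  rw [← two_mul, ← mul_assoc]
  congr 1
  have := Real.pi_pos
  field_simp
  norm_num

/-- The sample space: independent seeds at all times. -/
abbrev SeedSpace : Type := ℤ → S2 × Bool

/-- The law of a family of independent seeds. -/
def seedLaw : Measure SeedSpace := Measure.infinitePi fun _ => seedMeasure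

instance : IsProbabilityMeasure seedLaw := by
  unfold seedLaw
  infer_instance

theorem integral_seedLaw_eval {F : Type*} [NormedAddCommGroup F] [NormedSpace ℝ F] (t : ℤ)
    {f : S2 × Bool → F} (hf : AEStronglyMeasurable f seedMeasure) :
    ∫ ω, f (ω t) ∂seedLaw = ∫ e, f e ∂seedMeasure := by
  have h := measurePreserving_eval_infinitePi (fun _ : ℤ => seedMeasure) t
  rw [← h.map_eq] at hf
  conv_rhs => rw [← h.map_eq]
  rw [integral_map h.measurable.aemeasurable hf]
  rfl

theorem integral_seedLaw_mul {𝕜 : Type*} [RCLike 𝕜] {t s : ℤ} (hts : t ≠ s)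
    {f g : S2 × Bool → 𝕜} (hf : Measurable f) (hg : Measurable g) :
    ∫ ω, f (ω t) * g (ω s) ∂seedLaw
      = (∫ e, f e ∂seedMeasure) * ∫ e, g e ∂seedMeasure := by
  have hi := (ProbabilityTheory.iIndepFun_infinitePi (P := fun _ : ℤ => seedMeasure)
    (X := fun _ e => e) fun _ => measurable_id).indepFun hts
  rw [← integral_seedLaw_eval t hf.aestronglyMeasurable,
    ← integral_seedLaw_eval s hg.aestronglyMeasurable]
  exact hi.integral_fun_comp_mul_comp (f := f) (g := g) (measurable_pi_apply t).aemeasurable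
    (measurable_pi_apply s).aemeasurable hf.aestronglyMeasurable hg.aestronglyMeasurable

/-! ### The driving noise -/

/-- The multipole of degree `l`, with variance `c`, generated by a seed. -/
def multipole (l : ℕ) (c : ℝ) (x : S2) (e : S2 × Bool) : ℝ :=
  sgn e.2 * ((2 * l + 1) * √(c / (4 * Real.pi)) *
    (legendre l).eval (inner ℝ (x : E3) (e.1 : E3)))

theorem continuous_multipole (l : ℕ) (c : ℝ) :
    Continuous fun z : S2 × (S2 × Bool) => multipole l c z.1 z.2 := by
  have h1 := (legendre l).continuous
  have h2 : Continuous sgn := continuous_of_discreteTopology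
  unfold multipole
  fun_prop

theorem exists_multipole_bound (l : ℕ) (c : ℝ) :
    ∃ M : ℝ, 0 ≤ M ∧ ∀ x e, |multipole l c x e| ≤ M := by
  obtain ⟨M, hM0, hM⟩ := exists_legendre_bound l
  refine ⟨(2 * l + 1) * √(c / (4 * Real.pi)) * M, by positivity, fun x e => ?_⟩
  rw [multipole, abs_mul, abs_sgn, one_mul, abs_mul, abs_of_nonneg (by positivity)]
  exact mul_le_mul_of_nonneg_left (hM _ (inner_mem_Icc _ _)) (by positivity)

theorem measurable_multipole (l : ℕ) (c : ℝ) (x : S2) : Measurable (multipole l c x) :=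
  ((continuous_multipole l c).comp (Continuous.prodMk_right x)).measurable

theorem integral_multipole (l : ℕ) (c : ℝ) (x : S2) : ∫ e, multipole l c x e ∂seedMeasure = 0 :=
  integral_sgn_smul (h := fun y : S2 => (2 * l + 1) * √(c / (4 * Real.pi)) *
    (legendre l).eval (inner ℝ (x : E3) (y : E3)))
    (continuous_const.mul (continuous_legendre_inner l x))

/-- The signs cancel, and averaging over the random point is the Legendre convolution. It produces
the factor `1 / (2 l + 1)` and explains the normalisation in `multipole`, as well as why different
degrees of the same seed are uncorrelated. -/
theorem integral_multipole_mul (l l' : ℕ) (c c' : ℝ) (x y : S2) :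
    ∫ e, multipole l c x e * multipole l' c' y e ∂seedMeasure
      = if l = l' then (2 * l + 1) / (4 * Real.pi) * (√c * √c') *
          (legendre l).eval (inner ℝ (x : E3) (y : E3)) else 0 := by
  refine (integral_sgn_mul_sgn
    (h := fun z : S2 => (2 * l + 1) * √(c / (4 * Real.pi)) *
      (legendre l).eval (inner ℝ (x : E3) (z : E3)))
    (h' := fun z : S2 => (2 * l' + 1) * √(c' / (4 * Real.pi)) *
      (legendre l').eval (inner ℝ (y : E3) (z : E3)))
    (continuous_const.mul (continuous_legendre_inner l x))
    (continuous_const.mul (continuous_legendre_inner l' y))).trans ?_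
  have e : ∀ z : S2, (2 * l + 1) * √(c / (4 * Real.pi)) *
      (legendre l).eval (inner ℝ (x : E3) (z : E3)) * ((2 * l' + 1) * √(c' / (4 * Real.pi)) *
      (legendre l').eval (inner ℝ (y : E3) (z : E3)))
      = ((2 * l + 1) * √(c / (4 * Real.pi)) * ((2 * l' + 1) * √(c' / (4 * Real.pi)))) *
        ((legendre l).eval (inner ℝ (x : E3) (z : E3)) *
          (legendre l').eval (inner ℝ (z : E3) (y : E3))) := by
    intro z
    rw [real_inner_comm (z : E3) (y : E3)]
    ring
  simp only [e]
  rw [integral_const_mul, integral_legendre_mul_legendre]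
  split_ifs with h
  · subst h
    have hp := Real.pi_pos
    rw [Real.sqrt_div' _ (by positivity), Real.sqrt_div' _ (by positivity)]
    have hs : √(4 * Real.pi) * √(4 * Real.pi) = 4 * Real.pi := Real.mul_self_sqrt (by positivity)
    have hs0 : 0 < √(4 * Real.pi) := Real.sqrt_pos.2 (by positivity)
    calc _ = (2 * l + 1) * √c * √c' * (legendre l).eval (inner ℝ (x : E3) (y : E3)) /
          (√(4 * Real.pi) * √(4 * Real.pi)) := by
          field_simp
      _ = _ := by
          rw [hs]
          ring
  · simp

theorem ofReal_multipole_mem (l : ℕ) (c : ℝ) (e : S2 × Bool) :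
    (fun x => (multipole l c x e : ℂ)) ∈ harmonicSpace l := by
  have h := (harmonicSpace l).smul_mem
    ((sgn e.2 * ((2 * l + 1) * √(c / (4 * Real.pi))) : ℝ) : ℂ) (legendre_mem_harmonicSpace l e.1)
  convert h using 1
  ext x
  simp only [multipole, Pi.smul_apply, smul_eq_mul, ← Complex.ofReal_mul]
  rw [real_inner_comm (x : E3) (e.1 : E3)]
  congr 1
  ring

/-- Finite dimension makes the space closed under pointwise limits, so the infinite moving averages
stay inside it. -/
instance finiteDimensional_harmonicSpace (l : ℕ) : FiniteDimensional ℂ (harmonicSpace l) := by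
  have hfg := MvPolynomial.homogeneousSubmodule_fg (Fin 3) ℂ l
  have hle : harmonicSpace l ≤ (MvPolynomial.homogeneousSubmodule (Fin 3) ℂ l).map
      restrictToSphere := by
    intro Y hY
    obtain ⟨q, hq, _, rfl⟩ := exists_poly_of_mem_harmonicSpace hY
    exact ⟨q, hq, rfl⟩
  have : FiniteDimensional ℂ ((MvPolynomial.homogeneousSubmodule (Fin 3) ℂ l).map
      restrictToSphere) := Module.Finite.iff_fg.2 (hfg.map _)
  exact Submodule.finiteDimensional_of_le hle

theorem tsum_mem_harmonicSpace {l : ℕ} {f : ℤ → S2 → ℝ}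
    (hf : ∀ s, (fun x => (f s x : ℂ)) ∈ harmonicSpace l) (hs : ∀ x, Summable fun s => f s x) :
    (fun x => ((∑' s, f s x : ℝ) : ℂ)) ∈ harmonicSpace l := by
  have hcl := (harmonicSpace l).closed_of_finiteDimensional
  have h : HasSum (fun s => fun x => (f s x : ℂ)) (fun x => ((∑' s, f s x : ℝ) : ℂ)) := by
    rw [Pi.hasSum]
    exact fun x => Complex.hasSum_ofReal.2 (hs x).hasSum
  exact hcl.mem_of_tendsto h (Eventually.of_forall fun s => Submodule.sum_mem _ fun i _ => hf i)

/-! ### Linear filters of the noise -/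

theorem summable_abs_shift {ψ : ℤ → ℝ} (hψ : Summable fun n => |ψ n|) (t : ℤ) :
    Summable fun s => |ψ (t - s)| :=
  (Equiv.subLeft t).summable_iff.2 hψ

/-- The multipole of degree `l` of a linear process with moving average coefficients `ψ`. -/
def linFilter (ψ : ℤ → ℝ) (l : ℕ) (c : ℝ) (x : S2) (t : ℤ) (ω : SeedSpace) : ℝ :=
  ∑' s, ψ (t - s) * multipole l c x (ω s)

theorem summable_linFilter {ψ : ℤ → ℝ} (hψ : Summable fun n => |ψ n|) (l : ℕ) (c : ℝ) (x : S2)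
    (t : ℤ) (ω : SeedSpace) : Summable fun s => ψ (t - s) * multipole l c x (ω s) := by
  obtain ⟨M, _, hM⟩ := exists_multipole_bound l c
  refine Summable.of_norm_bounded ((summable_abs_shift hψ t).mul_right M) fun s => ?_
  rw [norm_mul]
  exact mul_le_mul_of_nonneg_left (hM _ _) (norm_nonneg _)

theorem exists_linFilter_bound {ψ : ℤ → ℝ} (hψ : Summable fun n => |ψ n|) (l : ℕ) (c : ℝ) :
    ∃ M : ℝ, 0 ≤ M ∧ ∀ x t ω, |linFilter ψ l c x t ω| ≤ M := by
  obtain ⟨M, hM0, hM⟩ := exists_multipole_bound l c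
  refine ⟨(∑' n, |ψ n|) * M, mul_nonneg (tsum_nonneg fun _ => abs_nonneg _) hM0, fun x t ω => ?_⟩
  have h1 : HasSum (fun s => |ψ (t - s)| * M) ((∑' n, |ψ n|) * M) :=
    ((Equiv.subLeft t).hasSum_iff.2 hψ.hasSum).mul_right M
  rw [← Real.norm_eq_abs, linFilter]
  refine tsum_of_norm_bounded h1 fun s => ?_
  rw [norm_mul]
  exact mul_le_mul_of_nonneg_left (hM _ _) (norm_nonneg _)

theorem measurable_linFilter (ψ : ℤ → ℝ) (l : ℕ) (c : ℝ) (t : ℤ) :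
    Measurable fun z : S2 × SeedSpace => linFilter ψ l c z.1 t z.2 := by
  refine Measurable.tsum fun s => Measurable.const_mul ?_ _
  exact (continuous_multipole l c).measurable.comp
    (measurable_fst.prodMk ((measurable_pi_apply s).comp measurable_snd))

/-- The multipoles are uniformly bounded, so the series converges absolutely and the recursion of
`ψ` transfers to the process for every outcome, with no exceptional set. -/
theorem linFilter_eq {p : ℕ} {φ : ℕ → ℝ} {ψ : ℤ → ℝ} (hs : Summable fun n => |ψ n|)
    (hψ : ∀ n : ℤ, ψ n = (if n = 0 then 1 else 0) +
      ∑ j : Fin p, φ j * ψ (n - ((j : ℕ) + 1 : ℤ))) (l : ℕ) (c : ℝ) (x : S2) (t : ℤ)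
    (ω : SeedSpace) : linFilter ψ l c x t ω
      = ∑ j : Fin p, φ j * linFilter ψ l c x (t - ((j : ℕ) + 1 : ℤ)) ω + multipole l c x (ω t) := by
  have h1 : HasSum (fun s => (if s = t then multipole l c x (ω t) else 0) +
      ∑ j : Fin p, φ j * (ψ (t - ((j : ℕ) + 1 : ℤ) - s) * multipole l c x (ω s)))
      (multipole l c x (ω t) + ∑ j : Fin p, φ j * linFilter ψ l c x (t - ((j : ℕ) + 1 : ℤ)) ω) :=
    (hasSum_ite_eq t _).add
      (hasSum_sum fun j _ => (summable_linFilter hs l c x _ ω).hasSum.mul_left _)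
  rw [add_comm, ← h1.tsum_eq]
  refine tsum_congr fun s => ?_
  rw [hψ (t - s), add_mul, Finset.sum_mul]
  congr 1
  · by_cases h : s = t
    · simp [h]
    · rw [if_neg h, if_neg (by omega), zero_mul]
  · refine Finset.sum_congr rfl fun j _ => ?_
    rw [sub_right_comm, mul_assoc]

theorem ofReal_linFilter_mem {ψ : ℤ → ℝ} (hψ : Summable fun n => |ψ n|) (l : ℕ) (c : ℝ) (t : ℤ)
    (ω : SeedSpace) : (fun x => (linFilter ψ l c x t ω : ℂ)) ∈ harmonicSpace l := by
  refine tsum_mem_harmonicSpace (fun s => ?_) fun x => summable_linFilter hψ l c x t ω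
  convert (harmonicSpace l).smul_mem ((ψ (t - s) : ℝ) : ℂ) (ofReal_multipole_mem l c (ω s)) using 1
  ext x
  simp

theorem measurable_multipole_eval (l : ℕ) (c : ℝ) (x : S2) (s : ℤ) :
    Measurable fun ω : SeedSpace => multipole l c x (ω s) :=
  (measurable_multipole l c x).comp (measurable_pi_apply s)

theorem integrable_of_bound {X : SeedSpace → ℝ} (hX : Measurable X) {M : ℝ} (hM : ∀ ω, |X ω| ≤ M) :
    Integrable X seedLaw :=
  Integrable.of_bound hX.aestronglyMeasurable M (Eventually.of_forall hM)

/-- Exchange of expectation and series. Allowing any bounded factor `X` lets it be used for the mean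
and, twice, for covariances. -/
theorem integral_mul_linFilter {ψ : ℤ → ℝ} (hψ : Summable fun n => |ψ n|) (l : ℕ) (c : ℝ) (x : S2)
    (t : ℤ) {X : SeedSpace → ℝ} (hX : Measurable X) {M : ℝ} (hM : ∀ ω, |X ω| ≤ M) :
    ∫ ω, X ω * linFilter ψ l c x t ω ∂seedLaw
      = ∑' s, ψ (t - s) * ∫ ω, X ω * multipole l c x (ω s) ∂seedLaw := by
  obtain ⟨N, hN0, hN⟩ := exists_multipole_bound l c
  have hb : ∀ s ω, |X ω * multipole l c x (ω s)| ≤ M * N := fun s ω => by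
    rw [abs_mul]
    exact mul_le_mul (hM ω) (hN _ _) (abs_nonneg _) ((abs_nonneg _).trans (hM ω))
  have hi : ∀ s, Integrable (fun ω => X ω * multipole l c x (ω s)) seedLaw := fun s =>
    integrable_of_bound (hX.mul (measurable_multipole_eval l c x s)) (hb s)
  simp only [← integral_const_mul]
  rw [integral_tsum_of_summable_integral_norm fun s => (hi s).const_mul _]
  · refine integral_congr_ae (Eventually.of_forall fun ω => ?_)
    simp only [linFilter, ← tsum_mul_left]
    exact tsum_congr fun s => by ring
  · refine Summable.of_nonneg_of_le (fun s => integral_nonneg fun ω => norm_nonneg _) (fun s => ?_)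
      ((summable_abs_shift hψ t).mul_right (M * N))
    simp only [norm_mul (ψ (t - s))]
    rw [integral_const_mul]
    refine mul_le_mul_of_nonneg_left ?_ (norm_nonneg _)
    calc _ ≤ ∫ _, M * N ∂seedLaw :=
          integral_mono (hi s).norm (integrable_const _) (hb s)
      _ = M * N := by simp

theorem integral_linFilter {ψ : ℤ → ℝ} (hψ : Summable fun n => |ψ n|) (l : ℕ) (c : ℝ) (x : S2)
    (t : ℤ) : ∫ ω, linFilter ψ l c x t ω ∂seedLaw = 0 := by
  have h := integral_mul_linFilter hψ l c x t (X := fun _ => 1) measurable_const (M := 1)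
    (fun _ => by simp)
  simp only [one_mul] at h
  rw [h]
  simp [integral_seedLaw_eval _ (measurable_multipole l c x).aestronglyMeasurable,
    integral_multipole]

/-- The covariance of multipoles generated by the same seed. -/
def multipoleCov (l l' : ℕ) (c c' : ℝ) (x y : S2) : ℝ :=
  ∫ e, multipole l c x e * multipole l' c' y e ∂seedMeasure

theorem integral_multipole_mul_multipole (l l' : ℕ) (c c' : ℝ) (x y : S2) (t s : ℤ) :
    ∫ ω, multipole l c x (ω t) * multipole l' c' y (ω s) ∂seedLaw
      = if t = s then multipoleCov l l' c c' x y else 0 := by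
  split_ifs with h
  · subst h
    exact integral_seedLaw_eval t (f := fun e => multipole l c x e * multipole l' c' y e)
      ((measurable_multipole l c x).mul (measurable_multipole l' c' y)).aestronglyMeasurable
  · rw [integral_seedLaw_mul h (measurable_multipole l c x) (measurable_multipole l' c' y),
      integral_multipole, zero_mul]

theorem integral_linFilter_mul {ψ ψ' : ℤ → ℝ} (hψ : Summable fun n => |ψ n|)
    (hψ' : Summable fun n => |ψ' n|) (l l' : ℕ) (c c' : ℝ) (x y : S2) (t s : ℤ) :
    ∫ ω, linFilter ψ l c x t ω * linFilter ψ' l' c' y s ω ∂seedLaw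
      = multipoleCov l l' c c' x y * ∑' u, ψ (t - u) * ψ' (s - u) := by
  obtain ⟨M, _, hM⟩ := exists_linFilter_bound hψ l c
  obtain ⟨N, _, hN⟩ := exists_multipole_bound l' c'
  have hm : Measurable fun ω => linFilter ψ l c x t ω :=
    (measurable_linFilter ψ l c t).comp measurable_prodMk_left
  rw [integral_mul_linFilter hψ' l' c' y s hm fun ω => hM x t ω, ← tsum_mul_left]
  refine tsum_congr fun u => ?_
  have h1 : ∫ ω, linFilter ψ l c x t ω * multipole l' c' y (ω u) ∂seedLaw
      = ψ (t - u) * multipoleCov l l' c c' x y := by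
    simp only [mul_comm (linFilter ψ l c x t _)]
    rw [integral_mul_linFilter hψ l c x t (measurable_multipole_eval l' c' y u) fun ω => hN y _]
    simp only [mul_comm (multipole l' c' y _), integral_multipole_mul_multipole, mul_ite, mul_zero]
    exact tsum_ite_eq u _
  rw [h1]
  ring

/-- The autocovariance function of a linear process. -/
def maCov (ψ : ℤ → ℝ) (t : ℤ) : ℝ := ∑' u, ψ (t - u) * ψ (-u)

theorem tsum_shift_mul_shift (ψ : ℤ → ℝ) (t s : ℤ) :
    ∑' u, ψ (t - u) * ψ (s - u) = maCov ψ (t - s) := by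
  unfold maCov
  rw [← (Equiv.addRight s).tsum_eq fun u => ψ (t - u) * ψ (s - u)]
  refine tsum_congr fun u => ?_
  simp only [Equiv.coe_addRight]
  congr 2 <;> ring

theorem multipoleCov_eq (l l' : ℕ) (c c' : ℝ) (x y : S2) : multipoleCov l l' c c' x y
    = if l = l' then (2 * l + 1) / (4 * Real.pi) * (√c * √c') *
        (legendre l).eval (inner ℝ (x : E3) (y : E3)) else 0 :=
  integral_multipole_mul l l' c c' x y

/-! ### Band-limited isotropic kernels -/

/-- The band-limited kernel with eigenvalues `b l`, `l ≤ L`. -/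
def bandKernel (L : ℕ) (b : ℕ → ℝ) (c : ℝ) : ℝ :=
  ∑ l ∈ Finset.range (L + 1), b l * ((2 * l + 1) / (4 * Real.pi)) * (legendre l).eval c

theorem continuous_bandKernel (L : ℕ) (b : ℕ → ℝ) : Continuous (bandKernel L b) :=
  continuous_finsetSum _ fun l _ => continuous_const.mul (legendre l).continuous

theorem isotropicOp_bandKernel (L : ℕ) (b : ℕ → ℝ) {l : ℕ} {Y : S2 → ℂ} (hY : Y ∈ harmonicSpace l)
    (x : S2) : isotropicOp (bandKernel L b) Y x = ((if l ≤ L then b l else 0 : ℝ) : ℂ) * Y x := by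
  have hc := continuous_of_mem_harmonicSpace hY
  have e : ∀ y : S2, bandKernel L b (inner ℝ (x : E3) (y : E3)) • Y y
      = ∑ l' ∈ Finset.range (L + 1), ((b l' * ((2 * l' + 1) / (4 * Real.pi)) : ℝ) : ℂ) *
        ((((legendre l').eval (inner ℝ (x : E3) (y : E3)) : ℝ) : ℂ) * Y y) := by
    intro y
    rw [bandKernel, Complex.real_smul, Complex.ofReal_sum, Finset.sum_mul]
    refine Finset.sum_congr rfl fun l' _ => ?_
    push_cast
    ring
  unfold isotropicOp
  simp only [e]
  have hi : ∀ l' ∈ Finset.range (L + 1), Integrable (fun y : S2 =>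
      ((b l' * ((2 * l' + 1) / (4 * Real.pi)) : ℝ) : ℂ) *
        ((((legendre l').eval (inner ℝ (x : E3) (y : E3)) : ℝ) : ℂ) * Y y)) surf := fun l' _ =>
    integrable_of_continuous (continuous_const.mul
      ((Complex.continuous_ofReal.comp (continuous_legendre_inner l' x)).mul hc))
  rw [integral_finsetSum _ hi]
  simp only [integral_const_mul]
  have hval : ∀ l' : ℕ, ∫ y : S2, (((legendre l').eval (inner ℝ (x : E3) (y : E3)) : ℝ) : ℂ) * Y y
      ∂surf = if l' = l then ((4 * Real.pi / (2 * l + 1) : ℝ) : ℂ) * Y x else 0 := by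
    intro l'
    split_ifs with h
    · subst h
      exact integral_legendre_mul l' x hY
    · exact integral_legendre_mul_of_ne h x hY
  simp only [hval, mul_ite, mul_zero]
  rw [Finset.sum_ite_eq' _ l]
  have hl : l ∈ Finset.range (L + 1) ↔ l ≤ L := by
    rw [Finset.mem_range]
    omega
  simp only [hl]
  split_ifs with h
  · rw [← mul_assoc, ← Complex.ofReal_mul]
    congr 2
    have := Real.pi_pos
    field_simp
  · simp

theorem isotropicOp_bandKernel_sum (L : ℕ) (b : ℕ → ℝ) {f : ℕ → S2 → ℝ}
    (hf : ∀ l, (fun x => (f l x : ℂ)) ∈ harmonicSpace l) (x : S2) :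
    isotropicOp (bandKernel L b) (fun y => ∑ l ∈ Finset.range (L + 1), f l y) x
      = ∑ l ∈ Finset.range (L + 1), b l * f l x := by
  apply Complex.ofReal_injective
  unfold isotropicOp
  rw [← integral_complex_ofReal]
  have hk := continuous_bandKernel L b
  have e : ∀ y : S2, ((bandKernel L b (inner ℝ (x : E3) (y : E3)) •
      ∑ l ∈ Finset.range (L + 1), f l y : ℝ) : ℂ) = ∑ l ∈ Finset.range (L + 1),
        bandKernel L b (inner ℝ (x : E3) (y : E3)) • (f l y : ℂ) := by
    intro y
    rw [smul_eq_mul, Complex.ofReal_mul, Complex.ofReal_sum, Finset.mul_sum]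
    rfl
  simp only [e]
  have hi : ∀ l ∈ Finset.range (L + 1), Integrable (fun y : S2 =>
      bandKernel L b (inner ℝ (x : E3) (y : E3)) • (f l y : ℂ)) surf := fun l _ => by
    have := continuous_of_mem_harmonicSpace (hf l)
    exact integrable_of_continuous (by fun_prop)
  rw [integral_finsetSum _ hi, Complex.ofReal_sum]
  refine Finset.sum_congr rfl fun l hl => ?_
  have := isotropicOp_bandKernel L b (hf l) x
  rw [if_pos (Nat.lt_succ_iff.1 (Finset.mem_range.1 hl))] at this
  rw [Complex.ofReal_mul]
  exact this

/-! ### The spherical autoregression -/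

/-- The noise with angular power spectrum `C`. -/
def seedNoise (L : ℕ) (C : ℕ → ℝ) (x : S2) (t : ℤ) (ω : SeedSpace) : ℝ :=
  ∑ l ∈ Finset.range (L + 1), multipole l (C l) x (ω t)

/-- The linear process with multipole-wise moving average coefficients `ψ`. -/
def linearField (L : ℕ) (C : ℕ → ℝ) (ψ : ℕ → ℤ → ℝ) (x : S2) (t : ℤ) (ω : SeedSpace) : ℝ :=
  ∑ l ∈ Finset.range (L + 1), linFilter (ψ l) l (C l) x t ω

section

variable {L : ℕ} {C : ℕ → ℝ} {ψ : ℕ → ℤ → ℝ}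

theorem measurable_seedNoise (t : ℤ) :
    Measurable fun z : S2 × SeedSpace => seedNoise L C z.1 t z.2 :=
  Finset.measurable_fun_sum _ fun l _ => (continuous_multipole l (C l)).measurable.comp
    (measurable_fst.prodMk ((measurable_pi_apply t).comp measurable_snd))

theorem measurable_linearField (t : ℤ) :
    Measurable fun z : S2 × SeedSpace => linearField L C ψ z.1 t z.2 :=
  Finset.measurable_fun_sum _ fun l _ => measurable_linFilter (ψ l) l (C l) t

theorem exists_seedNoise_bound (L : ℕ) (C : ℕ → ℝ) :
    ∃ M : ℝ, ∀ x t ω, |seedNoise L C x t ω| ≤ M := by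
  choose M _ hM using fun l => exists_multipole_bound l (C l)
  exact ⟨∑ l ∈ Finset.range (L + 1), M l, fun x t ω =>
    (Finset.abs_sum_le_sum_abs _ _).trans (Finset.sum_le_sum fun l _ => hM l x (ω t))⟩

theorem exists_linearField_bound (hψ : ∀ l, Summable fun n => |ψ l n|) (L : ℕ) (C : ℕ → ℝ) :
    ∃ M : ℝ, ∀ x t ω, |linearField L C ψ x t ω| ≤ M := by
  choose M _ hM using fun l => exists_linFilter_bound (hψ l) l (C l)
  exact ⟨∑ l ∈ Finset.range (L + 1), M l, fun x t ω =>
    (Finset.abs_sum_le_sum_abs _ _).trans (Finset.sum_le_sum fun l _ => hM l x t ω)⟩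

/-- All degrees are driven by the same seeds, but the cross terms vanish by orthogonality of
Legendre polynomials. Only the angle and the time lag remain, whence isotropy and stationarity. -/
theorem integral_linearField_mul (hψ : ∀ l, Summable fun n => |ψ l n|) (hC : ∀ l, 0 ≤ C l)
    (x y : S2) (t s : ℤ) : ∫ ω, linearField L C ψ x t ω * linearField L C ψ y s ω ∂seedLaw
      = ∑ l ∈ Finset.range (L + 1), C l * maCov (ψ l) (t - s) *
          ((2 * l + 1) / (4 * Real.pi) * (legendre l).eval (inner ℝ (x : E3) (y : E3))) := by
  unfold linearField
  simp only [Finset.sum_mul_sum]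
  have hi : ∀ l l', Integrable (fun ω => linFilter (ψ l) l (C l) x t ω *
      linFilter (ψ l') l' (C l') y s ω) seedLaw := by
    intro l l'
    obtain ⟨M, hM0, hM⟩ := exists_linFilter_bound (hψ l) l (C l)
    obtain ⟨N, _, hN⟩ := exists_linFilter_bound (hψ l') l' (C l')
    refine integrable_of_bound (M := M * N) (Measurable.mul
      ((measurable_linFilter _ _ _ _).comp measurable_prodMk_left)
      ((measurable_linFilter _ _ _ _).comp measurable_prodMk_left)) fun ω => ?_
    rw [abs_mul]
    exact mul_le_mul (hM _ _ _) (hN _ _ _) (abs_nonneg _) hM0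
  rw [integral_finsetSum _ fun l _ => integrable_finsetSum _ fun l' _ => hi l l']
  refine Finset.sum_congr rfl fun l hl => ?_
  rw [integral_finsetSum _ fun l' _ => hi l l']
  simp only [integral_linFilter_mul (hψ _) (hψ _), multipoleCov_eq, ite_mul, zero_mul]
  rw [Finset.sum_ite_eq, if_pos hl, tsum_shift_mul_shift, Real.mul_self_sqrt (hC l)]
  ring

theorem isIsotropicStationary_linearField (hψ : ∀ l, Summable fun n => |ψ l n|)
    (hC : ∀ l, 0 ≤ C l) : IsIsotropicStationary seedLaw (linearField L C ψ) where
  measurable := measurable_linearField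
  memLp x t := by
    obtain ⟨M, hM⟩ := exists_linearField_bound hψ L C
    exact MemLp.of_bound
      ((measurable_linearField t).comp measurable_prodMk_left).aestronglyMeasurable M
      (Eventually.of_forall fun ω => hM x t ω)
  mean_zero x t := by
    unfold linearField
    rw [integral_finsetSum]
    · exact Finset.sum_eq_zero fun l _ => integral_linFilter (hψ l) l (C l) x t
    · intro l _
      obtain ⟨M, _, hM⟩ := exists_linFilter_bound (hψ l) l (C l)
      exact integrable_of_bound ((measurable_linFilter _ _ _ _).comp measurable_prodMk_left)
        fun ω => hM x t ω
  invariant g _ x y t s h := by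
    rw [integral_linearField_mul hψ hC, integral_linearField_mul hψ hC, add_sub_add_right_eq_sub]
    have e : inner ℝ (rotate g x : E3) (rotate g y : E3) = inner ℝ (x : E3) (y : E3) :=
      g.inner_map_map x y
    rw [e]

theorem covKernel_linearField (hψ : ∀ l, Summable fun n => |ψ l n|) (hC : ∀ l, 0 ≤ C l) (t : ℤ)
    (x y : S2) : covKernel seedLaw (linearField L C ψ) t x y
      = ∑ l ∈ Finset.range (L + 1), C l * maCov (ψ l) t *
          ((2 * l + 1) / (4 * Real.pi) * (legendre l).eval (inner ℝ (x : E3) (y : E3))) := by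
  rw [covKernel, integral_linearField_mul hψ hC, sub_zero]

theorem hasContinuousCov_linearField (hψ : ∀ l, Summable fun n => |ψ l n|) (hC : ∀ l, 0 ≤ C l) :
    HasContinuousCov seedLaw (linearField L C ψ) := by
  intro t
  simp only [covKernel_linearField hψ hC]
  have := fun l => (legendre l).continuous
  fun_prop

theorem ofReal_sum_mem {f : ℕ → S2 → ℝ} (hf : ∀ l, (fun x => (f l x : ℂ)) ∈ harmonicSpace l)
    (L : ℕ) : (fun x => ((∑ l ∈ Finset.range (L + 1), f l x : ℝ) : ℂ))
      ∈ ⨆ l ∈ Finset.range (L + 1), harmonicSpace l := by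
  have e : (fun x => ((∑ l ∈ Finset.range (L + 1), f l x : ℝ) : ℂ))
      = ∑ l ∈ Finset.range (L + 1), fun x => (f l x : ℂ) := by
    ext x
    simp
  rw [e]
  exact Submodule.sum_mem _ fun l hl => Submodule.mem_iSup_of_mem l
    (Submodule.mem_iSup_of_mem hl (hf l))

theorem isBandLimited_seedNoise : IsBandLimited seedLaw L (seedNoise L C) := fun t =>
  Eventually.of_forall fun ω => ofReal_sum_mem
    (f := fun l x => multipole l (C l) x (ω t)) (fun l => ofReal_multipole_mem l (C l) (ω t)) L

theorem isBandLimited_linearField (hψ : ∀ l, Summable fun n => |ψ l n|) :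
    IsBandLimited seedLaw L (linearField L C ψ) := fun t =>
  Eventually.of_forall fun ω => ofReal_sum_mem
    (f := fun l x => linFilter (ψ l) l (C l) x t ω)
    (fun l => ofReal_linFilter_mem (hψ l) l (C l) t ω) L

/-- The harmonic coefficients of the noise at a given time are the values of a fixed harmonic
function at the random point, up to the random sign. -/
theorem exists_harmonicCoeff_seedNoise (L : ℕ) (C : ℕ → ℝ) {l : ℕ} {Y : S2 → ℂ}
    (hY : Y ∈ harmonicSpace l) : ∃ κ : ℂ, ∀ t ω,
      harmonicCoeff (fun x => seedNoise L C x t ω) Y = sgn (ω t).2 • (κ * star (Y (ω t).1)) := by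
  have hc := continuous_of_mem_harmonicSpace hY
  refine ⟨∑ l' ∈ Finset.range (L + 1), (((2 * l' + 1) * √(C l' / (4 * Real.pi)) : ℝ) : ℂ) *
    (if l' = l then ((4 * Real.pi / (2 * l + 1) : ℝ) : ℂ) else 0), fun t ω => ?_⟩
  have hterm : ∀ l' : ℕ, ∫ x, (multipole l' (C l') x (ω t) : ℂ) * star (Y x) ∂surf
      = sgn (ω t).2 • ((((2 * l' + 1) * √(C l' / (4 * Real.pi)) : ℝ) : ℂ) *
        (if l' = l then ((4 * Real.pi / (2 * l + 1) : ℝ) : ℂ) else 0) * star (Y (ω t).1)) := by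
    intro l'
    have h1 : ∫ y : S2, (((legendre l').eval (inner ℝ ((ω t).1 : E3) (y : E3)) : ℝ) : ℂ) *
        star (Y y) ∂surf
        = (if l' = l then ((4 * Real.pi / (2 * l + 1) : ℝ) : ℂ) else 0) * star (Y (ω t).1) := by
      have h2 : ∫ y : S2, (((legendre l').eval (inner ℝ ((ω t).1 : E3) (y : E3)) : ℝ) : ℂ) * Y y
          ∂surf = (if l' = l then ((4 * Real.pi / (2 * l + 1) : ℝ) : ℂ) else 0) * Y (ω t).1 := by
        split_ifs with h
        · subst h
          exact integral_legendre_mul l' _ hY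
        · rw [integral_legendre_mul_of_ne h _ hY, zero_mul]
      have h3 := congrArg (starRingEnd ℂ) h2
      rw [← integral_conj] at h3
      simp only [map_mul, Complex.conj_ofReal] at h3
      rw [RCLike.star_def]
      rw [h3]
      congr 1
      split_ifs
      · exact Complex.conj_ofReal _
      · exact map_zero _
    rw [mul_assoc, ← h1, ← integral_const_mul, ← integral_smul]
    refine integral_congr_ae (Eventually.of_forall fun x => ?_)
    simp only [multipole, Complex.real_smul]
    rw [real_inner_comm (x : E3)]
    push_cast
    ring
  unfold harmonicCoeff seedNoise
  simp only [Complex.ofReal_sum, Finset.sum_mul]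
  rw [integral_finsetSum, Finset.smul_sum]
  · exact Finset.sum_congr rfl fun l' _ => hterm l'
  · intro l' _
    exact integrable_of_continuous
      ((continuous_of_mem_harmonicSpace (ofReal_multipole_mem l' (C l') (ω t))).mul hc.star)

/-- At distinct times the harmonic coefficients are functions of independent seeds, and each is
centred by the sign. -/
theorem isSphericalWhiteNoise_seedNoise (hC : ∀ l, 0 ≤ C l) (hL : ∀ l, L < l → C l = 0) :
    IsSphericalWhiteNoise seedLaw (seedNoise L C) C where
  measurable := measurable_seedNoise
  memLp x t := by
    obtain ⟨M, hM⟩ := exists_seedNoise_bound L C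
    exact MemLp.of_bound
      ((measurable_seedNoise t).comp measurable_prodMk_left).aestronglyMeasurable M
      (Eventually.of_forall fun ω => hM x t ω)
  mean_zero x t := by
    unfold seedNoise
    rw [integral_finsetSum]
    · refine Finset.sum_eq_zero fun l _ => ?_
      rw [integral_seedLaw_eval t (measurable_multipole l (C l) x).aestronglyMeasurable,
        integral_multipole]
    · intro l _
      obtain ⟨M, _, hM⟩ := exists_multipole_bound l (C l)
      exact integrable_of_bound (measurable_multipole_eval _ _ _ _) fun ω => hM x (ω t)
  spectrum_nonneg := hC
  spectrum_summable := summable_of_ne_finset_zero (s := Finset.range (L + 1)) fun l hl => by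
    rw [hL l (by have := Finset.mem_range.not.1 hl; omega), mul_zero]
  covariance t x y := by
    have h : ∫ ω, seedNoise L C x t ω * seedNoise L C y t ω ∂seedLaw
        = ∑ l ∈ Finset.range (L + 1), (2 * (l : ℝ) + 1) / (4 * Real.pi) * C l *
          (legendre l).eval (inner ℝ (x : E3) (y : E3)) := by
      unfold seedNoise
      simp only [Finset.sum_mul_sum]
      have hi : ∀ l l', Integrable (fun ω : SeedSpace => multipole l (C l) x (ω t) *
          multipole l' (C l') y (ω t)) seedLaw := by
        intro l l'
        obtain ⟨M, hM0, hM⟩ := exists_multipole_bound l (C l)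
        obtain ⟨N, _, hN⟩ := exists_multipole_bound l' (C l')
        refine integrable_of_bound (M := M * N) (Measurable.mul
          (measurable_multipole_eval _ _ _ _) (measurable_multipole_eval _ _ _ _)) fun ω => ?_
        rw [abs_mul]
        exact mul_le_mul (hM _ _) (hN _ _) (abs_nonneg _) hM0
      rw [integral_finsetSum _ fun l _ => integrable_finsetSum _ fun l' _ => hi l l']
      refine Finset.sum_congr rfl fun l hl => ?_
      rw [integral_finsetSum _ fun l' _ => hi l l']
      simp only [integral_multipole_mul_multipole, if_true, multipoleCov_eq]
      rw [Finset.sum_ite_eq, if_pos hl, Real.mul_self_sqrt (hC l)]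
    rw [h]
    exact hasSum_sum_of_ne_finset_zero fun l hl => by
      rw [hL l (by have := Finset.mem_range.not.1 hl; omega), mul_zero, zero_mul]
  uncorrelated t s hts l l' Y hY Y' hY' := by
    obtain ⟨κ, hκ⟩ := exists_harmonicCoeff_seedNoise L C hY
    obtain ⟨κ', hκ'⟩ := exists_harmonicCoeff_seedNoise L C hY'
    have hc := continuous_of_mem_harmonicSpace hY
    have hc' := continuous_of_mem_harmonicSpace hY'
    have hs : Continuous sgn := continuous_of_discreteTopology
    have m1 : Continuous fun e : S2 × Bool => sgn e.2 • (κ * star (Y e.1)) := by fun_prop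
    have m2 : Continuous fun e : S2 × Bool => star (sgn e.2 • (κ' * star (Y' e.1))) := by fun_prop
    simp only [hκ, hκ']
    rw [integral_seedLaw_mul hts (f := fun e : S2 × Bool => sgn e.2 • (κ * star (Y e.1)))
      (g := fun e : S2 × Bool => star (sgn e.2 • (κ' * star (Y' e.1)))) m1.measurable m2.measurable,
      integral_sgn_smul (h := fun y => κ * star (Y y)) (by fun_prop), zero_mul]

theorem isCausalBandLimitedSPHAR_linearField {p : ℕ} {φ : ℕ → ℕ → ℝ}
    (hφ : ∀ l, ∀ z : ℂ, ‖z‖ ≤ 1 → 1 - ∑ j : Fin p, (φ l j : ℂ) * z ^ ((j : ℕ) + 1) ≠ 0)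
    (hψ : ∀ l, Summable fun n => |ψ l n|)
    (hrec : ∀ l, ∀ n : ℤ, ψ l n = (if n = 0 then 1 else 0) +
      ∑ j : Fin p, φ l j * ψ l (n - ((j : ℕ) + 1 : ℤ)))
    (hC : ∀ l, 0 ≤ C l) (hL : ∀ l, L < l → C l = 0) :
    IsCausalBandLimitedSPHAR seedLaw (linearField L C ψ) := by
  -- The eigenvalues are cut to zero above `L`, as the kernels are band-limited; there the causality
  -- polynomial is the constant one.
  refine ⟨isIsotropicStationary_linearField hψ hC, L, p, fun j => bandKernel L fun l => φ l j,
    seedNoise L C, C, ?_, ⟨fun l j => if l ≤ L then φ l j else 0, ?_, ?_⟩,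
    isBandLimited_linearField hψ, isBandLimited_seedNoise, hL⟩
  · have heq : ∀ (x : S2) (t : ℤ) (ω : SeedSpace), linearField L C ψ x t ω
        = ∑ j : Fin p, isotropicOp (bandKernel L fun l => φ l j)
          (fun y => linearField L C ψ y (t - ((j : ℕ) + 1 : ℤ)) ω) x + seedNoise L C x t ω := by
      intro x t ω
      have h1 : ∀ j : Fin p, isotropicOp (bandKernel L fun l => φ l j)
          (fun y => linearField L C ψ y (t - ((j : ℕ) + 1 : ℤ)) ω) x
          = ∑ l ∈ Finset.range (L + 1), φ l j *
            linFilter (ψ l) l (C l) x (t - ((j : ℕ) + 1 : ℤ)) ω := fun j =>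
        isotropicOp_bandKernel_sum L _
          (f := fun l y => linFilter (ψ l) l (C l) y (t - ((j : ℕ) + 1 : ℤ)) ω)
          (fun l => ofReal_linFilter_mem (hψ l) l (C l) _ ω) x
      simp only [h1]
      rw [Finset.sum_comm, seedNoise, ← Finset.sum_add_distrib, linearField]
      exact Finset.sum_congr rfl fun l _ => linFilter_eq (hψ l) (hrec l) l (C l) x t ω
    exact
      { kernel_continuous := fun j => (continuous_bandKernel L _).continuousOn
        measurable := measurable_linearField
        sq_integrable := fun t => Eventually.of_forall fun ω => by
          obtain ⟨M, hM⟩ := exists_linearField_bound hψ L C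
          exact MemLp.of_bound ((measurable_linearField t).comp
            (measurable_id.prodMk measurable_const)).aestronglyMeasurable M
            (Eventually.of_forall fun x => hM x t ω)
        noise := isSphericalWhiteNoise_seedNoise hC hL
        equation := fun x t => Eventually.of_forall fun ω => heq x t ω
        equation_prod := fun t => Eventually.of_forall fun z => heq z.1 t z.2 }
  · intro l j Y hY x
    exact isotropicOp_bandKernel L (fun l => φ l j) hY x
  · intro l z hz
    by_cases h : l ≤ L
    · simpa [h] using hφ l z hz
    · simp [h]

end

/-! ### Spectra of linear processes -/

theorem norm_exp_neg_I_mul (lam : ℝ) (t : ℤ) :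
    ‖Complex.exp (-(Complex.I * (lam : ℂ) * (t : ℂ)))‖ = 1 := by
  rw [show -(Complex.I * (lam : ℂ) * (t : ℂ)) = ((-(lam * t) : ℝ) : ℂ) * Complex.I by
    push_cast; ring]
  exact Complex.norm_exp_ofReal_mul_I _

theorem exp_neg_I_zpow (lam : ℝ) (t : ℤ) :
    Complex.exp (-(Complex.I * (lam : ℂ))) ^ t = Complex.exp (-(Complex.I * (lam : ℂ) * (t : ℂ))) := by
  rw [← Complex.exp_int_mul]
  congr 1
  ring

theorem summable_exp_mul {g : ℤ → ℝ} (hg : Summable fun t => |g t|) (lam : ℝ) :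
    Summable fun t : ℤ => Complex.exp (-(Complex.I * (lam : ℂ) * (t : ℂ))) * (g t : ℂ) := by
  refine Summable.of_norm (hg.congr fun t => ?_)
  rw [norm_mul, norm_exp_neg_I_mul, one_mul, Complex.norm_real, Real.norm_eq_abs]

theorem maCov_eq (ψ : ℤ → ℝ) (t : ℤ) : maCov ψ t = ∑' v, ψ (t + v) * ψ v := by
  unfold maCov
  rw [← (Equiv.neg ℤ).tsum_eq fun v => ψ (t + v) * ψ v]
  exact tsum_congr fun u => by simp [sub_eq_add_neg]

/-- The shear `(t, v) ↦ (t + v, v)` of the integer lattice. -/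
def latticeShear : ℤ × ℤ ≃ ℤ × ℤ where
  toFun z := (z.1 + z.2, z.2)
  invFun z := (z.1 - z.2, z.2)
  left_inv z := by simp
  right_inv z := by simp

/-- After the shear `(t, v) ↦ (t + v, v)` the double series is a product of two summable ones. -/
theorem summable_maCov {ψ : ℤ → ℝ} (hψ : Summable fun n => |ψ n|) :
    Summable fun t => |maCov ψ t| := by
  have h1 : Summable fun z : ℤ × ℤ => |ψ z.1| * |ψ z.2| :=
    hψ.mul_of_nonneg hψ (fun _ => abs_nonneg _) fun _ => abs_nonneg _
  have h2 := (latticeShear.summable_iff (f := fun z : ℤ × ℤ => |ψ z.1| * |ψ z.2|)).2 h1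
  refine Summable.of_nonneg_of_le (fun _ => abs_nonneg _) (fun t => ?_) h2.prod
  rw [maCov_eq]
  have h3 : Summable fun v => ‖ψ (t + v) * ψ v‖ := by
    refine (h2.prod_factor t).congr fun v => ?_
    simp [latticeShear]
  refine (norm_tsum_le_tsum_norm h3).trans (le_of_eq ?_)
  exact tsum_congr fun v => by simp [latticeShear]

theorem tsum_shear {F : ℤ × ℤ → ℂ} (hF : Summable F) :
    ∑' t : ℤ, ∑' v : ℤ, F (t + v, v) = ∑' z, F z := by
  rw [← latticeShear.tsum_eq F]
  exact ((latticeShear.summable_iff (f := F)).2 hF).tsum_prod.symm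

/-- The spectral density of a filter is the squared modulus of its transfer function: for a
unimodular character `e t = e (t + v) * conj (e v)`, so the sheared double sum factors. -/
theorem tsum_mul_maCov {ψ : ℤ → ℝ} (hψ : Summable fun n => |ψ n|) {e : ℤ → ℂ}
    (hen : ∀ t, ‖e t‖ = 1) (hadd : ∀ t v, e (t + v) = e t * e v) :
    ∑' t : ℤ, e t * (maCov ψ t : ℂ) = ((‖∑' n : ℤ, (ψ n : ℂ) * e n‖ ^ 2 : ℝ) : ℂ) := by
  have hn : ∀ n, ‖(ψ n : ℂ) * e n‖ = |ψ n| := fun n => by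
    rw [norm_mul, hen, mul_one, Complex.norm_real, Real.norm_eq_abs]
  have hn' : ∀ n, ‖(starRingEnd ℂ) ((ψ n : ℂ) * e n)‖ = |ψ n| := fun n => by
    rw [RCLike.norm_conj, hn]
  have hs : Summable fun n => ‖(ψ n : ℂ) * e n‖ := hψ.congr fun n => (hn n).symm
  have hs' : Summable fun n => ‖(starRingEnd ℂ) ((ψ n : ℂ) * e n)‖ :=
    hψ.congr fun n => (hn' n).symm
  have hprod : Summable fun z : ℤ × ℤ =>
      ((ψ z.1 : ℂ) * e z.1) * (starRingEnd ℂ) ((ψ z.2 : ℂ) * e z.2) :=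
    summable_mul_of_summable_norm (f := fun n => (ψ n : ℂ) * e n)
      (g := fun n => (starRingEnd ℂ) ((ψ n : ℂ) * e n)) hs hs'
  have hterm : ∀ t v, ((ψ (t + v) : ℂ) * e (t + v)) * (starRingEnd ℂ) ((ψ v : ℂ) * e v)
      = e t * ((ψ (t + v) * ψ v : ℝ) : ℂ) := fun t v => by
    have : e v * (starRingEnd ℂ) (e v) = 1 := by
      rw [Complex.mul_conj, Complex.normSq_eq_norm_sq, hen]
      simp
    rw [hadd, map_mul, Complex.conj_ofReal]
    push_cast
    linear_combination (ψ (t + v) : ℂ) * e t * ψ v * this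
  calc ∑' t : ℤ, e t * (maCov ψ t : ℂ)
      = ∑' t : ℤ, ∑' v : ℤ, ((ψ (t + v) : ℂ) * e (t + v)) *
          (starRingEnd ℂ) ((ψ v : ℂ) * e v) := by
        refine tsum_congr fun t => ?_
        simp only [hterm]
        rw [tsum_mul_left, maCov_eq, Complex.ofReal_tsum]
    _ = ∑' z : ℤ × ℤ, ((ψ z.1 : ℂ) * e z.1) * (starRingEnd ℂ) ((ψ z.2 : ℂ) * e z.2) :=
        tsum_shear hprod
    _ = (∑' n, (ψ n : ℂ) * e n) * ∑' n, (starRingEnd ℂ) ((ψ n : ℂ) * e n) :=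
        (tsum_mul_tsum_of_summable_norm hs hs').symm
    _ = _ := by
        rw [← Complex.conj_tsum, Complex.mul_conj, Complex.normSq_eq_norm_sq]

theorem tsum_exp_mul_maCov {ψ : ℤ → ℝ} (hψ : Summable fun n => |ψ n|) (lam : ℝ) :
    ∑' t : ℤ, Complex.exp (-(Complex.I * (lam : ℂ) * (t : ℂ))) * (maCov ψ t : ℂ)
      = ((‖∑' n : ℤ, (ψ n : ℂ) * Complex.exp (-(Complex.I * (lam : ℂ))) ^ n‖ ^ 2 : ℝ) : ℂ) := by
  simp only [← exp_neg_I_zpow]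
  refine tsum_mul_maCov hψ (fun t => ?_) fun t v => zpow_add₀ (Complex.exp_ne_zero _) t v
  rw [exp_neg_I_zpow, norm_exp_neg_I_mul]

theorem tsum_exp_mul_of_even {g : ℤ → ℝ} (hg : Summable fun t => |g t|) (heven : ∀ t, g (-t) = g t)
    (lam : ℝ) : ∑' t : ℤ, Complex.exp (-(Complex.I * (lam : ℂ) * (t : ℂ))) * (g t : ℂ)
      = ((∑' t : ℤ, g t * Real.cos (t * lam) : ℝ) : ℂ) := by
  have hs := summable_exp_mul hg lam
  have hs' : Summable fun t : ℤ => Complex.exp (Complex.I * (lam : ℂ) * (t : ℂ)) * (g t : ℂ) := by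
    refine (((Equiv.neg ℤ).summable_iff).2 hs).congr fun t => ?_
    simp [heven]
  have h1 : ∑' t : ℤ, Complex.exp (-(Complex.I * (lam : ℂ) * (t : ℂ))) * (g t : ℂ)
      = ∑' t : ℤ, Complex.exp (Complex.I * (lam : ℂ) * (t : ℂ)) * (g t : ℂ) := by
    rw [← (Equiv.neg ℤ).tsum_eq]
    exact tsum_congr fun t => by simp [heven]
  have h2 : ∀ t : ℤ, ((g t * Real.cos (t * lam) : ℝ) : ℂ)
      = (1 / 2) * (Complex.exp (-(Complex.I * (lam : ℂ) * (t : ℂ))) * (g t : ℂ) +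
          Complex.exp (Complex.I * (lam : ℂ) * (t : ℂ)) * (g t : ℂ)) := fun t => by
    push_cast
    rw [Complex.cos]
    rw [show (t : ℂ) * lam * Complex.I = Complex.I * lam * t by ring,
      show -((t : ℂ) * lam) * Complex.I = -(Complex.I * lam * t) by ring]
    ring
  rw [Complex.ofReal_tsum]
  simp only [h2]
  rw [tsum_mul_left, hs.tsum_add hs', ← h1]
  ring

theorem aeval_eq_one_sub_sum {q : Polynomial ℝ} (h0 : q.coeff 0 = 1) {p : ℕ}
    (hp : q.natDegree ≤ p) (z : ℂ) : Polynomial.aeval z q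
      = 1 - ∑ j : Fin p, ((-q.coeff ((j : ℕ) + 1) : ℝ) : ℂ) * z ^ ((j : ℕ) + 1) := by
  rw [Polynomial.aeval_eq_sum_range' (n := p + 1) (by omega), Finset.sum_range_succ', h0,
    Finset.sum_range]
  simp only [Complex.ofReal_neg, neg_mul, Finset.sum_neg_distrib, Complex.real_smul]
  simp
  ring

/-- Finitely many spectral densities can be approximated simultaneously by spectral densities
of causal autoregressions of a common order. -/
theorem exists_linearField_near (L : ℕ) (g : ℕ → ℤ → ℝ) (hg : ∀ l, Summable fun t => |g l t|)
    (heven : ∀ l t, g l (-t) = g l t)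
    (hpos : ∀ l, ∀ s : ℝ, 0 ≤ ∑' t : ℤ, g l t * Real.cos (t * s)) {δ : ℝ} (hδ : 0 < δ) :
    ∃ (C : ℕ → ℝ) (ψ : ℕ → ℤ → ℝ), (∀ l, 0 ≤ C l) ∧ (∀ l, Summable fun n => |ψ l n|) ∧
      IsCausalBandLimitedSPHAR seedLaw (linearField L C ψ) ∧
      ∀ l ≤ L, ∀ lam : ℝ, ‖∑' t : ℤ, Complex.exp (-(Complex.I * (lam : ℂ) * (t : ℂ))) *
        ((C l * maCov (ψ l) t - g l t : ℝ) : ℂ)‖ ≤ δ := by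
  choose q σ hq0 hσ hq hnear using fun l => exists_ar_near (g l) (hg l) (hpos l) hδ
  -- All degrees must share one order; polynomials of smaller degree are padded with zero
  -- coefficients.
  set p := (Finset.range (L + 1)).sup fun l => (q l).natDegree with hp
  have hdeg : ∀ l ≤ L, (q l).natDegree ≤ p := fun l hl =>
    Finset.le_sup (f := fun l => (q l).natDegree) (Finset.mem_range.2 (by omega))
  set φ : ℕ → ℕ → ℝ := fun l j => if l ≤ L then -(q l).coeff (j + 1) else 0 with hφdef
  have hφ : ∀ l, ∀ z : ℂ, ‖z‖ ≤ 1 →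
      1 - ∑ j : Fin p, (φ l j : ℂ) * z ^ ((j : ℕ) + 1) ≠ 0 := by
    intro l z hz
    by_cases hl : l ≤ L
    · simp only [hφdef, if_pos hl]
      rw [← aeval_eq_one_sub_sum (hq0 l) (hdeg l hl)]
      exact hq l z hz
    · simp [hφdef, if_neg hl]
  choose ψ hψ hrec using fun l => exists_ma_coeff p (φ l) (hφ l)
  refine ⟨fun l => if l ≤ L then σ l else 0, ψ, fun l => ?_, hψ,
    isCausalBandLimitedSPHAR_linearField hφ hψ hrec (fun l => ?_) fun l hl => ?_,
    fun l hl lam => ?_⟩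
  · dsimp only; split_ifs; exacts [hσ l, le_rfl]
  · split_ifs; exacts [hσ l, le_rfl]
  · simp [not_le.2 hl]
  · simp only [if_pos hl]
    have hm := summable_maCov (hψ l)
    have hm' : Summable fun t => |σ l * maCov (ψ l) t| := by
      simp only [abs_mul]
      exact hm.mul_left _
    have hw : ‖Complex.exp (-(Complex.I * (lam : ℂ)))‖ = 1 := by
      simpa using norm_exp_neg_I_mul lam 1
    have h1 := tsum_ma_mul_ar (hψ l) (hrec l) hw
    have h2 : (1 - ∑ j : Fin p, (φ l j : ℂ) * Complex.exp (-(Complex.I * (lam : ℂ))) ^ ((j : ℕ) + 1))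
        = Polynomial.aeval (Complex.exp (-(Complex.I * (lam : ℂ)))) (q l) := by
      simp only [hφdef, if_pos hl]
      rw [← aeval_eq_one_sub_sum (hq0 l) (hdeg l hl)]
    rw [h2] at h1
    have h3 : ∑' t : ℤ, Complex.exp (-(Complex.I * (lam : ℂ) * (t : ℂ))) *
        ((σ l * maCov (ψ l) t : ℝ) : ℂ) = ((σ l /
          ‖(Polynomial.aeval (Complex.exp (-(Complex.I * lam))) (q l) : ℂ)‖ ^ 2 : ℝ) : ℂ) := by
      have : ∀ t : ℤ, Complex.exp (-(Complex.I * (lam : ℂ) * (t : ℂ))) *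
        ((σ l * maCov (ψ l) t : ℝ) : ℂ) = (σ l : ℂ) *
          (Complex.exp (-(Complex.I * (lam : ℂ) * (t : ℂ))) * (maCov (ψ l) t : ℂ)) := fun t => by
        push_cast; ring
      simp only [this]
      rw [tsum_mul_left, tsum_exp_mul_maCov (hψ l), ← Complex.ofReal_mul,
        eq_inv_of_mul_eq_one_left h1, norm_inv, inv_pow, div_eq_mul_inv]
    simp only [Complex.ofReal_sub, mul_sub]
    rw [(summable_exp_mul hm' lam).tsum_sub (summable_exp_mul (hg l) lam), h3,
      tsum_exp_mul_of_even (hg l) (heven l), ← Complex.ofReal_sub, Complex.norm_real]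
    exact hnear l lam

/-! ### Isotropic kernels are functions of the angle -/

theorem det_trans (g h : E3 ≃ₗᵢ[ℝ] E3) :
    LinearMap.det ((g.trans h).toLinearEquiv : E3 →ₗ[ℝ] E3)
      = LinearMap.det (h.toLinearEquiv : E3 →ₗ[ℝ] E3) *
        LinearMap.det (g.toLinearEquiv : E3 →ₗ[ℝ] E3) := by
  rw [← LinearMap.det_comp]
  rfl

theorem exists_reflection_fix (x y : E3) : ∃ n : E3, n ≠ 0 ∧ inner ℝ n x = 0 ∧ inner ℝ n y = 0 := by
  have h : (Submodule.span ℝ ({x, y} : Set E3))ᗮ ≠ ⊥ := by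
    intro h
    rw [Submodule.orthogonal_eq_bot_iff] at h
    classical
    have h1 := finrank_span_finset_le_card (R := ℝ) ({x, y} : Finset E3)
    have h2 : ({x, y} : Finset E3).card ≤ 2 := Finset.card_le_two
    rw [Finset.coe_insert, Finset.coe_singleton, Set.finrank, h, finrank_top, finrank_euclideanSpace_fin] at h1
    omega
  obtain ⟨n, hn, h0⟩ := Submodule.exists_mem_ne_zero_of_ne_bot h
  rw [Submodule.mem_orthogonal'] at hn
  exact ⟨n, h0, hn _ (Submodule.subset_span (by simp)), hn _ (Submodule.subset_span (by simp))⟩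

/-- The reflection in the plane orthogonal to `v`. -/
def planeReflection (v : E3) : E3 ≃ₗᵢ[ℝ] E3 := (Submodule.span ℝ {v})ᗮ.reflection

theorem planeReflection_fix {v x : E3} (h : inner ℝ v x = 0) : planeReflection v x = x :=
  Submodule.reflection_mem_subspace_eq_self (Submodule.mem_orthogonal_singleton_iff_inner_right.2 h)

theorem det_planeReflection (v : E3) :
    LinearMap.det ((planeReflection v).toLinearEquiv : E3 →ₗ[ℝ] E3)
      = (-1) ^ Module.finrank ℝ (Submodule.span ℝ {v})ᗮᗮ :=
  Submodule.det_reflection _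

theorem det_planeReflection_of_ne {v : E3} (hv : v ≠ 0) :
    LinearMap.det ((planeReflection v).toLinearEquiv : E3 →ₗ[ℝ] E3) = -1 := by
  rw [det_planeReflection, Submodule.orthogonal_orthogonal, finrank_span_singleton hv, pow_one]

/-- Rotations act transitively on pairs of points with a given angle. -/
theorem exists_rotation {x y x' y' : S2}
    (h : inner ℝ (x : E3) (y : E3) = inner ℝ (x' : E3) (y' : E3)) :
    ∃ g : E3 ≃ₗᵢ[ℝ] E3, IsRotation g ∧ rotate g x = x' ∧ rotate g y = y' := by
  -- One reflection takes `x` to `x'`. A second one corrects the image of `y` and fixes `x'`,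
  -- because the angles agree.
  set A := planeReflection ((x : E3) - x') with hA
  have hAx : A x = x' := Submodule.reflection_sub (by rw [norm_eq_of_mem_sphere, norm_eq_of_mem_sphere])
  set B := planeReflection (A y - y') with hB
  have hBy : B (A y) = y' :=
    Submodule.reflection_sub (by rw [A.norm_map, norm_eq_of_mem_sphere, norm_eq_of_mem_sphere])
  have hBx : B x' = x' := by
    refine planeReflection_fix ?_
    rw [inner_sub_left, ← hAx, A.inner_map_map, real_inner_comm, h, hAx, real_inner_comm, sub_self]
  have hGx : (A.trans B) x = x' := by rw [LinearIsometryEquiv.trans_apply, hAx, hBx]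
  have hGy : (A.trans B) y = y' := by rw [LinearIsometryEquiv.trans_apply, hBy]
  have hdet : LinearMap.det ((A.trans B).toLinearEquiv : E3 →ₗ[ℝ] E3) = 1 ∨
      LinearMap.det ((A.trans B).toLinearEquiv : E3 →ₗ[ℝ] E3) = -1 := by
    rw [det_trans, hA, hB, det_planeReflection, det_planeReflection, ← pow_add]
    exact neg_one_pow_eq_or ℝ _
  rcases hdet with hdet | hdet
  · exact ⟨A.trans B, hdet, Subtype.ext hGx, Subtype.ext hGy⟩
  -- A wrong orientation is repaired by a further reflection in a plane containing both targets; it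
  -- exists as two vectors cannot span three-space.
  · obtain ⟨n, hn0, hnx, hny⟩ := exists_reflection_fix (x' : E3) (y' : E3)
    refine ⟨(A.trans B).trans (planeReflection n), ?_, Subtype.ext ?_, Subtype.ext ?_⟩
    · rw [IsRotation, det_trans, hdet, det_planeReflection_of_ne hn0]
      norm_num
    · change planeReflection n ((A.trans B) x) = x'
      rw [hGx, planeReflection_fix hnx]
    · change planeReflection n ((A.trans B) y) = y'
      rw [hGy, planeReflection_fix hny]

/-- The point at angle `arccos c` from the pole. -/
def anglePoint (c : ℝ) : S2 :=
  ⟨!₂[max (-1) (min 1 c), √(1 - max (-1) (min 1 c) ^ 2), 0], by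
    have h : max (-1) (min 1 c) ^ 2 ≤ 1 := by
      rw [sq_le_one_iff_abs_le_one, abs_le]
      exact ⟨le_max_left _ _, max_le (by norm_num) (min_le_left _ _)⟩
    rw [mem_sphere_zero_iff_norm, EuclideanSpace.norm_eq]
    simp [Fin.sum_univ_three, Real.sq_sqrt (sub_nonneg.2 h)]⟩

theorem continuous_anglePoint : Continuous anglePoint := by
  refine Continuous.subtype_mk ((PiLp.continuous_toLp 2 _).comp (continuous_pi fun i => ?_)) _
  fin_cases i
  · simp; fun_prop
  · simp; fun_prop
  · simp; fun_prop

theorem inner_pole_anglePoint {c : ℝ} (hc : c ∈ Set.Icc (-1 : ℝ) 1) :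
    inner ℝ (pole : E3) (anglePoint c : E3) = c := by
  simp [pole, anglePoint, EuclideanSpace.inner_single_left, min_eq_right hc.2, max_eq_right hc.1]

section

variable {Ω : Type*} [MeasurableSpace Ω] {μ : Measure Ω} {T : S2 → ℤ → Ω → ℝ}

/-- The autocovariance as a function of the cosine of the angle. -/
def angularCov (μ : Measure Ω) (T : S2 → ℤ → Ω → ℝ) (t : ℤ) (c : ℝ) : ℝ :=
  covKernel μ T t pole (anglePoint c)

theorem covKernel_eq_angularCov (hT : IsIsotropicStationary μ T) (t : ℤ) (x y : S2) :
    covKernel μ T t x y = angularCov μ T t (inner ℝ (x : E3) (y : E3)) := by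
  obtain ⟨g, hg, hx, hy⟩ := exists_rotation (x := x) (y := y) (x' := pole)
    (y' := anglePoint (inner ℝ (x : E3) (y : E3))) (inner_pole_anglePoint (inner_mem_Icc x y)).symm
  have := hT.invariant g hg x y t 0 0
  rw [hx, hy, add_zero, add_zero] at this
  exact this

/-- Continuity holds on the whole line, as required by `funk_hecke`, because `anglePoint` clamps its
argument to `[-1, 1]`. -/
theorem continuous_angularCov (hc : HasContinuousCov μ T) (t : ℤ) :
    Continuous (angularCov μ T t) :=
  (hc t).comp (continuous_const.prodMk continuous_anglePoint)

theorem covCont_eq_zonalKer (hT : IsIsotropicStationary μ T) (hc : HasContinuousCov μ T) (t : ℤ) :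
    covCont hc t = zonalKer (angularCov μ T t) (continuous_angularCov hc t) := by
  ext z
  change ((covKernel μ T t z.1 z.2 : ℝ) : ℂ) = _
  rw [covKernel_eq_angularCov hT]
  rfl

theorem integral_mul_eq_covKernel (hT : IsIsotropicStationary μ T) (x y : S2) (t s : ℤ) :
    ∫ ω, T x t ω * T y s ω ∂μ = covKernel μ T (t - s) x y := by
  have hid : IsRotation (LinearIsometryEquiv.refl ℝ E3) := LinearMap.det_id
  have := hT.invariant _ hid x y t s (-s)
  rw [add_neg_cancel] at this
  exact this

/-- Stationarity exchanges time reversal for swapping the two points, and the angle does not see the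
swap. Hence the angular spectral densities are real cosine series. -/
theorem angularCov_neg (hT : IsIsotropicStationary μ T) (t : ℤ) :
    angularCov μ T (-t) = angularCov μ T t := by
  funext c
  have h1 : covKernel μ T (-t) pole (anglePoint c) = covKernel μ T t (anglePoint c) pole := by
    rw [← sub_zero t, ← integral_mul_eq_covKernel hT, neg_sub,
      ← integral_mul_eq_covKernel hT]
    simp only [mul_comm]
  unfold angularCov
  rw [h1, covKernel_eq_angularCov hT, covKernel_eq_angularCov hT, real_inner_comm]

/-- The eigenvalue of the autocovariance operator on the harmonics of degree `l`. -/
def angularSpec (μ : Measure Ω) (T : S2 → ℤ → Ω → ℝ) (l : ℕ) (t : ℤ) : ℝ :=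
  fhCoeff (angularCov μ T t) l

theorem angularSpec_neg (hT : IsIsotropicStationary μ T) (l : ℕ) (t : ℤ) :
    angularSpec μ T l (-t) = angularSpec μ T l t := by
  rw [angularSpec, angularCov_neg hT, angularSpec]

end

/-! ### Nonnegativity of the angular spectral densities -/

/-- The increments of the double sums `u N` are the symmetric partial sums of `h`, so by Cesàro `u N
/ N` tends to the total sum and is nonnegative. -/
theorem tsum_nonneg_of_sum_sub_nonneg {h : ℤ → ℝ} (hs : Summable h)
    (hp : ∀ N : ℕ, 0 ≤ ∑ t ∈ Finset.range N, ∑ s ∈ Finset.range N, h ((t : ℤ) - s)) :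
    0 ≤ ∑' k, h k := by
  set u : ℕ → ℝ := fun N => ∑ t ∈ Finset.range N, ∑ s ∈ Finset.range N, h ((t : ℤ) - s) with hu
  have hdiff : ∀ N, u (N + 1) - u N = ∑ i ∈ Finset.range (N + 1), h (i : ℤ) +
      ∑ i ∈ Finset.range N, h (-((i : ℤ) + 1)) := by
    intro N
    have h1 : ∑ i ∈ Finset.range (N + 1), h (i : ℤ)
        = ∑ s ∈ Finset.range (N + 1), h ((N : ℤ) - s) := by
      rw [← Finset.sum_range_reflect]
      refine Finset.sum_congr rfl fun i hi => ?_
      have := Finset.mem_range.1 hi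
      congr 1
      omega
    have h2 : ∑ i ∈ Finset.range N, h (-((i : ℤ) + 1))
        = ∑ t ∈ Finset.range N, h ((t : ℤ) - N) := by
      rw [← Finset.sum_range_reflect]
      refine Finset.sum_congr rfl fun i hi => ?_
      have := Finset.mem_range.1 hi
      congr 1
      omega
    simp only [hu]
    rw [Finset.sum_range_succ, h1, h2]
    simp only [Finset.sum_range_succ _ N, Finset.sum_add_distrib]
    ring
  have hnat : Summable fun n : ℕ => h n := hs.comp_injective Nat.cast_injective
  have hneg : Summable fun n : ℕ => h (-((n : ℤ) + 1)) :=
    hs.comp_injective (i := fun n : ℕ => -((n : ℤ) + 1)) fun a b hab => by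
      simp only at hab
      omega
  have hlim : Tendsto (fun N => u (N + 1) - u N) atTop (𝓝 (∑' k, h k)) := by
    rw [tsum_of_nat_of_neg_add_one hnat hneg]
    simp only [hdiff]
    exact (hnat.hasSum.tendsto_sum_nat.comp (tendsto_add_atTop_nat 1)).add
      hneg.hasSum.tendsto_sum_nat
  have hces := hlim.cesaro
  simp only [Finset.sum_range_sub] at hces
  refine ge_of_tendsto' hces fun N => mul_nonneg (by positivity) ?_
  simpa [hu] using hp N

/-- The zonal harmonic coefficient of degree `l` of the field at time `t`. -/
def zonalCoeff {Ω : Type*} (T : S2 → ℤ → Ω → ℝ) (l : ℕ) (t : ℤ) (ω : Ω) : ℝ :=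
  ∫ x : S2, (legendre l).eval (inner ℝ (x : E3) (pole : E3)) * T x t ω ∂surf

theorem zonalCoeff_mul {Ω : Type*} (T : S2 → ℤ → Ω → ℝ) (l : ℕ) (t s : ℤ) (ω : Ω) :
    zonalCoeff T l t ω * zonalCoeff T l s ω = ∫ z : S2 × S2,
      ((legendre l).eval (inner ℝ (z.1 : E3) (pole : E3)) * T z.1 t ω) *
      ((legendre l).eval (inner ℝ (z.2 : E3) (pole : E3)) * T z.2 s ω) ∂(surf.prod surf) :=
  (integral_prod_mul (fun x : S2 => (legendre l).eval (inner ℝ (x : E3) (pole : E3)) * T x t ω)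
    fun x : S2 => (legendre l).eval (inner ℝ (x : E3) (pole : E3)) * T x s ω).symm

section

variable {Ω : Type*} [MeasurableSpace Ω] {μ : Measure Ω} {T : S2 → ℤ → Ω → ℝ}

theorem integral_sq_eq (hT : IsIsotropicStationary μ T) (x : S2) (t : ℤ) :
    ∫ ω, T x t ω ^ 2 ∂μ = angularCov μ T 0 1 := by
  simp only [sq]
  rw [integral_mul_eq_covKernel hT, sub_self, covKernel_eq_angularCov hT, inner_self_sphere]

/-- The variance is the same at every point and time; this uniform bound is what justifies Fubini
for the harmonic coefficients. -/
theorem integral_abs_mul_le (hT : IsIsotropicStationary μ T) (x y : S2) (t s : ℤ) :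
    ∫ ω, |T x t ω * T y s ω| ∂μ ≤ angularCov μ T 0 1 := by
  have hi : ∀ x t, Integrable (fun ω => T x t ω ^ 2) μ := fun x t => (hT.memLp x t).integrable_sq
  calc ∫ ω, |T x t ω * T y s ω| ∂μ ≤ ∫ ω, (1 / 2 * T x t ω ^ 2 + 1 / 2 * T y s ω ^ 2) ∂μ := by
        refine integral_mono ((hT.memLp x t).integrable_mul (hT.memLp y s)).abs
          (((hi x t).const_mul _).add ((hi y s).const_mul _)) fun ω => ?_
        rw [abs_le]
        constructor <;> nlinarith [sq_nonneg (T x t ω + T y s ω), sq_nonneg (T x t ω - T y s ω)]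
    _ = angularCov μ T 0 1 := by
        rw [integral_add ((hi x t).const_mul _) ((hi y s).const_mul _), integral_const_mul,
          integral_const_mul, integral_sq_eq hT, integral_sq_eq hT]
        ring

theorem integrable_zonal_mul [IsProbabilityMeasure μ] (hT : IsIsotropicStationary μ T) (l : ℕ)
    (t s : ℤ) : Integrable (fun z : Ω × (S2 × S2) =>
      ((legendre l).eval (inner ℝ (z.2.1 : E3) (pole : E3)) * T z.2.1 t z.1) *
      ((legendre l).eval (inner ℝ (z.2.2 : E3) (pole : E3)) * T z.2.2 s z.1))
      (μ.prod (surf.prod surf)) := by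
  obtain ⟨M, hM0, hM⟩ := exists_legendre_bound l
  have hP : Measurable fun x : S2 => (legendre l).eval (inner ℝ (x : E3) (pole : E3)) :=
    (continuous_legendre_inner' l pole).measurable
  have hm : Measurable (fun z : Ω × (S2 × S2) =>
      ((legendre l).eval (inner ℝ (z.2.1 : E3) (pole : E3)) * T z.2.1 t z.1) *
      ((legendre l).eval (inner ℝ (z.2.2 : E3) (pole : E3)) * T z.2.2 s z.1)) := by
    have h1 : Measurable fun z : Ω × (S2 × S2) => T z.2.1 t z.1 :=
      (hT.measurable t).comp ((measurable_fst.comp measurable_snd).prodMk measurable_fst)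
    have h2 : Measurable fun z : Ω × (S2 × S2) => T z.2.2 s z.1 :=
      (hT.measurable s).comp ((measurable_snd.comp measurable_snd).prodMk measurable_fst)
    exact ((hP.comp (measurable_fst.comp measurable_snd)).mul h1).mul
      ((hP.comp (measurable_snd.comp measurable_snd)).mul h2)
  rw [integrable_prod_iff' hm.aestronglyMeasurable]
  constructor
  · refine Eventually.of_forall fun z => ?_
    have := ((hT.memLp z.1 t).const_mul ((legendre l).eval (inner ℝ (z.1 : E3) (pole : E3)))).integrable_mul
      ((hT.memLp z.2 s).const_mul ((legendre l).eval (inner ℝ (z.2 : E3) (pole : E3))))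
    exact this
  · refine Integrable.of_bound (C := M * M * angularCov μ T 0 1)
      (hm.norm.stronglyMeasurable.integral_prod_left').aestronglyMeasurable
      (Eventually.of_forall fun z => ?_)
    rw [Real.norm_eq_abs, abs_of_nonneg (integral_nonneg fun _ => norm_nonneg _)]
    have e : ∀ ω, ‖((legendre l).eval (inner ℝ (z.1 : E3) (pole : E3)) * T z.1 t ω) *
      ((legendre l).eval (inner ℝ (z.2 : E3) (pole : E3)) * T z.2 s ω)‖
        = (|(legendre l).eval (inner ℝ (z.1 : E3) (pole : E3))| *
          |(legendre l).eval (inner ℝ (z.2 : E3) (pole : E3))|) * |T z.1 t ω * T z.2 s ω| := by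
      intro ω
      simp only [Real.norm_eq_abs, abs_mul]
      ring
    simp only [e]
    rw [integral_const_mul]
    exact mul_le_mul (mul_le_mul (hM _ (inner_mem_Icc _ _)) (hM _ (inner_mem_Icc _ _))
      (abs_nonneg _) hM0) (integral_abs_mul_le hT _ _ _ _)
      (integral_nonneg fun _ => abs_nonneg _) (mul_nonneg hM0 hM0)

theorem integrable_zonalCoeff_mul [IsProbabilityMeasure μ] (hT : IsIsotropicStationary μ T) (l : ℕ)
    (t s : ℤ) : Integrable (fun ω => zonalCoeff T l t ω * zonalCoeff T l s ω) μ := by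
  simp only [zonalCoeff_mul]
  exact (integrable_zonal_mul hT l t s).integral_prod_left

/-- By Fubini this is a double integral of the covariance kernel against two zonal harmonics;
Funk-Hecke evaluates the inner one and Legendre convolution the outer one. It exhibits `angularSpec`
as a scalar autocovariance up to a positive factor. -/
theorem integral_zonalCoeff_mul [IsProbabilityMeasure μ] (hT : IsIsotropicStationary μ T)
    (hc : HasContinuousCov μ T) (l : ℕ) (t s : ℤ) :
    ∫ ω, zonalCoeff T l t ω * zonalCoeff T l s ω ∂μ
      = 4 * Real.pi / (2 * l + 1) * angularSpec μ T l (t - s) := by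
  have hκ := continuous_angularCov hc (t - s)
  simp only [zonalCoeff_mul]
  rw [integral_integral_swap (integrable_zonal_mul hT l t s)]
  have e : ∀ z : S2 × S2, ∫ ω, ((legendre l).eval (inner ℝ (z.1 : E3) (pole : E3)) * T z.1 t ω) *
      ((legendre l).eval (inner ℝ (z.2 : E3) (pole : E3)) * T z.2 s ω) ∂μ
      = (legendre l).eval (inner ℝ (z.1 : E3) (pole : E3)) *
        (angularCov μ T (t - s) (inner ℝ (z.1 : E3) (z.2 : E3)) *
        (legendre l).eval (inner ℝ (z.2 : E3) (pole : E3))) := by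
    intro z
    rw [← covKernel_eq_angularCov hT, ← integral_mul_eq_covKernel hT, mul_comm (∫ ω, _ ∂μ),
      ← mul_assoc, ← integral_const_mul]
    refine integral_congr_ae (Eventually.of_forall fun ω => ?_)
    ring
  simp only [e]
  have hcont : Continuous fun z : S2 × S2 => (legendre l).eval (inner ℝ (z.1 : E3) (pole : E3)) *
        (angularCov μ T (t - s) (inner ℝ (z.1 : E3) (z.2 : E3)) *
        (legendre l).eval (inner ℝ (z.2 : E3) (pole : E3))) :=
    ((continuous_legendre_inner' l pole).comp continuous_fst).mul
      ((hκ.comp (by fun_prop)).mul ((continuous_legendre_inner' l pole).comp continuous_snd))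
  rw [integral_prod _ (hcont.integrable_of_hasCompactSupport (HasCompactSupport.of_compactSpace _))]
  simp only [integral_const_mul]
  simp only [funk_hecke hκ]
  have h1 := integral_legendre_mul_legendre l l pole pole
  rw [if_pos rfl, inner_self_sphere, legendre_eval_one, mul_one] at h1
  rw [← h1, ← integral_mul_const]
  refine integral_congr_ae (Eventually.of_forall fun x => ?_)
  simp only [angularSpec, real_inner_comm (x : E3) (pole : E3)]
  ring

theorem sum_angularSpec_mul_cos_nonneg [IsProbabilityMeasure μ] (hT : IsIsotropicStationary μ T)
    (hc : HasContinuousCov μ T) (l : ℕ) (lam : ℝ) (N : ℕ) :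
    0 ≤ ∑ t ∈ Finset.range N, ∑ s ∈ Finset.range N,
      angularSpec μ T l ((t : ℤ) - s) * Real.cos (((t : ℤ) - s : ℤ) * lam) := by
  have hsq : ∀ a : ℕ → ℝ, 0 ≤ ∑ t ∈ Finset.range N, ∑ s ∈ Finset.range N,
      a t * a s * (4 * Real.pi / (2 * l + 1) * angularSpec μ T l ((t : ℤ) - s)) := by
    intro a
    have : ∑ t ∈ Finset.range N, ∑ s ∈ Finset.range N,
        a t * a s * (4 * Real.pi / (2 * l + 1) * angularSpec μ T l ((t : ℤ) - s))
        = ∫ ω, (∑ t ∈ Finset.range N, a t * zonalCoeff T l t ω) ^ 2 ∂μ := by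
      have e : ∀ ω, (∑ t ∈ Finset.range N, a t * zonalCoeff T l t ω) ^ 2
          = ∑ t ∈ Finset.range N, ∑ s ∈ Finset.range N,
            a t * a s * (zonalCoeff T l t ω * zonalCoeff T l s ω) := by
        intro ω
        rw [sq, Finset.sum_mul_sum]
        refine Finset.sum_congr rfl fun t _ => Finset.sum_congr rfl fun s _ => ?_
        ring
      simp only [e]
      have hi : ∀ t s : ℕ, Integrable (fun ω => a t * a s *
          (zonalCoeff T l t ω * zonalCoeff T l s ω)) μ := fun t s =>
        (integrable_zonalCoeff_mul hT l t s).const_mul _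
      rw [integral_finsetSum _ fun t _ => integrable_finsetSum _ fun s _ => hi t s]
      refine Finset.sum_congr rfl fun t _ => ?_
      rw [integral_finsetSum _ fun s _ => hi t s]
      refine Finset.sum_congr rfl fun s _ => ?_
      rw [integral_const_mul, integral_zonalCoeff_mul hT hc]
    rw [this]
    exact integral_nonneg fun _ => sq_nonneg _
  -- The addition formula for the cosine combines the two real quadratic forms into the required
  -- one, avoiding complex weights.
  have h := add_nonneg (hsq fun t => Real.cos (t * lam)) (hsq fun t => Real.sin (t * lam))
  have hpos : 0 < 4 * Real.pi / (2 * (l : ℝ) + 1) := by positivity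
  refine nonneg_of_mul_nonneg_right (h.trans_eq ?_) hpos
  rw [← Finset.sum_add_distrib, Finset.mul_sum]
  refine Finset.sum_congr rfl fun t _ => ?_
  rw [← Finset.sum_add_distrib, Finset.mul_sum]
  refine Finset.sum_congr rfl fun s _ => ?_
  push_cast
  rw [sub_mul, Real.cos_sub]
  ring

theorem tsum_angularSpec_mul_cos_nonneg [IsProbabilityMeasure μ] (hT : IsIsotropicStationary μ T)
    (hc : HasContinuousCov μ T) (l : ℕ) (hs : Summable fun t => |angularSpec μ T l t|) (lam : ℝ) :
    0 ≤ ∑' t : ℤ, angularSpec μ T l t * Real.cos (t * lam) := by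
  refine tsum_nonneg_of_sum_sub_nonneg (h := fun t => angularSpec μ T l t * Real.cos (t * lam))
    (Summable.of_norm_bounded hs fun t => ?_) (sum_angularSpec_mul_cos_nonneg hT hc l lam)
  rw [norm_mul, Real.norm_eq_abs, Real.norm_eq_abs]
  exact mul_le_of_le_one_right (abs_nonneg _) (Real.abs_cos_le_one _)

end

/-! ### Truncation of isotropic kernels -/

/-- A continuous kernel as a square-integrable kernel. -/
def kerL2 (K : C(S2 × S2, ℂ)) : L2SS := ContinuousMap.toLp 2 (surf.prod surf) ℂ K

theorem inner_kerL2 (K₁ K₂ : C(S2 × S2, ℂ)) :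
    inner ℂ (kerL2 K₁) (kerL2 K₂) = ∫ x, ∫ y, K₂ (x, y) * star (K₁ (x, y)) ∂surf ∂surf := by
  unfold kerL2
  rw [ContinuousMap.inner_toLp, integral_prod]
  · rfl
  · have : Continuous fun z => K₂ z * (starRingEnd ℂ) (K₁ z) := by fun_prop
    exact this.integrable_of_hasCompactSupport (HasCompactSupport.of_compactSpace _)

theorem integral_legKer_diag (l : ℕ) : ∫ x, legKer l (x, x) ∂surf = 2 * l + 1 := by
  simp only [legKer_apply, inner_self_sphere, legendre_eval_one]
  rw [integral_const, surf_real_univ, Complex.real_smul]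
  have := Real.pi_ne_zero
  rw [← Complex.ofReal_mul, show 4 * Real.pi * ((2 * (l : ℝ) + 1) / (4 * Real.pi) * 1) = 2 * l + 1 by
    field_simp]
  push_cast
  ring

theorem inner_legKer_zonalKer {κ : ℝ → ℝ} (hκ : Continuous κ) (l : ℕ) :
    inner ℂ (kerL2 (legKer l)) (kerL2 (zonalKer κ hκ)) = (fhCoeff κ l : ℂ) * (2 * l + 1) := by
  rw [inner_kerL2]
  simp only [star_legKer, integral_zonalKer_mul_legKer]
  rw [integral_const_mul, integral_legKer_diag]

theorem inner_legKer_legKer (l l' : ℕ) : inner ℂ (kerL2 (legKer l)) (kerL2 (legKer l'))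
    = if l' = l then (2 * (l : ℂ) + 1) else 0 := by
  rw [inner_kerL2]
  simp only [star_legKer, integral_legKer_mul_legKer]
  split_ifs with h
  · rw [h, integral_legKer_diag]
  · simp

/-- Pairing with `legKer l` returns `2 l + 1 ≥ 1` times the eigenvalue. With fixed `l` this
transfers summability over time from kernels to eigenvalues. -/
theorem abs_fhCoeff_le_norm_kerL2 {κ : ℝ → ℝ} (hκ : Continuous κ) (l : ℕ) :
    |fhCoeff κ l| ≤ ‖kerL2 (legKer l)‖ * ‖kerL2 (zonalKer κ hκ)‖ := by
  have h := norm_inner_le_norm (𝕜 := ℂ) (kerL2 (legKer l)) (kerL2 (zonalKer κ hκ))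
  rw [inner_legKer_zonalKer, norm_mul, Complex.norm_real, Real.norm_eq_abs] at h
  refine le_trans (le_mul_of_one_le_right (abs_nonneg _) ?_) h
  rw [show (2 * (l : ℂ) + 1) = ((2 * l + 1 : ℝ) : ℂ) by push_cast; ring, Complex.norm_real,
    Real.norm_eq_abs, abs_of_pos (by positivity)]
  have : (0 : ℝ) ≤ l := Nat.cast_nonneg l
  linarith

/-- The part of an isotropic kernel of degrees above `L`. -/
def tailL2 (κ : ℝ → ℝ) (hκ : Continuous κ) (L : ℕ) : L2SS :=
  kerL2 (zonalKer κ hκ) - ∑ l ∈ Finset.range (L + 1), (fhCoeff κ l : ℂ) • kerL2 (legKer l)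

theorem inner_tailL2 {κ : ℝ → ℝ} (hκ : Continuous κ) {L l : ℕ} (hl : l ≤ L) :
    inner ℂ (kerL2 (legKer l)) (tailL2 κ hκ L) = 0 := by
  unfold tailL2
  rw [inner_sub_right, inner_legKer_zonalKer, inner_sum]
  simp only [inner_smul_right, inner_legKer_legKer]
  simp only [mul_ite, mul_zero, Finset.sum_ite_eq']
  rw [if_pos (Finset.mem_range.2 (by omega)), sub_self]

/-- Best approximation: the tail is orthogonal to every `legKer l` with `l ≤ L`, so Pythagoras
applies. -/
theorem norm_tailL2_le_of_sum {κ : ℝ → ℝ} (hκ : Continuous κ) (L : ℕ) (a : ℕ → ℂ) :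
    ‖tailL2 κ hκ L‖
      ≤ ‖kerL2 (zonalKer κ hκ) - ∑ l ∈ Finset.range (L + 1), a l • kerL2 (legKer l)‖ := by
  set v := ∑ l ∈ Finset.range (L + 1), ((fhCoeff κ l : ℂ) - a l) • kerL2 (legKer l) with hv
  have e : kerL2 (zonalKer κ hκ) - ∑ l ∈ Finset.range (L + 1), a l • kerL2 (legKer l)
      = v + tailL2 κ hκ L := by
    rw [hv, tailL2]
    simp only [sub_smul, Finset.sum_sub_distrib]
    abel
  have h0 : inner ℂ v (tailL2 κ hκ L) = 0 := by
    rw [hv, sum_inner]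
    refine Finset.sum_eq_zero fun l hl => ?_
    rw [inner_smul_left, inner_tailL2 hκ (by have := Finset.mem_range.1 hl; omega), mul_zero]
  rw [e]
  have h1 := norm_add_sq_eq_norm_sq_add_norm_sq_of_inner_eq_zero v (tailL2 κ hκ L) h0
  nlinarith [norm_nonneg v, norm_nonneg (tailL2 κ hκ L), norm_nonneg (v + tailL2 κ hκ L)]

theorem norm_tailL2_le {κ : ℝ → ℝ} (hκ : Continuous κ) (L : ℕ) :
    ‖tailL2 κ hκ L‖ ≤ ‖kerL2 (zonalKer κ hκ)‖ := by
  simpa using norm_tailL2_le_of_sum hκ L 0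

/-- A polynomial uniformly close to `κ` gives a combination of the `legKer l`, and the tail is at
most the distance to any such combination. -/
theorem tendsto_norm_tailL2 {κ : ℝ → ℝ} (hκ : Continuous κ) :
    Tendsto (fun L => ‖tailL2 κ hκ L‖) atTop (𝓝 0) := by
  obtain ⟨D, hD0, hD⟩ : ∃ D : ℝ, 0 ≤ D ∧ ∀ K, ‖kerL2 K‖ ≤ D * ‖K‖ :=
    ⟨‖(ContinuousMap.toLp 2 (surf.prod surf) ℂ : C(S2 × S2, ℂ) →L[ℂ] L2SS)‖,
      norm_nonneg (ContinuousMap.toLp 2 (surf.prod surf) ℂ : C(S2 × S2, ℂ) →L[ℂ] L2SS),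
      fun K => ContinuousLinearMap.le_opNorm _ K⟩
  rw [Metric.tendsto_atTop]
  intro ε hε
  obtain ⟨p, hp⟩ := exists_polynomial_near_of_continuousOn (-1) 1 κ hκ.continuousOn
    (ε / (D + 1)) (by positivity)
  refine ⟨p.natDegree, fun L hL => ?_⟩
  rw [dist_zero_right, norm_norm]
  obtain ⟨b, hb⟩ := exists_legendre_expansion L p hL
  have e : zonalKer (fun c => p.eval c) p.continuous = ∑ l ∈ Finset.range (L + 1),
      ((b l * (4 * Real.pi / (2 * l + 1)) : ℝ) : ℂ) • legKer l := by
    ext z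
    rw [ContinuousMap.sum_apply]
    simp only [ContinuousMap.smul_apply, smul_eq_mul]
    change ((p.eval (inner ℝ (z.1 : E3) (z.2 : E3)) : ℝ) : ℂ) = _
    have h1 := congrArg (Polynomial.eval (inner ℝ (z.1 : E3) (z.2 : E3))) hb
    rw [Polynomial.eval_finsetSum] at h1
    rw [h1, Complex.ofReal_sum]
    refine Finset.sum_congr rfl fun l _ => ?_
    have h2 : legKer l z = ((2 * l + 1 : ℝ) / (4 * Real.pi) *
        (legendre l).eval (inner ℝ (z.1 : E3) (z.2 : E3)) : ℝ) := rfl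
    rw [h2, ← Complex.ofReal_mul, Polynomial.eval_mul, Polynomial.eval_C]
    congr 1
    have := Real.pi_ne_zero
    have : (2 * (l : ℝ) + 1) ≠ 0 := by positivity
    field_simp
  have e2 : kerL2 (zonalKer (fun c => p.eval c) p.continuous) = ∑ l ∈ Finset.range (L + 1),
      ((b l * (4 * Real.pi / (2 * l + 1)) : ℝ) : ℂ) • kerL2 (legKer l) := by
    rw [e]
    simp only [kerL2, map_sum, map_smul]
  refine (norm_tailL2_le_of_sum hκ L fun l => ((b l * (4 * Real.pi / (2 * l + 1)) : ℝ) : ℂ)).trans_lt ?_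
  rw [← e2, kerL2, kerL2, ← map_sub]
  refine (hD _).trans_lt ?_
  have h2 : ‖zonalKer κ hκ - zonalKer (fun c => p.eval c) p.continuous‖ ≤ ε / (D + 1) := by
    refine (ContinuousMap.norm_le _ (by positivity)).2 fun z => ?_
    change ‖((κ _ : ℝ) : ℂ) - ((p.eval _ : ℝ) : ℂ)‖ ≤ _
    rw [← Complex.ofReal_sub, Complex.norm_real, Real.norm_eq_abs, abs_sub_comm]
    exact (hp _ (inner_mem_Icc z.1 z.2)).le
  calc D * _ ≤ D * (ε / (D + 1)) := by gcongr
    _ < ε := by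
        rw [← mul_div_assoc, div_lt_iff₀ (by positivity)]
        nlinarith

/-- The zonal harmonic at the pole is a nonzero eigenvector. -/
theorem abs_fhCoeff_le_norm_integralOp {κ : ℝ → ℝ} (hκ : Continuous κ) (l : ℕ) :
    |fhCoeff κ l| ≤ ‖integralOp (zonalKer κ hκ)‖ := by
  set s : L2S := ContinuousMap.toLp 2 surf ℂ (kerSection (legKer l) pole) with hs
  have h1 : integralOp (zonalKer κ hκ) s = (fhCoeff κ l : ℂ) • s := by
    rw [hs, ← map_smul]
    exact integralOp_toLp fun x => integral_zonalKer_mul_legKer hκ l x pole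
  have h2 : s ≠ 0 := by
    intro h0
    have h3 : inner ℂ s s = ((2 * l + 1 : ℝ) / (4 * Real.pi) : ℝ) := by
      rw [hs, ContinuousMap.inner_toLp]
      have h4 := integral_legKer_mul_legKer l l pole pole
      rw [if_pos rfl, legKer_apply, inner_self_sphere, legendre_eval_one, mul_one] at h4
      rw [← h4]
      refine integral_congr_ae (Eventually.of_forall fun x => ?_)
      change legKer l (x, pole) * star (legKer l (x, pole)) = _
      rw [star_legKer, mul_comm]
    rw [h0, inner_zero_left] at h3
    have : (0 : ℝ) < (2 * l + 1 : ℝ) / (4 * Real.pi) := by positivity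
    exact this.ne (by exact_mod_cast h3)
  have h3 := (integralOp (zonalKer κ hκ)).le_opNorm s
  rw [h1, norm_smul, Complex.norm_real, Real.norm_eq_abs] at h3
  exact le_of_mul_le_mul_right h3 (norm_pos_iff.2 h2)

theorem bandProj_comp_integralOp {κ : ℝ → ℝ} (hκ : Continuous κ) (L : ℕ) :
    (bandProj L).comp (integralOp (zonalKer κ hκ))
      = ∑ l ∈ Finset.range (L + 1), (fhCoeff κ l : ℂ) • integralOp (legKer l) := by
  unfold bandProj
  rw [ContinuousLinearMap.finsetSum_comp]
  refine Finset.sum_congr rfl fun l _ => ?_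
  rw [← integralOp_smul]
  exact integralOp_comp fun x y => integral_legKer_mul_zonalKer hκ l x y

theorem norm_sub_bandProj_apply_le (L : ℕ) (x : L2S) :
    ‖(ContinuousLinearMap.id ℂ L2S - bandProj L) x‖ ≤ 2 * ‖x‖ := by
  change ‖x - bandProj L x‖ ≤ _
  have h1 := norm_sub_le x (bandProj L x)
  have h2 := norm_bandProj_apply_le L x
  linarith

theorem enorm_sub_bandProj_apply_le (L : ℕ) (x : L2S) :
    ‖(ContinuousLinearMap.id ℂ L2S - bandProj L) x‖ₑ ≤ 2 * ‖x‖ₑ := by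
  calc _ = ENNReal.ofReal ‖(ContinuousLinearMap.id ℂ L2S - bandProj L) x‖ :=
        (ofReal_norm _).symm
    _ ≤ ENNReal.ofReal (2 * ‖x‖) := ENNReal.ofReal_le_ofReal (norm_sub_bandProj_apply_le L x)
    _ = _ := by rw [ENNReal.ofReal_mul (by norm_num), ofReal_norm]; norm_num

theorem enorm_sub_bandProj_le (L : ℕ) : ‖ContinuousLinearMap.id ℂ L2S - bandProj L‖ₑ ≤ 2 := by
  calc _ = ENNReal.ofReal ‖ContinuousLinearMap.id ℂ L2S - bandProj L‖ := (ofReal_norm _).symm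
    _ ≤ ENNReal.ofReal 2 := ENNReal.ofReal_le_ofReal <|
        ContinuousLinearMap.opNorm_le_bound _ (by norm_num) (norm_sub_bandProj_apply_le L)
    _ = 2 := by norm_num

theorem tendsto_sub_bandProj (x : L2S) :
    Tendsto (fun L => (ContinuousLinearMap.id ℂ L2S - bandProj L) x) atTop (𝓝 0) := by
  have := (tendsto_bandProj x).const_sub x
  rw [sub_self] at this
  exact this

/-- Dominated convergence over `t`, with majorant `2 * traceNorm (R t)`: each term tends to zero as
the complementary projections tend strongly to zero. -/
theorem exists_tail_traceNorm_lt {R : ℤ → L2S →L[ℂ] L2S} (hR : ∑' t, traceNorm (R t) ≠ ∞)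
    {ε : ℝ≥0∞} (hε : 0 < ε) : ∃ L, ∑' t,
      traceNorm ((ContinuousLinearMap.id ℂ L2S - bandProj L).comp (R t)) < ε := by
  have hb : ∑' t, 2 * traceNorm (R t) ≠ ∞ := by
    rw [ENNReal.tsum_mul_left]
    exact ENNReal.mul_ne_top (by norm_num) hR
  have h := tendsto_ennreal_tsum_of_dominated (F := fun L t =>
    traceNorm ((ContinuousLinearMap.id ℂ L2S - bandProj L).comp (R t))) hb (fun L t => ?_)
    fun t => tendsto_traceNorm_comp (ENNReal.ne_top_of_tsum_ne_top hR t) (C := 2) (by norm_num)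
      enorm_sub_bandProj_apply_le tendsto_sub_bandProj
  · exact (h.eventually_lt_const hε).exists
  · exact (traceNorm_comp_le _ _).trans (mul_le_mul_left (enorm_sub_bandProj_le L) _)

/-! ### Approximation of spectral densities -/

/-- The algebra common to both parts: the difference of the spectra is a finite combination with
scalar spectral errors as coefficients, minus the transform of the tail. In the trace-norm case it
is applied in the operator norm, and the trace norm is estimated afterwards. -/
theorem tsum_smul_sub_tsum_smul {V : Type*} [NormedAddCommGroup V] [NormedSpace ℂ V]
    [CompleteSpace V] (L : ℕ) (D : ℕ → V) {c c' : ℕ → ℤ → ℝ} {E R R' : ℤ → V}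
    (hc : ∀ l, Summable fun t => |c l t|) (hc' : ∀ l, Summable fun t => |c' l t|)
    (hE : Summable fun t => ‖E t‖)
    (hR : ∀ t, R t = ∑ l ∈ Finset.range (L + 1), (c l t : ℂ) • D l + E t)
    (hR' : ∀ t, R' t = ∑ l ∈ Finset.range (L + 1), (c' l t : ℂ) • D l) (lam : ℝ) :
    ∑' t : ℤ, Complex.exp (-(Complex.I * (lam : ℂ) * (t : ℂ))) • R' t
      - ∑' t : ℤ, Complex.exp (-(Complex.I * (lam : ℂ) * (t : ℂ))) • R t
    = ∑ l ∈ Finset.range (L + 1), (∑' t : ℤ, Complex.exp (-(Complex.I * (lam : ℂ) * (t : ℂ))) *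
        ((c' l t - c l t : ℝ) : ℂ)) • D l
      - ∑' t : ℤ, Complex.exp (-(Complex.I * (lam : ℂ) * (t : ℂ))) • E t := by
  set e : ℤ → ℂ := fun t => Complex.exp (-(Complex.I * (lam : ℂ) * (t : ℂ))) with he
  have hsum : ∀ {a : ℕ → ℤ → ℝ}, (∀ l, Summable fun t => |a l t|) →
      HasSum (fun t => e t • ∑ l ∈ Finset.range (L + 1), (a l t : ℂ) • D l)
        (∑ l ∈ Finset.range (L + 1), (∑' t, e t * (a l t : ℂ)) • D l) := by
    intro a ha
    simp only [Finset.smul_sum, smul_smul]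
    exact hasSum_sum fun l _ => (summable_exp_mul (ha l) lam).hasSum.smul_const (D l)
  have hEs : Summable fun t => e t • E t := by
    refine Summable.of_norm (hE.congr fun t => ?_)
    rw [norm_smul, norm_exp_neg_I_mul, one_mul]
  have h1 : ∑' t, e t • R' t = ∑ l ∈ Finset.range (L + 1), (∑' t, e t * (c' l t : ℂ)) • D l := by
    simp only [hR']
    exact (hsum hc').tsum_eq
  have h2 : ∑' t, e t • R t
      = ∑ l ∈ Finset.range (L + 1), (∑' t, e t * (c l t : ℂ)) • D l + ∑' t, e t • E t := by
    simp only [hR, smul_add]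
    exact ((hsum hc).add hEs.hasSum).tsum_eq
  have h3 : ∀ l, ∑' t, e t * ((c' l t - c l t : ℝ) : ℂ)
      = ∑' t, e t * (c' l t : ℂ) - ∑' t, e t * (c l t : ℂ) := fun l => by
    simp only [Complex.ofReal_sub, mul_sub]
    exact (summable_exp_mul (hc' l) lam).tsum_sub (summable_exp_mul (hc l) lam)
  change ∑' t, e t • R' t - ∑' t, e t • R t
    = ∑ l ∈ Finset.range (L + 1), (∑' t, e t * ((c' l t - c l t : ℝ) : ℂ)) • D l
      - ∑' t, e t • E t
  rw [h1, h2]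
  simp only [h3, sub_smul, Finset.sum_sub_distrib]
  abel

theorem traceNorm_tsum_le {H : Type*} [NormedAddCommGroup H] [InnerProductSpace ℂ H]
    [CompleteSpace H] {ι : Type*} [Countable ι] {A : ι → H →L[ℂ] H} (hA : Summable A) :
    traceNorm (∑' i, A i) ≤ ∑' i, traceNorm (A i) :=
  traceNorm_le_tsum_traceNorm fun x =>
    hA.hasSum.map (ContinuousLinearMap.apply ℂ H x) (ContinuousLinearMap.apply ℂ H x).continuous

theorem norm_one_div_two_pi_le : ‖(1 / (2 * (Real.pi : ℂ)))‖ ≤ 1 := by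
  rw [show (1 / (2 * (Real.pi : ℂ))) = ((1 / (2 * Real.pi) : ℝ) : ℂ) by push_cast; ring,
    Complex.norm_real, Real.norm_eq_abs, abs_of_pos (by positivity),
    div_le_one (by positivity)]
  linarith [Real.pi_gt_three]

section

variable {Ω : Type*} [MeasurableSpace Ω] {μ : Measure Ω} {T : S2 → ℤ → Ω → ℝ} {L : ℕ}
  {C : ℕ → ℝ} {ψ : ℕ → ℤ → ℝ}

theorem covCont_linearField (hψ : ∀ l, Summable fun n => |ψ l n|) (hC : ∀ l, 0 ≤ C l) (t : ℤ) :
    covCont (hasContinuousCov_linearField (L := L) hψ hC) t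
      = ∑ l ∈ Finset.range (L + 1), ((C l * maCov (ψ l) t : ℝ) : ℂ) • legKer l := by
  ext z
  rw [ContinuousMap.sum_apply]
  change ((covKernel seedLaw (linearField L C ψ) t z.1 z.2 : ℝ) : ℂ) = _
  rw [covKernel_linearField hψ hC, Complex.ofReal_sum]
  refine Finset.sum_congr rfl fun l _ => ?_
  rw [ContinuousMap.smul_apply, smul_eq_mul, Complex.ofReal_mul]
  rfl

theorem summable_mul_maCov (hψ : ∀ l, Summable fun n => |ψ l n|) (C : ℕ → ℝ) (l : ℕ) :
    Summable fun t => |C l * maCov (ψ l) t| := by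
  simp only [abs_mul]
  exact (summable_maCov (hψ l)).mul_left _

theorem covL2_linearField (hψ : ∀ l, Summable fun n => |ψ l n|) (hC : ∀ l, 0 ≤ C l) (t : ℤ) :
    covL2 (hasContinuousCov_linearField (L := L) hψ hC) t
      = ∑ l ∈ Finset.range (L + 1), ((C l * maCov (ψ l) t : ℝ) : ℂ) • kerL2 (legKer l) := by
  rw [covL2, covCont_linearField hψ hC]
  simp only [kerL2, map_sum, map_smul]

theorem covOp_linearField (hψ : ∀ l, Summable fun n => |ψ l n|) (hC : ∀ l, 0 ≤ C l) (t : ℤ) :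
    covOp (hasContinuousCov_linearField (L := L) hψ hC) t
      = ∑ l ∈ Finset.range (L + 1), ((C l * maCov (ψ l) t : ℝ) : ℂ) • integralOp (legKer l) := by
  rw [covOp, covCont_linearField hψ hC, integralOp_sum]
  simp only [integralOp_smul]

theorem summableCovKernels_linearField (hψ : ∀ l, Summable fun n => |ψ l n|) (hC : ∀ l, 0 ≤ C l) :
    SummableCovKernels (hasContinuousCov_linearField (L := L) hψ hC) := by
  have h : Summable fun t => ∑ l ∈ Finset.range (L + 1),
      |C l * maCov (ψ l) t| * ‖kerL2 (legKer l)‖ :=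
    summable_sum fun l _ => (summable_mul_maCov hψ C l).mul_right _
  refine Summable.of_nonneg_of_le (fun _ => norm_nonneg _) (fun t => ?_) h
  rw [covL2_linearField hψ hC]
  refine (norm_sum_le _ _).trans (Finset.sum_le_sum fun l _ => ?_)
  rw [norm_smul, Complex.norm_real, Real.norm_eq_abs]

theorem summableCovOps_linearField (hψ : ∀ l, Summable fun n => |ψ l n|) (hC : ∀ l, 0 ≤ C l) :
    SummableCovOps (hasContinuousCov_linearField (L := L) hψ hC) := by
  have hle : ∀ t, traceNorm (covOp (hasContinuousCov_linearField (L := L) hψ hC) t)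
      ≤ ∑ l ∈ Finset.range (L + 1),
        ENNReal.ofReal |C l * maCov (ψ l) t| * traceNorm (integralOp (legKer l)) := by
    intro t
    rw [covOp_linearField hψ hC]
    refine (traceNorm_sum_le _ _).trans (Finset.sum_le_sum fun l _ => ?_)
    refine (traceNorm_smul_le _ _).trans_eq ?_
    rw [← ofReal_norm, Complex.norm_real, Real.norm_eq_abs]
  refine ne_top_of_le_ne_top ?_ (ENNReal.tsum_le_tsum hle)
  rw [Summable.tsum_finsetSum fun _ _ => ENNReal.summable]
  refine ENNReal.sum_ne_top.2 fun l _ => ?_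
  rw [ENNReal.tsum_mul_right]
  exact ENNReal.mul_ne_top (summable_mul_maCov hψ C l).tsum_ofReal_ne_top (traceNorm_legKer_ne_top l)

theorem exists_specKernel_near [IsProbabilityMeasure μ] (hT : IsIsotropicStationary μ T)
    (hc : HasContinuousCov μ T) (hs : SummableCovKernels hc) {ε : ℝ} (hε : 0 < ε) :
    ∃ (L : ℕ) (C : ℕ → ℝ) (ψ : ℕ → ℤ → ℝ) (hc' : HasContinuousCov seedLaw (linearField L C ψ)),
      IsCausalBandLimitedSPHAR seedLaw (linearField L C ψ) ∧ SummableCovKernels hc' ∧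
      ∀ lam : ℝ, ‖specKernel hc' lam - specKernel hc lam‖ ≤ ε := by
  have hκ := continuous_angularCov hc
  have hcov : ∀ t, covL2 hc t = kerL2 (zonalKer (angularCov μ T t) (hκ t)) := fun t => by
    rw [covL2, covCont_eq_zonalKer hT, kerL2]
  have hs' : Summable fun t => ‖kerL2 (zonalKer (angularCov μ T t) (hκ t))‖ :=
    Summable.congr hs fun t => by rw [hcov]
  have hg : ∀ l, Summable fun t => |angularSpec μ T l t| := fun l =>
    Summable.of_nonneg_of_le (fun _ => abs_nonneg _)
      (fun t => abs_fhCoeff_le_norm_kerL2 (hκ t) l) (hs'.mul_left ‖kerL2 (legKer l)‖)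
  have htail : Tendsto (fun L => ∑' t, ‖tailL2 (angularCov μ T t) (hκ t) L‖) atTop
      (𝓝 (∑' _ : ℤ, (0 : ℝ))) :=
    tendsto_tsum_of_dominated_convergence hs' (fun t => tendsto_norm_tailL2 (hκ t))
      (Eventually.of_forall fun L t => by
        rw [norm_norm]
        exact norm_tailL2_le (hκ t) L)
  rw [tsum_zero] at htail
  obtain ⟨L, hL⟩ := (htail.eventually_lt_const (half_pos hε)).exists
  have hE : Summable fun t => ‖tailL2 (angularCov μ T t) (hκ t) L‖ :=
    Summable.of_nonneg_of_le (fun _ => norm_nonneg _) (fun t => norm_tailL2_le (hκ t) L) hs'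
  set A := ∑ l ∈ Finset.range (L + 1), ‖kerL2 (legKer l)‖ with hA
  have hA0 : 0 ≤ A := Finset.sum_nonneg fun _ _ => norm_nonneg _
  -- The scalar accuracy is chosen so that, weighted by the norms of the `legKer l`, the finite part
  -- costs at most `ε / 2`. The other half is the tail, and the prefactor `1 / (2π)` is simply
  -- bounded by one.
  obtain ⟨C, ψ, hC, hψ, hsp, hnear⟩ := exists_linearField_near L (angularSpec μ T) hg
    (angularSpec_neg hT) (fun l => tsum_angularSpec_mul_cos_nonneg hT hc l (hg l))
    (δ := ε / 2 / (A + 1)) (by positivity)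
  refine ⟨L, C, ψ, hasContinuousCov_linearField hψ hC, hsp, summableCovKernels_linearField hψ hC,
    fun lam => ?_⟩
  unfold specKernel
  rw [← smul_sub, tsum_smul_sub_tsum_smul L (fun l => kerL2 (legKer l)) hg
    (summable_mul_maCov hψ C) hE (fun t => by
      rw [hcov, tailL2]
      exact (add_sub_cancel _ _).symm)
    (covL2_linearField hψ hC) lam, norm_smul]
  refine (mul_le_of_le_one_left (norm_nonneg _) norm_one_div_two_pi_le).trans
    ((norm_sub_le _ _).trans ?_)
  have h1 : ‖∑ l ∈ Finset.range (L + 1), (∑' t : ℤ,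
      Complex.exp (-(Complex.I * (lam : ℂ) * (t : ℂ))) *
        ((C l * maCov (ψ l) t - angularSpec μ T l t : ℝ) : ℂ)) • kerL2 (legKer l)‖ ≤ ε / 2 := by
    calc _ ≤ ∑ l ∈ Finset.range (L + 1), ε / 2 / (A + 1) * ‖kerL2 (legKer l)‖ := by
          refine (norm_sum_le _ _).trans (Finset.sum_le_sum fun l hl => ?_)
          rw [norm_smul]
          exact mul_le_mul_of_nonneg_right
            (hnear l (by have := Finset.mem_range.1 hl; omega) lam) (norm_nonneg _)
      _ = ε / 2 / (A + 1) * A := by rw [hA, Finset.mul_sum]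
      _ ≤ ε / 2 := by
          rw [div_mul_eq_mul_div, div_le_iff₀ (by positivity)]
          nlinarith
  have h2 : ‖∑' t : ℤ, Complex.exp (-(Complex.I * (lam : ℂ) * (t : ℂ))) •
      tailL2 (angularCov μ T t) (hκ t) L‖ ≤ ε / 2 := by
    have e : ∀ t : ℤ, ‖Complex.exp (-(Complex.I * (lam : ℂ) * (t : ℂ))) •
        tailL2 (angularCov μ T t) (hκ t) L‖ = ‖tailL2 (angularCov μ T t) (hκ t) L‖ := fun t => by
      rw [norm_smul, norm_exp_neg_I_mul, one_mul]
    refine (norm_tsum_le_tsum_norm (hE.congr fun t => (e t).symm)).trans ?_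
    simp only [e]
    exact hL.le
  linarith

theorem exists_specOp_near [IsProbabilityMeasure μ] (hT : IsIsotropicStationary μ T)
    (hc : HasContinuousCov μ T) (hs : SummableCovOps hc) {ε : ℝ} (hε : 0 < ε) :
    ∃ (L : ℕ) (C : ℕ → ℝ) (ψ : ℕ → ℤ → ℝ) (hc' : HasContinuousCov seedLaw (linearField L C ψ)),
      IsCausalBandLimitedSPHAR seedLaw (linearField L C ψ) ∧ SummableCovOps hc' ∧
      ∀ lam : ℝ, traceNorm (specOp hc' lam - specOp hc lam) ≤ ENNReal.ofReal ε := by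
  have hκ := continuous_angularCov hc
  have hcov : ∀ t, covOp hc t = integralOp (zonalKer (angularCov μ T t) (hκ t)) := fun t => by
    rw [covOp, covCont_eq_zonalKer hT]
  obtain ⟨L, hL⟩ := exists_tail_traceNorm_lt hs (ε := ENNReal.ofReal (ε / 2))
    (ENNReal.ofReal_pos.2 (half_pos hε))
  -- The tail is taken by composing with the complementary projection on the left; since `R_t` acts
  -- as a scalar on each harmonic space, what is removed is exactly the finite combination of the
  -- `integralOp (legKer l)`.
  set E : ℤ → L2S →L[ℂ] L2S := fun t =>
    (ContinuousLinearMap.id ℂ L2S - bandProj L).comp (covOp hc t) with hEdef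
  have hsumm : ∀ {R : ℤ → L2S →L[ℂ] L2S}, ∑' t, traceNorm (R t) ≠ ∞ →
      Summable fun t => ‖R t‖ := fun {R} hR => by
    have h1 : ∑' t, ‖R t‖ₑ ≠ ∞ :=
      ne_top_of_le_ne_top hR (ENNReal.tsum_le_tsum fun t => enorm_le_traceNorm _)
    exact (ENNReal.summable_toReal h1).congr fun t => toReal_enorm _
  have hE : Summable fun t => ‖E t‖ := hsumm hL.ne_top
  have hg : ∀ l, Summable fun t => |angularSpec μ T l t| := fun l =>
    Summable.of_nonneg_of_le (fun _ => abs_nonneg _)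
      (fun t => (abs_fhCoeff_le_norm_integralOp (hκ t) l).trans_eq (by rw [hcov])) (hsumm hs)
  set A := ∑ l ∈ Finset.range (L + 1), traceNorm (integralOp (legKer l)) with hA
  have hAtop : A ≠ ∞ := ENNReal.sum_ne_top.2 fun l _ => traceNorm_legKer_ne_top l
  have hA0 : 0 ≤ A.toReal := ENNReal.toReal_nonneg
  obtain ⟨C, ψ, hC, hψ, hsp, hnear⟩ := exists_linearField_near L (angularSpec μ T) hg
    (angularSpec_neg hT) (fun l => tsum_angularSpec_mul_cos_nonneg hT hc l (hg l))
    (δ := ε / 2 / (A.toReal + 1)) (by positivity)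
  refine ⟨L, C, ψ, hasContinuousCov_linearField hψ hC, hsp, summableCovOps_linearField hψ hC,
    fun lam => ?_⟩
  have hdec : ∀ t, covOp hc t = ∑ l ∈ Finset.range (L + 1),
      (angularSpec μ T l t : ℂ) • integralOp (legKer l) + E t := fun t => by
    have h1 := bandProj_comp_integralOp (hκ t) L
    rw [← hcov] at h1
    simp only [angularSpec]
    rw [← h1, hEdef]
    ext1 x
    simp
  unfold specOp
  rw [← smul_sub, tsum_smul_sub_tsum_smul L (fun l => integralOp (legKer l)) hg
    (summable_mul_maCov hψ C) hE hdec (covOp_linearField hψ hC) lam]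
  have hone : ‖(1 / (2 * (Real.pi : ℂ)))‖ₑ ≤ 1 := by
    rw [← ofReal_norm, ← ENNReal.ofReal_one]
    exact ENNReal.ofReal_le_ofReal norm_one_div_two_pi_le
  refine (traceNorm_smul_le _ _).trans ((mul_le_of_le_one_left zero_le hone).trans ?_)
  have h1 : traceNorm (∑ l ∈ Finset.range (L + 1), (∑' t : ℤ,
      Complex.exp (-(Complex.I * (lam : ℂ) * (t : ℂ))) *
        ((C l * maCov (ψ l) t - angularSpec μ T l t : ℝ) : ℂ)) • integralOp (legKer l))
      ≤ ENNReal.ofReal (ε / 2) := by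
    calc _ ≤ ∑ l ∈ Finset.range (L + 1), ENNReal.ofReal (ε / 2 / (A.toReal + 1)) *
          traceNorm (integralOp (legKer l)) := by
          refine (traceNorm_sum_le _ _).trans (Finset.sum_le_sum fun l hl => ?_)
          refine (traceNorm_smul_le _ _).trans (mul_le_mul_left ?_ _)
          rw [← ofReal_norm]
          exact ENNReal.ofReal_le_ofReal (hnear l (by have := Finset.mem_range.1 hl; omega) lam)
      _ = ENNReal.ofReal (ε / 2 / (A.toReal + 1)) * A := by rw [hA, Finset.mul_sum]
      _ = ENNReal.ofReal (ε / 2 / (A.toReal + 1) * A.toReal) := by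
          rw [ENNReal.ofReal_mul (by positivity), ENNReal.ofReal_toReal hAtop]
      _ ≤ ENNReal.ofReal (ε / 2) := by
          refine ENNReal.ofReal_le_ofReal ?_
          rw [div_mul_eq_mul_div, div_le_iff₀ (by positivity)]
          nlinarith
  have h2 : traceNorm (∑' t : ℤ, Complex.exp (-(Complex.I * (lam : ℂ) * (t : ℂ))) • E t)
      ≤ ENNReal.ofReal (ε / 2) := by
    have hsE : Summable fun t : ℤ => Complex.exp (-(Complex.I * (lam : ℂ) * (t : ℂ))) • E t :=
      Summable.of_norm (hE.congr fun t => by rw [norm_smul, norm_exp_neg_I_mul, one_mul])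
    refine (traceNorm_tsum_le hsE).trans ?_
    refine le_trans (ENNReal.tsum_le_tsum fun t => ?_) hL.le
    refine (traceNorm_smul_le _ _).trans_eq ?_
    rw [← ofReal_norm, norm_exp_neg_I_mul, ENNReal.ofReal_one, one_mul]
  rw [sub_eq_add_neg, ← neg_one_smul ℂ (∑' t : ℤ, _)]
  refine (traceNorm_add_le _ _).trans ?_
  rw [show ε = ε / 2 + ε / 2 by ring, ENNReal.ofReal_add (half_pos hε).le (half_pos hε).le]
  refine add_le_add h1 ((traceNorm_smul_le _ _).trans ?_)
  rw [enorm_neg, enorm_one, one_mul]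
  exact h2

end

end SphereTime

end

theorem mainTheorem3 {Ω : Type*} [MeasurableSpace Ω] (μ : Measure Ω) [IsProbabilityMeasure μ]
    (T : S2 → ℤ → Ω → ℝ) (hT : IsIsotropicStationary μ T) (hc : HasContinuousCov μ T) :
    (SummableCovKernels hc → ∀ ε : ℝ, 0 < ε →
      ∃ (Ω' : Type) (_ : MeasurableSpace Ω') (μ' : Measure Ω') (_ : IsProbabilityMeasure μ')
        (T' : S2 → ℤ → Ω' → ℝ) (hc' : HasContinuousCov μ' T'),
        IsCausalBandLimitedSPHAR μ' T' ∧ SummableCovKernels hc' ∧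
        ∀ lam ∈ Set.Icc (-Real.pi) Real.pi, ‖specKernel hc' lam - specKernel hc lam‖ ≤ ε) ∧
    (SummableCovOps hc → ∀ ε : ℝ, 0 < ε →
      ∃ (Ω' : Type) (_ : MeasurableSpace Ω') (μ' : Measure Ω') (_ : IsProbabilityMeasure μ')
        (T' : S2 → ℤ → Ω' → ℝ) (hc' : HasContinuousCov μ' T'),
        IsCausalBandLimitedSPHAR μ' T' ∧ SummableCovOps hc' ∧
        ∀ lam ∈ Set.Icc (-Real.pi) Real.pi,
          traceNorm (specOp hc' lam - specOp hc lam) ≤ ENNReal.ofReal ε) := by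
  refine ⟨fun hs ε hε => ?_, fun hs ε hε => ?_⟩
  · obtain ⟨L, C, ψ, hc', h1, h2, h3⟩ := exists_specKernel_near hT hc hs hε
    exact ⟨SeedSpace, inferInstance, seedLaw, inferInstance, linearField L C ψ, hc', h1, h2,
      fun lam _ => h3 lam⟩
  · obtain ⟨L, C, ψ, hc', h1, h2, h3⟩ := exists_specOp_near hT hc hs hε
    exact ⟨SeedSpace, inferInstance, seedLaw, inferInstance, linearField L C ψ, hc', h1, h2,
      fun lam _ => h3 lam⟩
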